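/- **Setting.** Let $N\ge 1$ players $i\in[N]=\{1,\dots,N\}$ have decision sets $X_i\subseteq\mathbb{R}^{d_i}$, aggregation maps $\psi_i:\mathbb{R}^{d_i}\to\mathbb{R}^n$ and constraint functions $g_i:\mathbb{R}^{d_i}\to\mathbb{R}^m$. Put $\sigma(x)=\frac1N\sum_i\psi_i(x_i)$ and $g(x)=\sum_i g_i(x_i)$ for $x=(x_1,\dots,x_N)$. Player $i$ minimizes $f_i(x_i,\sigma(x))$ over $x_i\in X_i$ subject to $g(x)\le 0$, where $f_i(x_i,y)=\mathbb{E}[F_{i,t}(x_i,y,\xi_i)]$ does not depend on $t\ge0$, $\xi_i$ is a random vector in $\mathbb{R}^{q_i}$, the expectations exist, and $F_{i,t}(\cdot,\cdot,s)$ is differentiable at the points of $X_i\times\mathbb{R}^n$ for every $s$. Write $$p_i(x_i,y)=\nabla_1f_i(x_i,y)+\tfrac1N\nabla\psi_i(x_i)\nabla_2f_i(x_i,y),\qquad q_{i,t}(x_i,y,s)=\nabla_1F_{i,t}(x_i,y,s)+\tfrac1N\nabla\psi_i(x_i)\nabla_2F_{i,t}(x_i,y,s),$$ with $q_{i,t}$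 measurable on $X_i\times\mathbb{R}^n\times\mathbb{R}^{q_i}$, and $G(x)=(p_i(x_i,\sigma(x)))_{i\in[N]}$. A point $x^*$ is a *variational generalized Nash equilibrium* (vGNE) if $x^*\in X_1\times\cdots\times X_N$, $g(x^*)\le0$, no player can lower its cost by a unilateral change of its decision that keeps the joint decision feasible, and for some $\mu^*\in\mathbb{R}^m_+$ common to all players $0\in p_i(x_i^*,\sigma(x^*))+\nabla g_i(x_i^*)\mu^*+\mathbf N_{X_i}(x_i^*)$ for all $i$ and $0\in-g(x^*)+\mathbf N_{\mathbb{R}^m_+}(\mu^*)$, where $\mathbf N$ denotes the normal cone. **Assumptions.** 1. The weight matrices $\mathcal W_t=[w_{ij,t}]\in\mathbb{R}^{N\times N}$, $t\ge0$, are nonnegative with positive diagonal and column sums $1$; all positive entries are at least some $\underline w\in(0,1)$; and for some integer $U>0$ and every $t\ge 0$ the union over $l=0,\dots,U-1$ of the graphs with edges $\{(j,i):w_{ij,t+l}>0\}$ is strongly connected. 2. Each $X_i$ is nonempty, convex and compact; there is $x\in X_1\times\cdots\times X_N$ with $g(x)<0$ componentwise (Slater); $f_i$ is differentiable at the points of $X_i\times\mathbb{R}^n$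 and $f_i(x_i,\sigma(x))$ is convex in $x_i\in X_i$ for every fixed choice of the other players' decisions; the components of $g_i$ are differentiable and convex on $X_i$, with $\nabla g_i$ bounded on $X_i$; $\psi_i$ is differentiable and Lipschitz continuous on $X_i$. 3. For some $L_f>0$, $\|p_i(x_i,y)-p_i(x_i,y')\|\le L_f\|y-y'\|$ for all $i$, $x_i\in X_i$, $y,y'\in\mathbb{R}^n$. 4. The samples $\xi_{i,t}$ ($i\in[N]$, $t\ge0$), defined on one probability space, have the law of $\xi_i$. Let $\mathscr F_t$ be the $\sigma$-algebra generated by $\xi_{i,s}$, $i\in[N]$, $0\le s\le t-1$ ($\mathscr F_0$ is trivial). There is $S>0$ such that for all $t\ge 0$, $i\in[N]$ and all $\mathscr F_t$-measurable $x_i\in X_i$, $y\in\mathbb{R}^n$, almost surely $\mathbb{E}[q_{i,t}(x_i,y,\xi_{i,t})\mid\mathscr F_t]=p_i(x_i,y)$ and $\|q_{i,t}(x_i,y,\xi_{i,t})\|\le S$. 5. $G$ is strictly monotone: $\langle G(x)-G(x'),x-x'\rangle>0$ for all $x\ne x'$ in $X_1\times\cdots\times X_N$. **Algorithm.** Let $\alpha_t,\beta_t,\gamma_t\in(0,1]$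 be non-increasing. Start from $z_{i,0}=1$, a deterministic $x_{i,0}\in X_i$, $\mu_{i,0}=0$, $\sigma_{i,0}=\psi_i(x_{i,0})$, and for $t\ge0$ let $$z_{i,t+1}=\sum_jw_{ij,t}z_{j,t},\quad\hat\mu_{i,t}=\sum_jw_{ij,t}\mu_{j,t},\quad\hat\sigma_{i,t}=\sum_jw_{ij,t}\sigma_{j,t},$$ $$s_{i,t+1}=q_{i,t}\Big(x_{i,t},\frac{\hat\sigma_{i,t}}{z_{i,t+1}},\xi_{i,t}\Big)+\nabla g_i(x_{i,t})\frac{\hat\mu_{i,t}}{z_{i,t+1}},\quad x_{i,t+1}=\Pi_{X_i}[x_{i,t}-\alpha_ts_{i,t+1}],$$ $$\mu_{i,t+1}=\Pi_{\mathbb{R}^m_+}\big[\hat\mu_{i,t}+\gamma_t(g_i(x_{i,t})-\beta_t\hat\mu_{i,t})\big],\quad\sigma_{i,t+1}=\hat\sigma_{i,t}+\psi_i(x_{i,t+1})-\psi_i(x_{i,t}),$$ where $\Pi$ denotes Euclidean projection. **Theorem.** Under assumptions 1–5, if $\alpha_t=\gamma_t$ for all $t$ and $$\sum_{t=1}^\infty\alpha_t=\infty,\quad\sum_{t=1}^\infty\alpha_t^2<\infty,\quad\sum_{t=1}^\infty\frac{\alpha_t^2}{\beta_t^2}<\infty,\quad\sum_{t=1}^\infty\alpha_t\beta_t<\infty,\quad\sum_{t=1}^\infty\frac{\alpha_t^2}{\beta_t}<\infty,$$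 then the game has exactly one vGNE $x^*$, and $x_t=(x_{1,t},\dots,x_{N,t})$ converges to $x^*$ almost surely. -/

import Mathlib

open MeasureTheory Filter Topology
open scoped BigOperators

noncomputable section

/-- `ℝ^k` with its Euclidean norm. -/
abbrev Eu (k : ℕ) : Type := EuclideanSpace ℝ (Fin k)

/-- The Euclidean projection `Π_S[v] = argmin_{u ∈ S} ‖u - v‖` (it exists and is unique when `S` is
nonempty, closed and convex). -/
def proj {k : ℕ} (S : Set (Eu k)) (v : Eu k) : Eu k :=
  Classical.epsilon fun u => u ∈ S ∧ ∀ y ∈ S, ‖u - v‖ ≤ ‖y - v‖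

/-- The nonnegative orthant `ℝ^k_+`. -/
def nonnegOrthant (k : ℕ) : Set (Eu k) := {v | ∀ j, 0 ≤ v j}

/-- The normal cone `N_S(x) = {s | ⟨s, y - x⟩ ≤ 0 for all y ∈ S}` at a point `x ∈ S`
(empty when `x ∉ S`). -/
def normalCone {k : ℕ} (S : Set (Eu k)) (x : Eu k) : Set (Eu k) :=
  {s | x ∈ S ∧ ∀ y ∈ S, inner ℝ s (y - x) ≤ 0}

/-- Data of an online stochastic aggregative game with `N` players, decisions `x_i ∈ ℝ^{d_i}`,
an aggregate in `ℝ^n`, `m` coupled constraints, and random data in `ℝ^{q_i}`. -/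
structure AggGame (N m n : ℕ) (d q : Fin N → ℕ) where
  /-- local feasible sets `X_i` -/
  X : (i : Fin N) → Set (Eu (d i))
  /-- contributions `ψ_i` to the aggregate -/
  ψ : (i : Fin N) → Eu (d i) → Eu n
  /-- sample costs `F_{i,t}(x_i, σ, ξ_i)` -/
  F : ℕ → (i : Fin N) → Eu (d i) → Eu n → Eu (q i) → ℝ
  /-- constraint functions `g_{i,t}` -/
  g : ℕ → (i : Fin N) → Eu (d i) → Eu m
  /-- the law of the random vector `ξ_i` -/
  law : (i : Fin N) → ProbabilityMeasure (Eu (q i))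

namespace AggGame

variable {N m n : ℕ} {d q : Fin N → ℕ} (Γ : AggGame N m n d q)

/-- The expected cost `f_{i,t}(x_i, σ) = E[F_{i,t}(x_i, σ, ξ_i)]`. -/
def cost (t : ℕ) (i : Fin N) (x : Eu (d i)) (y : Eu n) : ℝ :=
  ∫ s, Γ.F t i x y s ∂(Γ.law i : Measure (Eu (q i)))

/-- The aggregate `σ(x) = (1/N) ∑ ψ_i(x_i)`. -/
def agg (x : (i : Fin N) → Eu (d i)) : Eu n := (N : ℝ)⁻¹ • ∑ i, Γ.ψ i (x i)

/-- The total constraint function `g_t(x) = ∑ g_{i,t}(x_i)`. -/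
def gSum (t : ℕ) (x : (i : Fin N) → Eu (d i)) : Eu m := ∑ i, Γ.g t i (x i)

/-- `∇ψ_i(x) v`, where the columns of `∇ψ_i(x)` are the gradients of the components of `ψ_i`. -/
def gradψ (i : Fin N) (x : Eu (d i)) (v : Eu n) : Eu (d i) :=
  ContinuousLinearMap.adjoint (fderiv ℝ (Γ.ψ i) x) v

/-- `∇g_{i,t}(x) v = ∑_j v_j ∇g_{ij,t}(x)`. -/
def gradg (t : ℕ) (i : Fin N) (x : Eu (d i)) (v : Eu m) : Eu (d i) :=
  ContinuousLinearMap.adjoint (fderiv ℝ (Γ.g t i) x) v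

/-- `p_{i,t}(x, y) = ∇₁ f_{i,t}(x, y) + (∇ψ_i(x) / N) ∇₂ f_{i,t}(x, y)`. -/
def p (t : ℕ) (i : Fin N) (x : Eu (d i)) (y : Eu n) : Eu (d i) :=
  gradient (fun u => Γ.cost t i u y) x
    + (N : ℝ)⁻¹ • Γ.gradψ i x (gradient (fun v => Γ.cost t i x v) y)

/-- The sampled gradient
`q_{i,t}(x, y, s) = ∇₁ F_{i,t}(x, y, s) + (∇ψ_i(x) / N) ∇₂ F_{i,t}(x, y, s)`. -/
def qs (t : ℕ) (i : Fin N) (x : Eu (d i)) (y : Eu n) (s : Eu (q i)) : Eu (d i) :=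
  gradient (fun u => Γ.F t i u y s) x
    + (N : ℝ)⁻¹ • Γ.gradψ i x (gradient (fun v => Γ.F t i x v s) y)

/-- The pseudo-gradient, whose `i`-th block is `∇_{x_i} f_{i,t}(x_i, σ(x)) = p_{i,t}(x_i, σ(x))`. -/
def pseudoGradient (t : ℕ) (x : (i : Fin N) → Eu (d i)) (i : Fin N) : Eu (d i) :=
  Γ.p t i (x i) (Γ.agg x)

/-- The joint feasible set `X_t = (X_1 × ⋯ × X_N) ∩ {x | g_t(x) ≤ 0}`. -/
def feasible (t : ℕ) : Set ((i : Fin N) → Eu (d i)) :=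
  {x | (∀ i, x i ∈ Γ.X i) ∧ ∀ j, Γ.gSum t x j ≤ 0}

/-- Generalized Nash equilibrium: no player can lower its cost by a unilateral feasible change. -/
def IsGNE (t : ℕ) (x : (i : Fin N) → Eu (d i)) : Prop :=
  x ∈ Γ.feasible t ∧ ∀ (i : Fin N) (u : Eu (d i)), Function.update x i u ∈ Γ.feasible t →
    Γ.cost t i (x i) (Γ.agg x) ≤ Γ.cost t i u (Γ.agg (Function.update x i u))

/-- Variational GNE: a GNE satisfying the KKT conditions with one multiplier common to all players,
`0 ∈ ∇_{x_i} f_{i,t}(x_i, σ(x)) + ∇g_{i,t}(x_i) μ + N_{X_i}(x_i)` and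
`0 ∈ -g_t(x) + N_{ℝ^m_+}(μ)`. -/
def IsVGNE (t : ℕ) (x : (i : Fin N) → Eu (d i)) : Prop :=
  Γ.IsGNE t x ∧ ∃ μ : Eu m,
    (∀ i, -(Γ.pseudoGradient t x i + Γ.gradg t i (x i) μ) ∈ normalCone (Γ.X i) (x i)) ∧
    Γ.gSum t x ∈ normalCone (nonnegOrthant m) μ

/-- The expected costs and the constraint functions do not depend on time. -/
def IsTimeInvariant : Prop :=
  (∀ t i x y, Γ.cost t i x y = Γ.cost 0 i x y) ∧ ∀ t i x, Γ.g t i x = Γ.g 0 i x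

/-- The expectations that define the costs exist, the sample costs are differentiable, and the
sampled gradients are measurable. -/
structure WellPosed : Prop where
  integrable : ∀ t i x y, Integrable (Γ.F t i x y) (Γ.law i : Measure (Eu (q i)))
  differentiable : ∀ t i, ∀ x ∈ Γ.X i, ∀ y s,
    DifferentiableAt ℝ (fun z : Eu (d i) × Eu n => Γ.F t i z.1 z.2 s) (x, y)
  measurable : ∀ t i,
    Measurable (fun z : (Γ.X i) × Eu n × Eu (q i) => Γ.qs t i (z.1 : Eu (d i)) z.2.1 z.2.2)

/-- Standing assumptions on the sets, costs, constraints and aggregation functions. -/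
structure Regular : Prop where
  nonempty : ∀ i, (Γ.X i).Nonempty
  convex : ∀ i, Convex ℝ (Γ.X i)
  compact : ∀ i, IsCompact (Γ.X i)
  slater : ∀ t, ∃ x : (i : Fin N) → Eu (d i), (∀ i, x i ∈ Γ.X i) ∧ ∀ j, Γ.gSum t x j < 0
  cost_diff : ∀ t i, ∀ x ∈ Γ.X i, ∀ y,
    DifferentiableAt ℝ (fun z : Eu (d i) × Eu n => Γ.cost t i z.1 z.2) (x, y)
  cost_convex : ∀ t i, ∀ x : (j : Fin N) → Eu (d j),
    ConvexOn ℝ (Γ.X i) (fun u => Γ.cost t i u (Γ.agg (Function.update x i u)))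
  g_diff : ∀ t i, ∀ x ∈ Γ.X i, DifferentiableAt ℝ (Γ.g t i) x
  g_convex : ∀ t i j, ConvexOn ℝ (Γ.X i) (fun u => Γ.g t i u j)
  g_grad_bdd : ∃ M > 0, ∀ t i, ∀ x ∈ Γ.X i, ‖fderiv ℝ (Γ.g t i) x‖ ≤ M
  ψ_diff : ∀ i, ∀ x ∈ Γ.X i, DifferentiableAt ℝ (Γ.ψ i) x
  ψ_lip : ∃ L > 0, ∀ i, ∀ x ∈ Γ.X i, ∀ x' ∈ Γ.X i, ‖Γ.ψ i x - Γ.ψ i x'‖ ≤ L * ‖x - x'‖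

/-- `p_{i,t}(x_i, ·)` is Lipschitz, uniformly in `x_i ∈ X_i`. -/
def GradLipschitz : Prop :=
  ∃ L > 0, ∀ t i, ∀ x ∈ Γ.X i, ∀ y y' : Eu n, ‖Γ.p t i x y - Γ.p t i x y'‖ ≤ L * ‖y - y'‖

/-- Strict monotonicity of the pseudo-gradient on `X_1 × ⋯ × X_N`. -/
def StrictlyMonotone (t : ℕ) : Prop :=
  ∀ x x' : (i : Fin N) → Eu (d i), (∀ i, x i ∈ Γ.X i) → (∀ i, x' i ∈ Γ.X i) → x ≠ x' →
    0 < ∑ i, inner ℝ (Γ.pseudoGradient t x i - Γ.pseudoGradient t x' i) (x i - x' i)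

end AggGame

/-- Assumptions on the communication weights: `w t i j = w_{ij,t}`, and `(j, i)` is an edge at time
`t` iff `w t i j > 0`. Weights are nonnegative with positive diagonal, positive weights are bounded
below, columns sum to one, and every union of `U` consecutive graphs is strongly connected. -/
structure GoodWeights {N : ℕ} (w : ℕ → Matrix (Fin N) (Fin N) ℝ) : Prop where
  nonneg : ∀ t i j, 0 ≤ w t i j
  diag_pos : ∀ t i, 0 < w t i i
  lower : ∃ c : ℝ, 0 < c ∧ c < 1 ∧ ∀ t i j, 0 < w t i j → c ≤ w t i j
  col_stochastic : ∀ t j, ∑ i, w t i j = 1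
  connected : ∃ U : ℕ, 0 < U ∧ ∀ t i j,
    Relation.ReflTransGen (fun a b => ∃ l < U, 0 < w (t + l) b a) i j

/-- The natural filtration: `ℱ_t` is generated by `ξ_{i,s}`, `i ∈ [N]`, `s < t`
(so `ℱ_0` is trivial). -/
abbrev sampleFiltration {Ω : Type*} {N : ℕ} {q : Fin N → ℕ} (ξ : (i : Fin N) → ℕ → Ω → Eu (q i))
    (t : ℕ) : MeasurableSpace Ω :=
  ⨆ (i : Fin N) (s : ℕ) (_ : s < t), MeasurableSpace.comap (ξ i s) inferInstance

/-- The stochastic first-order oracle: `ξ_{i,t}` is sampled from `ξ_i`, and for all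
`ℱ_t`-measurable `x ∈ X_i` and `y ∈ ℝ^n`, the sampled gradient `q_{i,t}(x, y, ξ_{i,t})` is
conditionally unbiased given `ℱ_t` and bounded by a constant `S`. -/
structure GoodOracle {Ω : Type*} [MeasurableSpace Ω] (P : Measure Ω) {N m n : ℕ} {d q : Fin N → ℕ}
    (Γ : AggGame N m n d q) (ξ : (i : Fin N) → ℕ → Ω → Eu (q i)) : Prop where
  measurable : ∀ i t, Measurable (ξ i t)
  sampled : ∀ i t, P.map (ξ i t) = Γ.law i
  unbiased : ∀ t i (x : Ω → Eu (d i)) (y : Ω → Eu n), (∀ ω, x ω ∈ Γ.X i) →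
    Measurable[sampleFiltration ξ t] x → Measurable[sampleFiltration ξ t] y →
    P[fun ω => Γ.qs t i (x ω) (y ω) (ξ i t ω) | sampleFiltration ξ t]
      =ᵐ[P] fun ω => Γ.p t i (x ω) (y ω)
  bounded : ∃ S > 0, ∀ t i (x : Ω → Eu (d i)) (y : Ω → Eu n), (∀ ω, x ω ∈ Γ.X i) →
    Measurable[sampleFiltration ξ t] x → Measurable[sampleFiltration ξ t] y →
    ∀ᵐ ω ∂P, ‖Γ.qs t i (x ω) (y ω) (ξ i t ω)‖ ≤ S

/-- The variables `z_{i,t}`, `x_{i,t}`, `μ_{i,t}`, `σ_{i,t}` of all players at one time. -/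
structure AlgState (N m n : ℕ) (d : Fin N → ℕ) where
  z : Fin N → ℝ
  x : (i : Fin N) → Eu (d i)
  μ : Fin N → Eu m
  σ : Fin N → Eu n

namespace AggGame

variable {N m n : ℕ} {d q : Fin N → ℕ} (Γ : AggGame N m n d q)

/-- The initial state: `z = 1`, `x = x_0`, `μ = 0`, `σ_i = ψ_i(x_{i,0})`. -/
def algInit (x₀ : (i : Fin N) → Eu (d i)) : AlgState N m n d where
  z := fun _ => 1
  x := x₀
  μ := fun _ => 0
  σ := fun i => Γ.ψ i (x₀ i)

/-- One iteration of the distributed stochastic primal-dual push-sum algorithm at time `t`, with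
weights `W`, parameters `a = α_t`, `b = β_t`, `c = γ_t` and samples `s i = ξ_{i,t}`. -/
def algStep (t : ℕ) (W : Matrix (Fin N) (Fin N) ℝ) (a b c : ℝ) (s : (i : Fin N) → Eu (q i))
    (S : AlgState N m n d) : AlgState N m n d :=
  let z' : Fin N → ℝ := fun i => ∑ j, W i j * S.z j
  let μh : Fin N → Eu m := fun i => ∑ j, W i j • S.μ j
  let σh : Fin N → Eu n := fun i => ∑ j, W i j • S.σ j
  let dir : (i : Fin N) → Eu (d i) := fun i =>
    Γ.qs t i (S.x i) ((z' i)⁻¹ • σh i) (s i) + Γ.gradg t i (S.x i) ((z' i)⁻¹ • μh i)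
  let x' : (i : Fin N) → Eu (d i) := fun i => proj (Γ.X i) (S.x i - a • dir i)
  { z := z'
    x := x'
    μ := fun i => proj (nonnegOrthant m) (μh i + c • (Γ.g t i (S.x i) - b • μh i))
    σ := fun i => σh i + Γ.ψ i (x' i) - Γ.ψ i (S.x i) }

/-- The state of the algorithm at time `t`, for a given realization `s i t` of the samples. -/
def algRun (w : ℕ → Matrix (Fin N) (Fin N) ℝ) (α β γ : ℕ → ℝ) (x₀ : (i : Fin N) → Eu (d i))
    (s : (i : Fin N) → ℕ → Eu (q i)) : ℕ → AlgState N m n d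
  | 0 => Γ.algInit x₀
  | t + 1 => Γ.algStep t (w t) (α t) (β t) (γ t) (fun i => s i t) (algRun w α β γ x₀ s t)

end AggGame

end

/-! The equilibrium is the decision part of a KKT point, that is, of a zero of the monotone operator
`(x, μ) ↦ (G(x) + ∇g(x)μ, -g(x))` plus normal cones. No continuity of `G` is assumed, so existence
does not rest on a fixed-point theorem. Averages of projected steps yield a point satisfying the
Minty inequalities over a bounded set of multipliers (`exists_forall_le_zero_of_le_inner`,
`exists_saddle`). Slater's condition keeps the multiplier strictly inside that bound. Convexity of
each cost in the player's own decision, together with the Lipschitz dependence on the aggregate,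
controls `G` along segments well enough to pass from Minty to KKT (`exists_isKKT`). Strict
monotonicity gives uniqueness.

Convergence rests on the Lyapunov function `V_t = ‖x_t - x*‖² + N ‖μ̄_t - μ*‖²`, where `μ̄_t` is the
mean of the local multipliers. One step decreases it by `2 α_t φ_t`, with `φ_t` the monotonicity gap
between `x_t` and `x*`, up to noise and errors (`lyapunov_succ_le`). The term `β_t` keeps `β_t
‖μ_t‖` bounded, so update directions are `O(1/β_t)`. The errors are then summable: squared steps
cost `α²/β²`, the regularization costs `αβ`, and projecting the multipliers costs `α²`. Disagreement
contracts geometrically over blocks of steps (`exists_disagreement_contraction`), and costs `α²` for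
the multipliers and `α²/β` for the aggregates. The gradient noise is a martingale bounded in `L²`,
hence almost surely has bounded partial sums.

Therefore `V_t` is bounded and `∑ α_t φ_t < ∞`. Bounded multipliers now improve the increments of
`x_t` from `O(α_t/β_t)` to `O(α_t)`. Since `φ_t` is bounded below while `x_t` stays away from `x*`
(`exists_pos_le_gap`), and `∑ α_t = ∞`, slow increments exclude recurrent excursions
(`tendsto_zero_of_summable_mul`). Neither `V_t` nor the multipliers are shown to converge. -/

noncomputable section

/-! ### Column-stochastic matrices and their products -/

/-- The action of a real matrix on a family of vectors. -/
def matAct {N : ℕ} {E : Type*} [AddCommGroup E] [Module ℝ E] (A : Matrix (Fin N) (Fin N) ℝ)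
    (v : Fin N → E) (i : Fin N) : E := ∑ j, A i j • v j

/-- The product `W_{t+k-1} ⋯ W_t`. -/
def transition {N : ℕ} (w : ℕ → Matrix (Fin N) (Fin N) ℝ) (t : ℕ) : ℕ → Matrix (Fin N) (Fin N) ℝ
  | 0 => 1
  | k + 1 => w (t + k) * transition w t k

section MatAct

variable {N : ℕ} {E : Type*} [NormedAddCommGroup E] [NormedSpace ℝ E]

lemma matAct_one (v : Fin N → E) : matAct 1 v = v := by
  funext i
  simp [matAct, Matrix.one_apply]

lemma matAct_mul (A B : Matrix (Fin N) (Fin N) ℝ) (v : Fin N → E) :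
    matAct (A * B) v = matAct A (matAct B v) := by
  funext i
  simp only [matAct, Matrix.mul_apply, Finset.sum_smul, Finset.smul_sum, smul_smul]
  exact Finset.sum_comm

lemma matAct_sub (A : Matrix (Fin N) (Fin N) ℝ) (u v : Fin N → E) :
    matAct A (u - v) = matAct A u - matAct A v := by
  funext i
  simp [matAct, smul_sub, Finset.sum_sub_distrib]

lemma matAct_smul_const (A : Matrix (Fin N) (Fin N) ℝ) (z : Fin N → ℝ) (c : E) (i : Fin N) :
    matAct A (fun j => z j • c) i = matAct A z i • c := by
  simp [matAct, Finset.sum_smul, smul_smul]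

lemma sum_matAct {A : Matrix (Fin N) (Fin N) ℝ} (hA : ∀ j, ∑ i, A i j = 1) (v : Fin N → E) :
    ∑ i, matAct A v i = ∑ j, v j := by
  simp only [matAct]
  rw [Finset.sum_comm]
  refine Finset.sum_congr rfl fun j _ => ?_
  rw [← Finset.sum_smul, hA, one_smul]

lemma sum_norm_matAct_le {A : Matrix (Fin N) (Fin N) ℝ} (h0 : ∀ i j, 0 ≤ A i j)
    (hA : ∀ j, ∑ i, A i j = 1) (v : Fin N → E) :
    ∑ i, ‖matAct A v i‖ ≤ ∑ j, ‖v j‖ := by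
  calc ∑ i, ‖matAct A v i‖ ≤ ∑ i, ∑ j, A i j * ‖v j‖ := by
        refine Finset.sum_le_sum fun i _ => (norm_sum_le _ _).trans ?_
        refine Finset.sum_le_sum fun j _ => ?_
        rw [norm_smul, Real.norm_of_nonneg (h0 i j)]
    _ = ∑ j, ‖v j‖ := by
        rw [Finset.sum_comm]
        refine Finset.sum_congr rfl fun j _ => ?_
        rw [← Finset.sum_mul, hA, one_mul]

/-- A column-stochastic matrix with entries at least `θ` contracts the `ℓ¹` norm on zero-sum
families by the factor `1 - N θ`. -/
lemma sum_norm_matAct_le_of_sum_eq_zero {A : Matrix (Fin N) (Fin N) ℝ} {θ : ℝ}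
    (hθ : ∀ i j, θ ≤ A i j) (hA : ∀ j, ∑ i, A i j = 1) {v : Fin N → E} (hv : ∑ j, v j = 0) :
    ∑ i, ‖matAct A v i‖ ≤ (1 - N * θ) * ∑ j, ‖v j‖ := by
  have h : ∀ i, matAct A v i = ∑ j, (A i j - θ) • v j := by
    intro i
    simp only [matAct, sub_smul, Finset.sum_sub_distrib, ← Finset.smul_sum, hv, smul_zero, sub_zero]
  calc ∑ i, ‖matAct A v i‖ ≤ ∑ i, ∑ j, (A i j - θ) * ‖v j‖ := by
        refine Finset.sum_le_sum fun i _ => ?_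
        rw [h]
        refine (norm_sum_le _ _).trans (Finset.sum_le_sum fun j _ => ?_)
        rw [norm_smul, Real.norm_of_nonneg (sub_nonneg.2 (hθ i j))]
    _ = (1 - N * θ) * ∑ j, ‖v j‖ := by
        rw [Finset.sum_comm, Finset.mul_sum]
        refine Finset.sum_congr rfl fun j _ => ?_
        rw [← Finset.sum_mul, Finset.sum_sub_distrib, hA]
        simp

end MatAct

namespace GoodWeights

variable {N : ℕ} {w : ℕ → Matrix (Fin N) (Fin N) ℝ}

lemma transition_nonneg (hw : GoodWeights w) (t k : ℕ) (i j : Fin N) :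
    0 ≤ transition w t k i j := by
  induction k generalizing i j with
  | zero =>
    simp only [transition, Matrix.one_apply]
    split_ifs <;> norm_num
  | succ k ih =>
    simp only [transition, Matrix.mul_apply]
    exact Finset.sum_nonneg fun l _ => mul_nonneg (hw.nonneg _ _ _) (ih _ _)

lemma transition_col_sum (hw : GoodWeights w) (t k : ℕ) (j : Fin N) :
    ∑ i, transition w t k i j = 1 := by
  induction k with
  | zero => simp [transition, Matrix.one_apply]
  | succ k ih =>
    simp only [transition, Matrix.mul_apply]
    rw [Finset.sum_comm, ← ih]
    refine Finset.sum_congr rfl fun l _ => ?_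
    rw [← Finset.sum_mul, hw.col_stochastic, one_mul]

lemma transition_succ_ge (hw : GoodWeights w) {c : ℝ} (hc0 : 0 < c)
    (hc : ∀ t i j, 0 < w t i j → c ≤ w t i j) {t k : ℕ} {a b j : Fin N}
    (ha : c ^ k ≤ transition w t k a j) (hab : 0 < w (t + k) b a) :
    c ^ (k + 1) ≤ transition w t (k + 1) b j := by
  simp only [transition, Matrix.mul_apply]
  calc c ^ (k + 1) = c * c ^ k := pow_succ' c k
    _ ≤ w (t + k) b a * transition w t k a j :=
        mul_le_mul (hc _ _ _ hab) ha (by positivity) (hw.nonneg _ _ _)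
    _ ≤ _ := Finset.single_le_sum (f := fun l => w (t + k) b l * transition w t k l j)
        (fun l _ => mul_nonneg (hw.nonneg _ _ _) (hw.transition_nonneg _ _ _ _)) (Finset.mem_univ a)

/-- Self-loops keep mass in place: each further step loses at most a factor `c`. -/
lemma transition_add_ge (hw : GoodWeights w) {c : ℝ} (hc0 : 0 < c)
    (hc : ∀ t i j, 0 < w t i j → c ≤ w t i j) {t k : ℕ} {a j : Fin N}
    (ha : c ^ k ≤ transition w t k a j) (l : ℕ) :
    c ^ (k + l) ≤ transition w t (k + l) a j := by
  induction l with
  | zero => exact ha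
  | succ l ih => exact hw.transition_succ_ge hc0 hc ih (hw.diag_pos _ _)

/-- Products of sufficiently many consecutive weight matrices have uniformly positive entries. -/
lemma exists_transition_ge (hw : GoodWeights w) :
    ∃ c : ℝ, 0 < c ∧ c < 1 ∧ (∀ t i, c ≤ w t i i) ∧
      ∃ K : ℕ, ∀ t i j, c ^ K ≤ transition w t K i j := by
  classical
  obtain ⟨c, hc0, hc1, hc⟩ := hw.lower
  obtain ⟨U, hU, hconn⟩ := hw.connected
  refine ⟨c, hc0, hc1, fun t i => hc _ _ _ (hw.diag_pos t i), N * U, fun t i j => ?_⟩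
  -- `R k` collects the nodes that mass starting at `j` has reached after `k` steps with the
  -- guaranteed amount. It grows by at least one node in every window of length `U` until it is
  -- everything, so `N * U` steps suffice.
  let R : ℕ → Finset (Fin N) := fun k => Finset.univ.filter fun a => c ^ k ≤ transition w t k a j
  have hR : ∀ k a, a ∈ R k ↔ c ^ k ≤ transition w t k a j := fun k a => by simp [R]
  have hj : ∀ k, j ∈ R k := by
    intro k
    have := hw.transition_add_ge hc0 hc (t := t) (k := 0) (a := j) (j := j) (by simp [transition]) k
    rw [zero_add] at this
    exact (hR _ _).2 this
  have hmono : ∀ k l, R k ⊆ R (k + l) := fun k l a ha =>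
    (hR _ _).2 (hw.transition_add_ge hc0 hc ((hR _ _).1 ha) l)
  have hgrow : ∀ k, R k ≠ Finset.univ → (R k).card < (R (k + U)).card := by
    intro k hk
    refine Finset.card_lt_card ((hmono k U).ssubset_of_ne fun heq => hk ?_)
    refine Finset.eq_univ_iff_forall.2 fun b => ?_
    have hpath := hconn (t + k) j b
    induction hpath with
    | refl => exact hj k
    | tail _ hstep ih =>
      obtain ⟨l, hl, hpos⟩ := hstep
      rw [heq]
      have h1 := hw.transition_add_ge hc0 hc ((hR _ _).1 ih) l
      have h2 := hw.transition_succ_ge hc0 hc h1 (by rwa [← add_assoc])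
      have h3 := hw.transition_add_ge hc0 hc h2 (U - (l + 1))
      rw [hR]
      have : k + l + 1 + (U - (l + 1)) = k + U := by omega
      rwa [this] at h3
  have hcard : ∀ l, R (l * U) = Finset.univ ∨ l ≤ (R (l * U)).card := by
    intro l
    induction l with
    | zero => right; simp
    | succ l ih =>
      rw [Nat.succ_mul]
      by_cases h : R (l * U) = Finset.univ
      · left
        exact Finset.univ_subset_iff.1 (h ▸ hmono (l * U) U)
      · right
        have := hgrow _ h
        have := ih.resolve_left h
        omega
  have hfull : R (N * U) = Finset.univ := by
    rcases hcard N with h | h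
    · exact h
    · exact Finset.eq_univ_of_card _ (le_antisymm (Finset.card_le_univ _) (by simpa using h))
  exact (hR _ _).1 (hfull ▸ Finset.mem_univ i)

end GoodWeights

/-! ### Push-sum consensus -/

section PushSum

variable {N : ℕ} {w : ℕ → Matrix (Fin N) (Fin N) ℝ}

lemma sum_pushSum_weights (hw : GoodWeights w) {z : ℕ → Fin N → ℝ} (hz0 : ∀ i, z 0 i = 1)
    (hz : ∀ t, z (t + 1) = matAct (w t) (z t)) (t : ℕ) : ∑ i, z t i = N := by
  induction t with
  | zero => simp [hz0]
  | succ t ih => rw [hz, sum_matAct (hw.col_stochastic t), ih]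

lemma eq_matAct_transition {z : ℕ → Fin N → ℝ} (hz : ∀ t, z (t + 1) = matAct (w t) (z t))
    (t k : ℕ) : z (t + k) = matAct (transition w t k) (z t) := by
  induction k with
  | zero => simp [transition, matAct_one]
  | succ k ih => rw [← add_assoc, hz, ih, transition, matAct_mul]

/-- Up to time `K` the self-loops alone leave at least `c ^ K`. Later, the total mass `N` present
`K` steps earlier is spread with coefficients at least `c ^ K`. -/
lemma exists_pushSum_weights_ge (hN : 0 < N) (hw : GoodWeights w) {z : ℕ → Fin N → ℝ}
    (hz0 : ∀ i, z 0 i = 1) (hz : ∀ t, z (t + 1) = matAct (w t) (z t)) :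
    ∃ δ : ℝ, 0 < δ ∧ ∀ t i, δ ≤ z t i := by
  obtain ⟨c, hc0, hc1, hd, K, hK⟩ := hw.exists_transition_ge
  have hpos : ∀ t i, c ^ t ≤ z t i := by
    intro t
    induction t with
    | zero => simp [hz0]
    | succ t ih =>
      intro i
      rw [hz, pow_succ']
      calc c * c ^ t ≤ w t i i * z t i := mul_le_mul (hd t i) (ih i) (by positivity) (hw.nonneg _ _ _)
        _ ≤ _ := Finset.single_le_sum (f := fun l => w t i l • z t l)
          (fun l _ => mul_nonneg (hw.nonneg _ _ _) ((pow_nonneg hc0.le t).trans (ih l)))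
          (Finset.mem_univ i)
  refine ⟨c ^ K, by positivity, fun t i => ?_⟩
  rcases le_total t K with h | h
  · exact (pow_le_pow_of_le_one hc0.le hc1.le h).trans (hpos t i)
  · obtain ⟨s, rfl⟩ := Nat.exists_eq_add_of_le' h
    rw [eq_matAct_transition hz]
    have h1 : (1 : ℝ) ≤ N := by exact_mod_cast hN
    calc c ^ K ≤ c ^ K * N := le_mul_of_one_le_right (by positivity) h1
      _ = ∑ j, c ^ K * z s j := by rw [← Finset.mul_sum, sum_pushSum_weights hw hz0 hz]
      _ ≤ _ := Finset.sum_le_sum fun j _ => mul_le_mul_of_nonneg_right (hK _ _ _)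
        ((pow_nonneg hc0.le s).trans (hpos s j))

variable {E : Type*} [NormedAddCommGroup E] [NormedSpace ℝ E]

/-- The mean of a family of vectors. -/
def meanVec (u : Fin N → E) : E := (N : ℝ)⁻¹ • ∑ i, u i

/-- The disagreement `∑ ‖u_i - z_i ū‖` of a family of vectors relative to push-sum weights. -/
def disagreement (z : Fin N → ℝ) (u : Fin N → E) : ℝ := ∑ i, ‖u i - z i • meanVec u‖

lemma disagreement_nonneg (z : Fin N → ℝ) (u : Fin N → E) : 0 ≤ disagreement z u :=
  Finset.sum_nonneg fun _ _ => norm_nonneg _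

lemma sum_eq_smul_meanVec (hN : 0 < N) (u : Fin N → E) : ∑ i, u i = (N : ℝ) • meanVec u := by
  have : (N : ℝ) ≠ 0 := by exact_mod_cast hN.ne'
  rw [meanVec, smul_smul, mul_inv_cancel₀ this, one_smul]

lemma sum_sub_smul_meanVec (hN : 0 < N) {z : Fin N → ℝ} (hz : ∑ i, z i = N) (u : Fin N → E) :
    ∑ i, (u i - z i • meanVec u) = 0 := by
  rw [Finset.sum_sub_distrib, ← Finset.sum_smul, hz, sum_eq_smul_meanVec hN, sub_self]

lemma meanVec_step {A : Matrix (Fin N) (Fin N) ℝ} (hA : ∀ j, ∑ i, A i j = 1) (u e : Fin N → E) :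
    meanVec (matAct A u + e) = meanVec u + meanVec e := by
  simp only [meanVec, Pi.add_apply, Finset.sum_add_distrib, sum_matAct hA, smul_add]

/-- Subtracting `z i • meanVec u` leaves a zero-sum family driven by the same matrices, and a
product of `K` of them contracts such families in `ℓ¹`. The constants `K` and `ρ` do not depend on
`E`, so they serve the multipliers and the aggregates alike. -/
lemma exists_disagreement_contraction (hN : 0 < N) (hw : GoodWeights w) {z : ℕ → Fin N → ℝ}
    (hz0 : ∀ i, z 0 i = 1) (hz : ∀ t, z (t + 1) = matAct (w t) (z t)) :
    ∃ (K : ℕ) (ρ : ℝ), 0 ≤ ρ ∧ ρ < 1 ∧ ∀ {E : Type} [NormedAddCommGroup E] [NormedSpace ℝ E]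
      (u e : ℕ → Fin N → E), (∀ t, u (t + 1) = matAct (w t) (u t) + e t) → ∀ t,
      disagreement (z (t + K)) (u (t + K)) ≤ ρ * disagreement (z t) (u t)
        + 2 * ∑ s ∈ Finset.range K, ∑ i, ‖e (t + s) i‖ := by
  obtain ⟨c, hc0, hc1, hd, K, hK⟩ := hw.exists_transition_ge
  have hzs := sum_pushSum_weights hw hz0 hz
  obtain ⟨δ, hδ, hzδ⟩ := exists_pushSum_weights_ge hN hw hz0 hz
  have hNpos : (0 : ℝ) < N := by exact_mod_cast hN
  refine ⟨K, 1 - N * c ^ K, ?_, ?_, ?_⟩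
  · have h1 := hw.transition_col_sum 0 K ⟨0, hN⟩
    have h2 : ∑ i : Fin N, c ^ K ≤ ∑ i, transition w 0 K i ⟨0, hN⟩ :=
      Finset.sum_le_sum fun i _ => hK _ _ _
    simp at h2
    linarith
  · have : 0 < N * c ^ K := by positivity
    linarith
  · intro E _ _ u e hu t
    let v : ℕ → Fin N → E := fun t i => u t i - z t i • meanVec (u t)
    let f : ℕ → Fin N → E := fun t i => e t i - z (t + 1) i • meanVec (e t)
    have hv : ∀ t, v (t + 1) = matAct (w t) (v t) + f t := by
      intro t
      have h1 : v t = u t - fun i => z t i • meanVec (u t) := rfl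
      funext i
      rw [h1, matAct_sub]
      simp only [Pi.add_apply, Pi.sub_apply, matAct_smul_const, v, f, ← hz]
      rw [show meanVec (u (t + 1)) = meanVec (u t) + meanVec (e t) by
        rw [hu, meanVec_step (hw.col_stochastic t)], hu, Pi.add_apply, smul_add]
      abel
    -- The factor 2 is the price of recentring: as `∑ z = N`, the removed part has `ℓ¹` norm `‖∑
    -- e‖`.
    have hf : ∀ t, ∑ i, ‖f t i‖ ≤ 2 * ∑ i, ‖e t i‖ := by
      intro t
      calc ∑ i, ‖f t i‖ ≤ ∑ i, (‖e t i‖ + z (t + 1) i * ‖meanVec (e t)‖) := by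
            refine Finset.sum_le_sum fun i _ => (norm_sub_le _ _).trans ?_
            rw [norm_smul, Real.norm_of_nonneg (hδ.le.trans (hzδ _ _))]
        _ = ∑ i, ‖e t i‖ + ‖∑ i, e t i‖ := by
            rw [Finset.sum_add_distrib, ← Finset.sum_mul, hzs, sum_eq_smul_meanVec hN (e t),
              norm_smul, Real.norm_of_nonneg hNpos.le]
        _ ≤ 2 * ∑ i, ‖e t i‖ := by
            have := norm_sum_le Finset.univ (e t)
            linarith
    have hdev : ∀ k, ∑ i, ‖(v (t + k) - matAct (transition w t k) (v t)) i‖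
        ≤ ∑ s ∈ Finset.range k, ∑ i, ‖f (t + s) i‖ := by
      intro k
      induction k with
      | zero => simp [transition, matAct_one]
      | succ k ih =>
        rw [Finset.sum_range_succ, ← add_assoc, hv, transition, matAct_mul]
        have : matAct (w (t + k)) (v (t + k)) + f (t + k)
            - matAct (w (t + k)) (matAct (transition w t k) (v t))
            = matAct (w (t + k)) (v (t + k) - matAct (transition w t k) (v t)) + f (t + k) := by
          rw [matAct_sub]; abel
        rw [this]
        calc _ ≤ ∑ i, (‖matAct (w (t + k)) (v (t + k) - matAct (transition w t k) (v t)) i‖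
              + ‖f (t + k) i‖) := Finset.sum_le_sum fun i _ => norm_add_le _ _
          _ ≤ _ := by
            rw [Finset.sum_add_distrib]
            gcongr
            exact (sum_norm_matAct_le (hw.nonneg _) (hw.col_stochastic _) _).trans ih
    have hcon := sum_norm_matAct_le_of_sum_eq_zero (hK t) (hw.transition_col_sum t K)
      (v := v t) (sum_sub_smul_meanVec hN (hzs t) (u t))
    calc disagreement (z (t + K)) (u (t + K)) = ∑ i, ‖v (t + K) i‖ := rfl
      _ ≤ ∑ i, (‖matAct (transition w t K) (v t) i‖
          + ‖(v (t + K) - matAct (transition w t K) (v t)) i‖) := by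
          refine Finset.sum_le_sum fun i _ => ?_
          refine le_trans (le_of_eq ?_) (norm_add_le _ _)
          simp
      _ ≤ _ := by
          rw [Finset.sum_add_distrib, Finset.mul_sum]
          exact add_le_add hcon ((hdev K).trans (Finset.sum_le_sum fun s _ => hf _))

/-- Mixing acts on `z • ū` exactly as on `z`, so division by the new weight returns `ū`; only the
mixed disagreement remains, divided by a weight at least `δ`. -/
lemma norm_inv_smul_matAct_sub_meanVec_le (hw : GoodWeights w) {z : ℕ → Fin N → ℝ}
    (hz : ∀ t, z (t + 1) = matAct (w t) (z t)) {δ : ℝ} (hδ : 0 < δ) (hzδ : ∀ t i, δ ≤ z t i)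
    (t : ℕ) (u : Fin N → E) (i : Fin N) :
    ‖(z (t + 1) i)⁻¹ • matAct (w t) u i - meanVec u‖ ≤ disagreement (z t) u / δ := by
  have hzpos : 0 < z (t + 1) i := hδ.trans_le (hzδ _ _)
  have h1 : (z (t + 1) i)⁻¹ • matAct (w t) u i - meanVec u
      = (z (t + 1) i)⁻¹ • matAct (w t) (fun j => u j - z t j • meanVec u) i := by
    have : (fun j => u j - z t j • meanVec u) = u - fun j => z t j • meanVec u := rfl
    rw [this, matAct_sub, Pi.sub_apply, matAct_smul_const, ← hz, smul_sub, smul_smul,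
      inv_mul_cancel₀ hzpos.ne', one_smul]
  rw [h1, norm_smul, norm_inv, Real.norm_of_nonneg hzpos.le, div_eq_inv_mul]
  have h2 : ‖matAct (w t) (fun j => u j - z t j • meanVec u) i‖ ≤ disagreement (z t) u :=
    (Finset.single_le_sum (f := fun i => ‖matAct (w t) (fun j => u j - z t j • meanVec u) i‖)
      (fun _ _ => norm_nonneg _) (Finset.mem_univ i)).trans
      (sum_norm_matAct_le (hw.nonneg t) (hw.col_stochastic t) _)
  exact mul_le_mul (inv_anti₀ hδ (hzδ _ _)) h2 (norm_nonneg _) (inv_nonneg.2 hδ.le)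

end PushSum

/-! ### Real sequences: delayed contractions and a convergence criterion -/

section RealSequences

/-- Sum the inequality over `t < T` and absorb `ρ ∑ b` on the left. Each `a t` is counted at most
`K` times. -/
lemma summable_of_delayed_contraction {b a : ℕ → ℝ} {ρ : ℝ} {K : ℕ} (hb : ∀ t, 0 ≤ b t)
    (ha : ∀ t, 0 ≤ a t) (hρ : ρ < 1) (hsum : Summable a)
    (h : ∀ t, b (t + K) ≤ ρ * b t + ∑ s ∈ Finset.range K, a (t + s)) : Summable b := by
  refine summable_of_sum_range_le (c := (∑ t ∈ Finset.range K, b t + K * ∑' t, a t) / (1 - ρ))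
    hb fun T => ?_
  rw [le_div_iff₀ (by linarith)]
  have h1 : ∑ t ∈ Finset.range T, b t ≤ ∑ t ∈ Finset.range (K + T), b t :=
    Finset.sum_le_sum_of_subset_of_nonneg (Finset.range_mono (by omega)) fun t _ _ => hb t
  rw [Finset.sum_range_add] at h1
  have h2 : ∑ t ∈ Finset.range T, b (K + t)
      ≤ ∑ t ∈ Finset.range T, (ρ * b t + ∑ s ∈ Finset.range K, a (t + s)) :=
    Finset.sum_le_sum fun t _ => by rw [add_comm]; exact h t
  rw [Finset.sum_add_distrib, ← Finset.mul_sum, Finset.sum_comm] at h2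
  have h3 : ∑ s ∈ Finset.range K, ∑ t ∈ Finset.range T, a (t + s) ≤ K * ∑' t, a t := by
    calc _ ≤ ∑ s ∈ Finset.range K, ∑' t, a t := by
          refine Finset.sum_le_sum fun s _ => ?_
          calc ∑ t ∈ Finset.range T, a (t + s) = ∑ t ∈ Finset.range T, a (s + t) := by
                simp only [add_comm]
            _ ≤ ∑ t ∈ Finset.range (s + T), a t := by
                rw [Finset.sum_range_add]
                exact le_add_of_nonneg_left (Finset.sum_nonneg fun t _ => ha t)
            _ ≤ _ := hsum.sum_le_tsum _ fun t _ => ha t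
      _ = _ := by simp
  linarith

/-- As `α` decreases, `α (t + K)` may be replaced by the earlier weight belonging to each term. -/
lemma summable_mul_of_delayed_contraction {α E e : ℕ → ℝ} {ρ : ℝ} {K : ℕ} (hα : ∀ t, 0 ≤ α t)
    (hα' : Antitone α) (hE : ∀ t, 0 ≤ E t) (he : ∀ t, 0 ≤ e t) (hρ0 : 0 ≤ ρ) (hρ : ρ < 1)
    (hsum : Summable fun t => α t * e t)
    (h : ∀ t, E (t + K) ≤ ρ * E t + 2 * ∑ s ∈ Finset.range K, e (t + s)) :
    Summable fun t => α t * E t := by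
  refine summable_of_delayed_contraction (a := fun t => 2 * (α t * e t)) (ρ := ρ) (K := K)
    (fun t => mul_nonneg (hα t) (hE t)) (fun t => by have := hα t; have := he t; positivity) hρ
    (hsum.mul_left 2) fun t => ?_
  calc α (t + K) * E (t + K)
      ≤ α (t + K) * (ρ * E t + 2 * ∑ s ∈ Finset.range K, e (t + s)) :=
        mul_le_mul_of_nonneg_left (h t) (hα _)
    _ = α (t + K) * (ρ * E t) + ∑ s ∈ Finset.range K, 2 * (α (t + K) * e (t + s)) := by
        rw [mul_add, Finset.mul_sum, Finset.mul_sum]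
        congr 1
        exact Finset.sum_congr rfl fun s _ => by ring
    _ ≤ α t * (ρ * E t) + ∑ s ∈ Finset.range K, 2 * (α (t + s) * e (t + s)) := by
        refine add_le_add (mul_le_mul_of_nonneg_right (hα' (by omega)) (mul_nonneg hρ0 (hE t))) ?_
        refine Finset.sum_le_sum fun s hs => ?_
        have : α (t + K) ≤ α (t + s) := hα' (by have := Finset.mem_range.1 hs; omega)
        have := mul_le_mul_of_nonneg_right this (he (t + s))
        linarith
    _ = _ := by ring

lemma bounded_of_delayed_contraction {E : ℕ → ℝ} {ρ C : ℝ} {K : ℕ} (hE : ∀ t, 0 ≤ E t)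
    (hρ0 : 0 ≤ ρ) (hρ : ρ < 1) (hC : 0 ≤ C) (h : ∀ t, E (t + K) ≤ ρ * E t + C) :
    ∃ B, ∀ t, E t ≤ B := by
  have h1 : 0 < 1 - ρ := by linarith
  have hS : 0 ≤ ∑ t ∈ Finset.range K, E t := Finset.sum_nonneg fun t _ => hE t
  refine ⟨∑ t ∈ Finset.range K, E t + C / (1 - ρ), fun t => ?_⟩
  have hq : C / (1 - ρ) * (1 - ρ) = C := div_mul_cancel₀ _ h1.ne'
  have hq0 : 0 ≤ C / (1 - ρ) := by positivity
  induction t using Nat.strong_induction_on with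
  | _ t ih =>
    rcases lt_or_ge t K with ht | ht
    · have := Finset.single_le_sum (f := E) (fun s _ => hE s) (Finset.mem_range.2 ht)
      linarith
    · obtain ⟨s, rfl⟩ := Nat.exists_eq_add_of_le' ht
      rcases Nat.eq_zero_or_pos K with hK | hK
      · subst hK
        have := h s
        simp only [add_zero, Finset.range_zero, Finset.sum_empty, zero_add] at this ⊢
        rw [le_div_iff₀ h1]
        linarith
      · have h2 := h s
        have h3 := mul_le_mul_of_nonneg_left (ih s (by omega)) hρ0
        nlinarith

/-- A nonnegative sequence with increments `O(α_t)` tends to zero if `∑ α_t φ_t < ∞`, where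
`∑ α_t = ∞` and `φ_t` is bounded below whenever `r_t` is. -/
lemma tendsto_zero_of_summable_mul {r φ α : ℕ → ℝ} {C : ℝ} (hr : ∀ t, 0 ≤ r t) (hC : 0 < C)
    (hstep : ∀ t, |r (t + 1) - r t| ≤ C * α t) (hα : ∀ t, 0 ≤ α t) (hα0 : Tendsto α atTop (𝓝 0))
    (hns : ¬ Summable α) (hφ : ∀ t, 0 ≤ φ t) (hsum : Summable fun t => α t * φ t)
    (hlow : ∀ ε > 0, ∃ c > 0, ∀ t, ε ≤ r t → c ≤ φ t) : Tendsto r atTop (𝓝 0) := by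
  have key : ∀ ε > 0, ∀ᶠ t in atTop, r t < 2 * ε := by
    intro ε hε
    obtain ⟨c, hc, hcφ⟩ := hlow (ε / 2) (by positivity)
    obtain ⟨T, hT⟩ := eventually_atTop.1 (hα0.eventually (gt_mem_nhds (show 0 < ε / 2 / C by positivity)))
    have hsmall : ∀ t, T ≤ t → C * α t < ε / 2 := fun t ht => by
      have := hT t ht
      rwa [lt_div_iff₀ hC, mul_comm] at this
    -- Below `ε / 2` one step cannot exceed `ε`, so the truncated sequence moves only where `r ≥ ε /
    -- 2`. There `φ ≥ c`, and the movement `C α` is at most `(C / c) α φ`. Hence `ψ` has finite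
    -- variation and converges; a positive limit would make `φ` eventually at least `c` and `α`
    -- summable.
    let ψ : ℕ → ℝ := fun t => max (r (t + T) - ε) 0
    have hd : ∀ t, dist (ψ t) (ψ t.succ) ≤ C / c * (α (t + T) * φ (t + T)) := by
      intro t
      have e1 : t.succ + T = t + T + 1 := by omega
      have hs := hstep (t + T)
      have h0 : 0 ≤ C / c * (α (t + T) * φ (t + T)) := by
        have := hα (t + T); have := hφ (t + T); positivity
      rcases lt_or_ge (r (t + T)) (ε / 2) with hlt | hge
      · have h1 : r (t + T + 1) < ε := by
          have := hsmall (t + T) (by omega)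
          have := (abs_le.1 hs).2
          linarith
        have h2 : ψ t = 0 := max_eq_right (by linarith)
        have h3 : ψ t.succ = 0 := by
          simp only [ψ, e1]
          exact max_eq_right (by linarith)
        rw [h2, h3, dist_self]
        exact h0
      · have h1 : dist (ψ t) (ψ t.succ) ≤ C * α (t + T) := by
          rw [dist_comm, Real.dist_eq]
          simp only [ψ, e1]
          refine (abs_max_sub_max_le_abs _ _ _).trans ?_
          rwa [sub_sub_sub_cancel_right]
        refine h1.trans ?_
        have h2 := hcφ _ hge
        calc C * α (t + T) = C / c * (α (t + T) * c) := by field_simp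
          _ ≤ _ := by
            have := hα (t + T)
            gcongr
    have hcs := cauchySeq_of_dist_le_of_summable _ hd
      (((summable_nat_add_iff T).2 hsum).mul_left (C / c))
    obtain ⟨l, hl⟩ := cauchySeq_tendsto_of_complete hcs
    rcases le_or_gt l 0 with hl0 | hl0
    · have h1 : ∀ᶠ t in atTop, ψ t < ε := hl.eventually (gt_mem_nhds (by linarith))
      obtain ⟨T', hT'⟩ := eventually_atTop.1 h1
      refine eventually_atTop.2 ⟨T' + T, fun t ht => ?_⟩
      have h2 := hT' (t - T) (by omega)
      have h3 : r (t - T + T) - ε ≤ ψ (t - T) := le_max_left _ _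
      rw [Nat.sub_add_cancel (by omega)] at h3
      linarith
    · exfalso
      obtain ⟨T', hT'⟩ := eventually_atTop.1 (hl.eventually (lt_mem_nhds hl0))
      apply hns
      rw [← summable_nat_add_iff (T' + T)]
      refine Summable.of_nonneg_of_le (fun t => hα _) (fun t => ?_)
        (((summable_nat_add_iff (T' + T)).2 hsum).mul_left c⁻¹)
      have h2 := hT' (t + T') (by omega)
      have h3 : ε / 2 ≤ r (t + (T' + T)) := by
        have h4 : 0 < max (r (t + T' + T) - ε) 0 := h2
        rw [← add_assoc]
        rcases lt_max_iff.1 h4 with h5 | h5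
        · linarith
        · exact absurd h5 (lt_irrefl _)
      have h5 := hcφ _ h3
      calc α (t + (T' + T)) = c⁻¹ * (α (t + (T' + T)) * c) := by field_simp
        _ ≤ _ := by
          have := hα (t + (T' + T))
          gcongr
  refine Metric.tendsto_atTop.2 fun ε hε => ?_
  obtain ⟨T, hT⟩ := eventually_atTop.1 (key (ε / 2) (by positivity))
  refine ⟨T, fun t ht => ?_⟩
  rw [Real.dist_eq, sub_zero, abs_of_nonneg (hr t)]
  have := hT t ht
  linarith

end RealSequences

/-! ### Euclidean projections -/

section Projection

variable {H : Type*} [NormedAddCommGroup H] [InnerProductSpace ℝ H]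

lemma exists_projection {H : Type*} [NormedAddCommGroup H] [ProperSpace H] {S : Set H} (hne : S.Nonempty) (hcl : IsClosed S) (v : H) :
    ∃ u ∈ S, ∀ y ∈ S, ‖u - v‖ ≤ ‖y - v‖ := by
  obtain ⟨u, hu, h⟩ := hcl.exists_infDist_eq_dist hne v
  refine ⟨u, hu, fun y hy => ?_⟩
  rw [← dist_eq_norm, ← dist_eq_norm, dist_comm u, dist_comm y, ← h]
  exact Metric.infDist_le_dist_of_mem hy

lemma inner_sub_projection_le {S : Set H} (hconv : Convex ℝ S) {u v : H} (hu : u ∈ S)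
    (h : ∀ y ∈ S, ‖u - v‖ ≤ ‖y - v‖) {y : H} (hy : y ∈ S) : inner ℝ (v - u) (y - u) ≤ 0 := by
  refine (norm_eq_iInf_iff_real_inner_le_zero hconv hu).1 ?_ y hy
  have : Nonempty S := ⟨⟨u, hu⟩⟩
  refine le_antisymm (le_ciInf fun y => ?_) (ciInf_le ⟨0, ?_⟩ (⟨u, hu⟩ : S))
  · rw [norm_sub_rev, norm_sub_rev v]
    exact h y y.2
  · rintro _ ⟨y, rfl⟩
    exact norm_nonneg _

lemma norm_sub_sq_le_of_inner_le {u v y : H} (h : inner ℝ (v - u) (y - u) ≤ 0) :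
    ‖u - y‖ ^ 2 ≤ ‖v - y‖ ^ 2 := by
  have h1 : v - y = (v - u) - (y - u) := by abel
  rw [h1, norm_sub_sq_real (v - u), norm_sub_rev u y]
  nlinarith [sq_nonneg ‖v - u‖]

variable {k : ℕ} {S : Set (Eu k)}

lemma proj_spec (hne : S.Nonempty) (hcl : IsClosed S) (v : Eu k) :
    proj S v ∈ S ∧ ∀ y ∈ S, ‖proj S v - v‖ ≤ ‖y - v‖ := by
  obtain ⟨u, hu, h⟩ := exists_projection hne hcl v
  exact Classical.epsilon_spec (p := fun u => u ∈ S ∧ ∀ y ∈ S, ‖u - v‖ ≤ ‖y - v‖) ⟨u, hu, h⟩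

lemma proj_mem (hne : S.Nonempty) (hcl : IsClosed S) (v : Eu k) : proj S v ∈ S :=
  (proj_spec hne hcl v).1

lemma inner_sub_proj_le (hcl : IsClosed S) (hconv : Convex ℝ S) (v : Eu k) {y : Eu k}
    (hy : y ∈ S) : inner ℝ (v - proj S v) (y - proj S v) ≤ 0 :=
  inner_sub_projection_le hconv (proj_mem ⟨y, hy⟩ hcl v) (proj_spec ⟨y, hy⟩ hcl v).2 hy

lemma norm_proj_sub_sq_le (hcl : IsClosed S) (hconv : Convex ℝ S) (v : Eu k) {y : Eu k}
    (hy : y ∈ S) : ‖proj S v - y‖ ^ 2 ≤ ‖v - y‖ ^ 2 :=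
  norm_sub_sq_le_of_inner_le (inner_sub_proj_le hcl hconv v hy)

lemma norm_proj_sub_le (hcl : IsClosed S) (hconv : Convex ℝ S) (v : Eu k) {y : Eu k}
    (hy : y ∈ S) : ‖proj S v - y‖ ≤ ‖v - y‖ :=
  (sq_le_sq₀ (norm_nonneg _) (norm_nonneg _)).1 (norm_proj_sub_sq_le hcl hconv v hy)

lemma norm_proj_sub_proj_le (hne : S.Nonempty) (hcl : IsClosed S) (hconv : Convex ℝ S)
    (u v : Eu k) : ‖proj S u - proj S v‖ ≤ ‖u - v‖ := by
  have h1 := inner_sub_proj_le hcl hconv u (proj_mem hne hcl v)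
  have h2 := inner_sub_proj_le hcl hconv v (proj_mem hne hcl u)
  set a := proj S u
  set b := proj S v
  have h3 : ‖a - b‖ ^ 2 ≤ inner ℝ (u - v) (a - b) := by
    rw [← real_inner_self_eq_norm_sq]
    have e1 : inner ℝ (u - a) (b - a) + inner ℝ (v - b) (a - b)
        = inner ℝ (a - b) (a - b) - inner ℝ (u - v) (a - b) := by
      rw [← neg_sub a b, inner_neg_right, ← sub_eq_neg_add, ← inner_sub_left, ← inner_sub_left]
      congr 1
      abel
    linarith
  have h4 := real_inner_le_norm (u - v) (a - b)
  rcases (norm_nonneg (a - b)).eq_or_lt with h0 | h0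
  · rw [← h0]; positivity
  · nlinarith

lemma continuous_proj (hne : S.Nonempty) (hcl : IsClosed S) (hconv : Convex ℝ S) :
    Continuous (proj S) :=
  (LipschitzWith.of_dist_le_mul (K := 1) fun u v => by
    simpa [dist_eq_norm] using norm_proj_sub_proj_le hne hcl hconv u v).continuous

lemma isClosed_nonnegOrthant : IsClosed (nonnegOrthant k) := by
  simp only [nonnegOrthant, Set.ofPred_forall]
  exact isClosed_iInter fun j => isClosed_le continuous_const (by fun_prop)

lemma convex_nonnegOrthant : Convex ℝ (nonnegOrthant k) := by
  intro u hu v hv a b ha hb _ j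
  have := hu j
  have := hv j
  simp only [PiLp.add_apply, PiLp.smul_apply, smul_eq_mul]
  positivity

lemma zero_mem_nonnegOrthant : (0 : Eu k) ∈ nonnegOrthant k := fun _ => le_rfl

lemma add_mem_nonnegOrthant {u v : Eu k} (hu : u ∈ nonnegOrthant k) (hv : v ∈ nonnegOrthant k) :
    u + v ∈ nonnegOrthant k := fun j => add_nonneg (hu j) (hv j)

lemma smul_mem_nonnegOrthant {u : Eu k} {c : ℝ} (hc : 0 ≤ c) (hu : u ∈ nonnegOrthant k) :
    c • u ∈ nonnegOrthant k := fun j => mul_nonneg hc (hu j)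

lemma sum_mem_nonnegOrthant {ι : Type*} {s : Finset ι} {u : ι → Eu k}
    (hu : ∀ i ∈ s, u i ∈ nonnegOrthant k) : ∑ i ∈ s, u i ∈ nonnegOrthant k := by
  classical
  induction s using Finset.induction_on with
  | empty => exact zero_mem_nonnegOrthant
  | insert i s hi ih =>
    rw [Finset.sum_insert hi]
    exact add_mem_nonnegOrthant (hu i (by simp)) (ih fun j hj => hu j (by simp [hj]))

lemma proj_nonnegOrthant_mem (v : Eu k) : proj (nonnegOrthant k) v ∈ nonnegOrthant k :=
  proj_mem ⟨0, zero_mem_nonnegOrthant⟩ isClosed_nonnegOrthant v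

/-- In a cone the projection `p` can be compared with both `0` and `2p`, which gives the two
opposite inequalities. -/
lemma inner_proj_nonnegOrthant_sub_self (v : Eu k) :
    inner ℝ (proj (nonnegOrthant k) v - v) (proj (nonnegOrthant k) v) = 0 := by
  set p := proj (nonnegOrthant k) v with hp
  have hpm : p ∈ nonnegOrthant k := proj_nonnegOrthant_mem v
  have h1 := inner_sub_proj_le isClosed_nonnegOrthant convex_nonnegOrthant v
    (zero_mem_nonnegOrthant (k := k))
  have h2 := inner_sub_proj_le isClosed_nonnegOrthant convex_nonnegOrthant v
    (add_mem_nonnegOrthant hpm hpm)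
  rw [← hp] at h1 h2
  rw [add_sub_cancel_right] at h2
  rw [zero_sub, inner_neg_right] at h1
  rw [← neg_sub v p, inner_neg_left]
  linarith

lemma inner_proj_nonnegOrthant_sub_nonneg (v : Eu k) {y : Eu k} (hy : y ∈ nonnegOrthant k) :
    0 ≤ inner ℝ (proj (nonnegOrthant k) v - v) y := by
  set p := proj (nonnegOrthant k) v with hp
  have h2 := inner_sub_proj_le isClosed_nonnegOrthant convex_nonnegOrthant v
    (add_mem_nonnegOrthant (proj_nonnegOrthant_mem v) hy)
  rw [← hp, add_sub_cancel_left] at h2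
  rw [← neg_sub v p, inner_neg_left]
  linarith

lemma norm_proj_nonnegOrthant_le (v : Eu k) : ‖proj (nonnegOrthant k) v‖ ≤ ‖v‖ := by
  simpa using norm_proj_sub_le isClosed_nonnegOrthant convex_nonnegOrthant v
    (zero_mem_nonnegOrthant (k := k))

end Projection

/-! ### Minty variational inequalities by averaging projected steps -/

section Averaging

variable {H : Type*} [NormedAddCommGroup H] [InnerProductSpace ℝ H]

/-- The regret bound of projected descent: expand the square and telescope. -/
lemma sum_inner_le_of_projected_steps {K : Set H} {A : H → H} {C a : ℝ} {u : ℕ → H}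
    (huK : ∀ t, u t ∈ K) (hA : ∀ v ∈ K, ‖A v‖ ^ 2 ≤ C)
    (hu : ∀ t, ∀ w ∈ K, ‖u (t + 1) - w‖ ^ 2 ≤ ‖u t - a • A (u t) - w‖ ^ 2) {w : H} (hw : w ∈ K)
    (T : ℕ) :
    ‖u T - w‖ ^ 2 + 2 * a * ∑ t ∈ Finset.range T, inner ℝ (A (u t)) (u t - w)
      ≤ ‖u 0 - w‖ ^ 2 + T * (a ^ 2 * C) := by
  induction T with
  | zero => simp
  | succ T ih =>
    have h1 := hu T w hw
    have h2 : u T - a • A (u T) - w = (u T - w) - a • A (u T) := by abel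
    rw [h2, norm_sub_sq_real (u T - w), inner_smul_right, norm_smul, mul_pow, Real.norm_eq_abs, sq_abs,
      real_inner_comm] at h1
    have h3 := mul_le_mul_of_nonneg_left (hA _ (huK T)) (sq_nonneg a)
    rw [Finset.sum_range_succ]
    push_cast
    nlinarith

/-- Averages of projected steps approximately solve a variational inequality given in Minty form by
functions `φ w` that are convex and continuous. -/
lemma exists_forall_le_zero_of_le_inner [ProperSpace H] {K : Set H} (hne : K.Nonempty)
    (hconv : Convex ℝ K) (hcomp : IsCompact K) {A : H → H} {C : ℝ} (hA : ∀ v ∈ K, ‖A v‖ ^ 2 ≤ C)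
    {φ : H → H → ℝ} (hφc : ∀ w ∈ K, ContinuousOn (φ w) K)
    (hφconv : ∀ w ∈ K, ConvexOn ℝ K (φ w))
    (hφ : ∀ w ∈ K, ∀ v ∈ K, φ w v ≤ inner ℝ (A v) (v - w)) :
    ∃ v ∈ K, ∀ w ∈ K, φ w v ≤ 0 := by
  obtain ⟨w₀, hw₀⟩ := hne
  obtain ⟨D, hD⟩ := hcomp.isBounded.exists_norm_le
  have hproj := fun v => exists_projection ⟨w₀, hw₀⟩ hcomp.isClosed v
  choose π hπK hπ using hproj
  have happrox : ∀ n : ℕ, ∃ v ∈ K, ∀ w ∈ K, φ w v ≤ ((2 * D) ^ 2 + C) / 2 * ((n : ℝ) + 1)⁻¹ := by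
    intro n
    have hn : (0 : ℝ) < (n : ℝ) + 1 := by positivity
    -- Step size `a` with `T = a⁻²` steps: the weights `a ^ 2` sum to one, the accumulated squared
    -- steps stay bounded by `C`, and the averaged regret is `O(a)`.
    set a : ℝ := ((n : ℝ) + 1)⁻¹ with ha
    have ha0 : 0 < a := by positivity
    let u : ℕ → H := fun t => Nat.rec w₀ (fun _ v => π (v - a • A v)) t
    have hus : ∀ t, u (t + 1) = π (u t - a • A (u t)) := fun t => rfl
    have huK : ∀ t, u t ∈ K := by
      intro t
      cases t with
      | zero => exact hw₀
      | succ t => exact hπK _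
    have hu : ∀ t, ∀ w ∈ K, ‖u (t + 1) - w‖ ^ 2 ≤ ‖u t - a • A (u t) - w‖ ^ 2 := fun t w hw => by
      rw [hus]
      exact norm_sub_sq_le_of_inner_le (inner_sub_projection_le hconv (hπK _) (hπ _) hw)
    set T : ℕ := (n + 1) ^ 2 with hT
    have hTa : (T : ℝ) * a ^ 2 = 1 := by
      rw [hT, ha]; push_cast; field_simp
    have hT0 : (0 : ℝ) < T := by rw [hT]; positivity
    have hw1 : ∑ t ∈ Finset.range T, (a ^ 2 : ℝ) = 1 := by
      rw [Finset.sum_const, Finset.card_range, nsmul_eq_mul, hTa]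
    refine ⟨∑ t ∈ Finset.range T, (a ^ 2) • u t,
      hconv.sum_mem (fun _ _ => by positivity) hw1 fun t _ => huK t, fun w hw => ?_⟩
    calc φ w (∑ t ∈ Finset.range T, (a ^ 2) • u t)
        ≤ ∑ t ∈ Finset.range T, (a ^ 2) • φ w (u t) :=
          (hφconv w hw).map_sum_le (fun _ _ => by positivity) hw1 fun t _ => huK t
      _ ≤ ∑ t ∈ Finset.range T, (a ^ 2) • inner ℝ (A (u t)) (u t - w) :=
          Finset.sum_le_sum fun t _ => mul_le_mul_of_nonneg_left (hφ w hw _ (huK t)) (by positivity)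
      _ = a ^ 2 * ∑ t ∈ Finset.range T, inner ℝ (A (u t)) (u t - w) := by
          rw [Finset.mul_sum]; rfl
      _ ≤ ((2 * D) ^ 2 + C) / 2 * a := by
          have h1 := sum_inner_le_of_projected_steps huK hA hu hw T
          have h2 : ‖u 0 - w‖ ^ 2 ≤ (2 * D) ^ 2 := by
            have h3 : ‖u 0 - w‖ ≤ 2 * D :=
              (norm_sub_le _ _).trans (by linarith [hD _ (huK 0), hD _ hw])
            exact pow_le_pow_left₀ (norm_nonneg _) h3 2
          rw [← mul_assoc, hTa, one_mul] at h1
          have h4 : 2 * a * ∑ t ∈ Finset.range T, inner ℝ (A (u t)) (u t - w) ≤ (2 * D) ^ 2 + C := by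
            linarith [sq_nonneg ‖u T - w‖]
          nlinarith
  choose v hvK hv using happrox
  obtain ⟨vbar, hvbar, ϕ, hϕ, hlim⟩ := hcomp.tendsto_subseq hvK
  refine ⟨vbar, hvbar, fun w hw => ?_⟩
  have h1 : Tendsto (fun n => φ w (v (ϕ n))) atTop (𝓝 (φ w vbar)) :=
    (hφc w hw vbar hvbar).tendsto.comp
      (tendsto_nhdsWithin_iff.2 ⟨hlim, Eventually.of_forall fun n => hvK _⟩)
  have h2 : Tendsto (fun n => ((2 * D) ^ 2 + C) / 2 * ((ϕ n : ℝ) + 1)⁻¹) atTop (𝓝 0) := by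
    have h3 : Tendsto (fun n : ℕ => ((2 * D) ^ 2 + C) / 2 * ((n : ℝ) + 1)⁻¹) atTop (𝓝 0) := by
      have := (tendsto_one_div_add_atTop_nhds_zero_nat (𝕜 := ℝ)).const_mul (((2 * D) ^ 2 + C) / 2)
      simpa using this
    exact h3.comp hϕ.tendsto_atTop
  exact le_of_tendsto_of_tendsto' h1 h2 fun n => hv _ w hw

end Averaging

/-! ### One-sided derivatives of convex functions -/

section ConvexDerivative

variable {E : Type*} [NormedAddCommGroup E] [NormedSpace ℝ E]

lemma HasFDerivAt.tendsto_slope_right {F : Type*} [NormedAddCommGroup F] [NormedSpace ℝ F]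
    {h : E → F} {h' : E →L[ℝ] F} {x : E} (hd : HasFDerivAt h h' x) (v : E) :
    Tendsto (fun s : ℝ => s⁻¹ • (h (x + s • v) - h x)) (𝓝[>] 0) (𝓝 (h' v)) := by
  have h1 : HasDerivAt (fun s : ℝ => x + s • v) v 0 := by
    simpa using ((hasDerivAt_id (0 : ℝ)).smul_const v).const_add x
  have h2 : HasDerivAt (fun s : ℝ => h (x + s • v)) (h' v) 0 :=
    HasFDerivAt.comp_hasDerivAt (0 : ℝ) (by simpa using hd) h1
  simpa using h2.tendsto_slope_zero_right

lemma Convex.add_smul_sub_mem_of_pos {X : Set E} (hX : Convex ℝ X) {x u : E} (hx : x ∈ X)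
    (hu : u ∈ X) {s : ℝ} (hs0 : 0 ≤ s) (hs1 : s ≤ 1) : x + s • (u - x) ∈ X :=
  hX.add_smul_sub_mem hx hu ⟨hs0, hs1⟩

lemma ConvexOn.fderiv_apply_sub_le {X : Set E} {h : E → ℝ} (hc : ConvexOn ℝ X h)
    {h' : E →L[ℝ] ℝ} {x u : E} (hd : HasFDerivAt h h' x) (hx : x ∈ X) (hu : u ∈ X) :
    h' (u - x) ≤ h u - h x := by
  refine le_of_tendsto (hd.tendsto_slope_right (u - x)) ?_
  filter_upwards [Ioc_mem_nhdsGT (show (0 : ℝ) < 1 by norm_num)] with s hs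
  have h1 := hc.2 hx hu (show 0 ≤ 1 - s by linarith [hs.2]) hs.1.le (by ring)
  have h2 : (1 - s) • x + s • u = x + s • (u - x) := by
    rw [sub_smul, smul_sub, one_smul]; abel
  rw [h2] at h1
  simp only [smul_eq_mul] at h1 ⊢
  rw [inv_mul_le_iff₀ hs.1]
  linarith

/-- The directional derivative of a differentiable convex function along a segment is bounded above
by a quantity converging to the directional derivative at the left endpoint. -/
lemma ConvexOn.exists_directional_bound {X : Set E} {h : E → ℝ} (hc : ConvexOn ℝ X h)
    {h' : E → E →L[ℝ] ℝ} (hd : ∀ x ∈ X, HasFDerivAt h (h' x) x) {x u : E} (hx : x ∈ X)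
    (hu : u ∈ X) :
    ∃ B : ℝ → ℝ, Tendsto B (𝓝[>] 0) (𝓝 (h' x (u - x))) ∧
      ∀ s, 0 < s → s ≤ 1 / 2 → h' (x + s • (u - x)) (u - x) ≤ B s := by
  set v := u - x with hv
  let k : ℝ → ℝ := fun s => s⁻¹ • (h (x + s • v) - h x)
  have hk : Tendsto k (𝓝[>] 0) (𝓝 (h' x v)) := (hd x hx).tendsto_slope_right v
  -- By convexity the derivative at parameter `s` is at most the slope from `s` to `2s`. In terms of
  -- the slopes `k` from `0`, that slope is `2 k(2s) - k(s)`, which tends to `2h' - h' = h'`.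
  refine ⟨fun s => 2 * k (2 * s) - k s, ?_, fun s hs0 hs1 => ?_⟩
  · have h2 : Tendsto (fun s : ℝ => 2 * s) (𝓝[>] 0) (𝓝[>] 0) := by
      refine tendsto_nhdsWithin_iff.2 ⟨?_, ?_⟩
      · have : Tendsto (fun s : ℝ => 2 * s) (𝓝 0) (𝓝 (2 * 0)) := by
          exact (continuous_const.mul continuous_id).tendsto 0
        rw [mul_zero] at this
        exact this.mono_left nhdsWithin_le_nhds
      · filter_upwards [self_mem_nhdsWithin] with s hs
        simpa using hs
    have h3 := ((hk.comp h2).const_mul 2).sub hk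
    have h4 : 2 * h' x v - h' x v = h' x v := by ring
    rwa [h4] at h3
  · have hys := hc.1.add_smul_sub_mem_of_pos hx hu hs0.le (by linarith : s ≤ 1)
    have hy2s := hc.1.add_smul_sub_mem_of_pos hx hu (by linarith : 0 ≤ 2 * s) (by linarith)
    have h1 := hc.fderiv_apply_sub_le (hd _ hys) hys hy2s
    have h2 : x + (2 * s) • (u - x) - (x + s • (u - x)) = s • v := by
      rw [two_mul, add_smul]; abel
    rw [h2, map_smul, smul_eq_mul] at h1
    have h3 : 2 * k (2 * s) - k s = s⁻¹ * (h (x + (2 * s) • v) - h (x + s • v)) := by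
      simp only [k, smul_eq_mul]
      field_simp
      ring
    show _ ≤ 2 * k (2 * s) - k s
    rw [h3, le_inv_mul_iff₀ hs0]
    exact h1

end ConvexDerivative

/-! ### Gradients of the costs and constraints -/

namespace AggGame

variable {N m n : ℕ} {d q : Fin N → ℕ} {Γ : AggGame N m n d q}

lemma inner_gradg (t : ℕ) (i : Fin N) (x v : Eu (d i)) (μ : Eu m) :
    inner ℝ (Γ.gradg t i x μ) v = inner ℝ μ (fderiv ℝ (Γ.g t i) x v) := by
  rw [gradg, ContinuousLinearMap.adjoint_inner_left]

lemma norm_gradg_le (t : ℕ) (i : Fin N) (x : Eu (d i)) (μ : Eu m) :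
    ‖Γ.gradg t i x μ‖ ≤ ‖fderiv ℝ (Γ.g t i) x‖ * ‖μ‖ := by
  refine (ContinuousLinearMap.le_opNorm _ _).trans (le_of_eq ?_)
  rw [LinearIsometryEquiv.norm_map]

lemma inner_eq_sum_mul (μ v : Eu m) : inner ℝ μ v = ∑ j, μ j * v j := by
  rw [PiLp.inner_apply]
  exact Finset.sum_congr rfl fun j _ => by simp [mul_comm]

lemma Regular.convexOn_inner_g (hreg : Γ.Regular) (t : ℕ) (i : Fin N) {μ : Eu m}
    (hμ : μ ∈ nonnegOrthant m) : ConvexOn ℝ (Γ.X i) fun u => inner ℝ μ (Γ.g t i u) := by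
  refine ⟨hreg.convex i, fun x hx y hy a b ha hb hab => ?_⟩
  simp only [inner_eq_sum_mul, smul_eq_mul, Finset.mul_sum]
  rw [← Finset.sum_add_distrib]
  refine Finset.sum_le_sum fun j _ => ?_
  have := mul_le_mul_of_nonneg_left ((hreg.g_convex t i j).2 hx hy ha hb hab) (hμ j)
  simp only [smul_eq_mul] at this
  linarith

lemma Regular.inner_gradg_sub_le (hreg : Γ.Regular) (t : ℕ) (i : Fin N) {μ : Eu m}
    (hμ : μ ∈ nonnegOrthant m) {x u : Eu (d i)} (hx : x ∈ Γ.X i) (hu : u ∈ Γ.X i) :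
    inner ℝ (Γ.gradg t i x μ) (u - x) ≤ inner ℝ μ (Γ.g t i u - Γ.g t i x) := by
  rw [inner_gradg, inner_sub_right]
  have h1 : HasFDerivAt (fun u => inner ℝ μ (Γ.g t i u))
      ((innerSL ℝ μ).comp (fderiv ℝ (Γ.g t i) x)) x :=
    (innerSL ℝ μ).hasFDerivAt.comp x (hreg.g_diff t i x hx).hasFDerivAt
  exact (hreg.convexOn_inner_g t i hμ).fderiv_apply_sub_le h1 hx hu

lemma sum_apply_update {F : Type*} [AddCommGroup F] (f : (i : Fin N) → Eu (d i) → F)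
    (x : (i : Fin N) → Eu (d i)) (i : Fin N) (u : Eu (d i)) :
    ∑ j, f j (Function.update x i u j) = ∑ j, f j (x j) + (f i u - f i (x i)) := by
  have h : (fun j => f j (Function.update x i u j))
      = Function.update (fun j => f j (x j)) i (f i u) := by
    funext j
    exact Function.apply_update f x i u j
  rw [h, Finset.sum_update_of_mem (Finset.mem_univ i),
    ← Finset.add_sum_erase _ (fun j => f j (x j)) (Finset.mem_univ i), Finset.sdiff_singleton_eq_erase]
  abel

lemma agg_update (x : (i : Fin N) → Eu (d i)) (i : Fin N) (u : Eu (d i)) :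
    Γ.agg (Function.update x i u) = Γ.agg x + (N : ℝ)⁻¹ • (Γ.ψ i u - Γ.ψ i (x i)) := by
  rw [agg, agg, sum_apply_update, smul_add]

lemma gSum_update (t : ℕ) (x : (i : Fin N) → Eu (d i)) (i : Fin N) (u : Eu (d i)) :
    Γ.gSum t (Function.update x i u) = Γ.gSum t x + (Γ.g t i u - Γ.g t i (x i)) := by
  rw [gSum, gSum, sum_apply_update]

lemma inner_gradient_eq {k : ℕ} {f : Eu k → ℝ} {f' : Eu k →L[ℝ] ℝ} {x : Eu k}
    (h : HasFDerivAt f f' x) (v : Eu k) : inner ℝ (gradient f x) v = f' v := by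
  rw [h.hasGradientAt.gradient]
  simp

lemma inner_gradψ (i : Fin N) (x v : Eu (d i)) (y : Eu n) :
    inner ℝ (Γ.gradψ i x y) v = inner ℝ y (fderiv ℝ (Γ.ψ i) x v) := by
  rw [gradψ, ContinuousLinearMap.adjoint_inner_left]

/-- `p_{i,t}(x_i, σ(x))` is the partial gradient of `f_{i,t}(x_i, σ(x))` in `x_i`. -/
lemma Regular.hasFDerivAt_cost_update (hreg : Γ.Regular) (t : ℕ) (i : Fin N)
    (x : (j : Fin N) → Eu (d j)) {u : Eu (d i)} (hu : u ∈ Γ.X i) :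
    HasFDerivAt (fun u => Γ.cost t i u (Γ.agg (Function.update x i u)))
      (innerSL ℝ (Γ.p t i u (Γ.agg (Function.update x i u)))) u := by
  set y := Γ.agg (Function.update x i u) with hy
  have hψ := (hreg.ψ_diff i u hu).hasFDerivAt
  have hagg : HasFDerivAt (fun u => Γ.agg (Function.update x i u))
      ((N : ℝ)⁻¹ • fderiv ℝ (Γ.ψ i) u) u := by
    have : (fun u => Γ.agg (Function.update x i u))
        = fun u => Γ.agg x + (N : ℝ)⁻¹ • (Γ.ψ i u - Γ.ψ i (x i)) :=
      funext fun u => agg_update x i u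
    rw [this]
    exact ((hψ.sub_const (Γ.ψ i (x i))).const_smul (N : ℝ)⁻¹).const_add (Γ.agg x)
  have hD := (hreg.cost_diff t i u hu y).hasFDerivAt
  set D := fderiv ℝ (fun z : Eu (d i) × Eu n => Γ.cost t i z.1 z.2) (u, y) with hDdef
  have h1 : HasFDerivAt (fun u => Γ.cost t i u y) (D.comp (.inl ℝ _ _)) u :=
    HasFDerivAt.comp (g := fun z : Eu (d i) × Eu n => Γ.cost t i z.1 z.2) u hD
      (hasFDerivAt_prodMk_left (𝕜 := ℝ) u y)
  have h2 : HasFDerivAt (fun v => Γ.cost t i u v) (D.comp (.inr ℝ _ _)) y :=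
    HasFDerivAt.comp (g := fun z : Eu (d i) × Eu n => Γ.cost t i z.1 z.2) y hD
      (hasFDerivAt_prodMk_right (𝕜 := ℝ) u y)
  have h3 := HasFDerivAt.comp (g := fun z : Eu (d i) × Eu n => Γ.cost t i z.1 z.2) u hD ((hasFDerivAt_id u).prodMk hagg)
  refine h3.congr_fderiv ?_
  ext v
  rw [innerSL_apply_apply, p, inner_add_left, inner_smul_left, inner_gradψ,
    inner_gradient_eq h1, inner_gradient_eq h2]
  simp only [ContinuousLinearMap.comp_apply, ContinuousLinearMap.inl_apply,
    ContinuousLinearMap.inr_apply, ContinuousLinearMap.prod_apply, ContinuousLinearMap.id_apply,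
    _root_.smul_apply, conj_trivial]
  rw [← smul_eq_mul, ← map_smul D, ← map_add]
  simp

end AggGame

/-! ### KKT points: existence and uniqueness -/

namespace AggGame

variable {N m n : ℕ} {d q : Fin N → ℕ} {Γ : AggGame N m n d q}

lemma Regular.continuousOn_ψ (hreg : Γ.Regular) (i : Fin N) : ContinuousOn (Γ.ψ i) (Γ.X i) :=
  fun x hx => (hreg.ψ_diff i x hx).continuousAt.continuousWithinAt

lemma Regular.continuousOn_g (hreg : Γ.Regular) (t : ℕ) (i : Fin N) :
    ContinuousOn (Γ.g t i) (Γ.X i) :=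
  fun x hx => (hreg.g_diff t i x hx).continuousAt.continuousWithinAt

/-- Along a segment, the pseudo-gradient in the direction of the segment is bounded above by a
quantity converging to its value at the left endpoint. -/
lemma Regular.exists_pseudoGradient_bound (hreg : Γ.Regular) (hlip : Γ.GradLipschitz) (t : ℕ)
    {x u : (i : Fin N) → Eu (d i)} (hx : ∀ i, x i ∈ Γ.X i) (hu : ∀ i, u i ∈ Γ.X i) :
    ∃ B : ℝ → ℝ,
      Tendsto B (𝓝[>] 0) (𝓝 (∑ i, inner ℝ (Γ.pseudoGradient t x i) (u i - x i))) ∧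
      ∀ s, 0 < s → s ≤ 1 / 2 →
        ∑ i, inner ℝ (Γ.pseudoGradient t (fun j => x j + s • (u j - x j)) i) (u i - x i) ≤ B s := by
  obtain ⟨L, hL, hp⟩ := hlip
  have hB := fun i => (hreg.cost_convex t i x).exists_directional_bound
    (fun z hz => hreg.hasFDerivAt_cost_update t i x hz) (hx i) (hu i)
  choose B hBlim hB using hB
  let y : ℝ → (i : Fin N) → Eu (d i) := fun s j => x j + s • (u j - x j)
  have hψ : ∀ j, Tendsto (fun s => Γ.ψ j (y s j)) (𝓝[>] 0) (𝓝 (Γ.ψ j (x j))) := by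
    intro j
    have h1 : Tendsto (fun s => y s j) (𝓝[>] 0) (𝓝 (x j)) := by
      have h2 : Continuous fun s => y s j := by fun_prop
      have h3 := h2.tendsto 0
      simp only [y, zero_smul, add_zero] at h3
      exact h3.mono_left nhdsWithin_le_nhds
    exact (hreg.ψ_diff j _ (hx j)).continuousAt.tendsto.comp h1
  have h1 : Tendsto (fun s => Γ.agg (y s)) (𝓝[>] 0) (𝓝 (Γ.agg x)) :=
    (tendsto_finsetSum _ fun j _ => hψ j).const_smul _
  have h2 : ∀ i, Tendsto (fun s => Γ.agg (Function.update x i (y s i))) (𝓝[>] 0)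
      (𝓝 (Γ.agg x)) := by
    intro i
    have h3 := (((hψ i).sub_const (Γ.ψ i (x i))).const_smul (N : ℝ)⁻¹).const_add (Γ.agg x)
    rw [sub_self, smul_zero, add_zero] at h3
    exact h3.congr fun s => (agg_update x i (y s i)).symm
  -- Moving only player `i` is governed by convexity through `B i`. The simultaneous moves of the
  -- other players enter only through the aggregate, and cost at most `L` times a difference that
  -- vanishes with `s`.
  refine ⟨fun s => ∑ i, (B i s
    + L * ‖Γ.agg (y s) - Γ.agg (Function.update x i (y s i))‖ * ‖u i - x i‖), ?_, ?_⟩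
  · refine tendsto_finsetSum _ fun i _ => ?_
    have h3 := ((h1.sub (h2 i)).norm.const_mul L).mul_const ‖u i - x i‖
    rw [sub_self, norm_zero, mul_zero, zero_mul] at h3
    have h4 := (hBlim i).add h3
    rw [add_zero, innerSL_apply_apply, Function.update_eq_self] at h4
    exact h4
  · intro s hs0 hs1
    refine Finset.sum_le_sum fun i _ => ?_
    have h3 := hB i s hs0 hs1
    rw [innerSL_apply_apply] at h3
    have hys : y s i ∈ Γ.X i :=
      (hreg.convex i).add_smul_sub_mem_of_pos (hx i) (hu i) hs0.le (by linarith)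
    have h4 := hp t i (y s i) hys (Γ.agg (y s)) (Γ.agg (Function.update x i (y s i)))
    have h5 := real_inner_le_norm (Γ.p t i (y s i) (Γ.agg (y s))
      - Γ.p t i (y s i) (Γ.agg (Function.update x i (y s i)))) (u i - x i)
    have h6 := mul_le_mul_of_nonneg_right h4 (norm_nonneg (u i - x i))
    rw [inner_sub_left] at h5
    change inner ℝ (Γ.p t i (y s i) (Γ.agg (y s))) (u i - x i) ≤ _
    change inner ℝ (Γ.p t i (y s i) (Γ.agg (Function.update x i (y s i)))) (u i - x i) ≤ _ at h3
    linarith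

/-- The KKT conditions with a multiplier common to all players. -/
def IsKKT (Γ : AggGame N m n d q) (t : ℕ) (x : (i : Fin N) → Eu (d i)) (μ : Eu m) : Prop :=
  (∀ i, -(Γ.pseudoGradient t x i + Γ.gradg t i (x i) μ) ∈ normalCone (Γ.X i) (x i)) ∧
    Γ.gSum t x ∈ normalCone (nonnegOrthant m) μ

namespace IsKKT

variable {t : ℕ} {x : (i : Fin N) → Eu (d i)} {μ : Eu m}

lemma mem (h : Γ.IsKKT t x μ) (i : Fin N) : x i ∈ Γ.X i := (h.1 i).1

lemma multiplier_mem (h : Γ.IsKKT t x μ) : μ ∈ nonnegOrthant m := h.2.1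

lemma inner_gSum_nonpos (h : Γ.IsKKT t x μ) {ν : Eu m} (hν : ν ∈ nonnegOrthant m) :
    inner ℝ ν (Γ.gSum t x) ≤ 0 := by
  have := h.2.2 (μ + ν) (add_mem_nonnegOrthant h.multiplier_mem hν)
  rwa [add_sub_cancel_left, real_inner_comm] at this

lemma inner_gSum_eq_zero (h : Γ.IsKKT t x μ) : inner ℝ μ (Γ.gSum t x) = 0 := by
  refine le_antisymm (h.inner_gSum_nonpos h.multiplier_mem) ?_
  have := h.2.2 0 zero_mem_nonnegOrthant
  rw [zero_sub, inner_neg_right, real_inner_comm] at this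
  linarith

lemma gSum_nonpos (h : Γ.IsKKT t x μ) (j : Fin m) : Γ.gSum t x j ≤ 0 := by
  have := h.inner_gSum_nonpos (ν := EuclideanSpace.single j 1) fun k => by
    by_cases hk : k = j <;> simp [hk]
  simpa [EuclideanSpace.inner_single_left] using this

lemma inner_pseudoGradient_ge (h : Γ.IsKKT t x μ) (hreg : Γ.Regular) (i : Fin N) {u : Eu (d i)}
    (hu : u ∈ Γ.X i) :
    -inner ℝ μ (Γ.g t i u - Γ.g t i (x i)) ≤ inner ℝ (Γ.pseudoGradient t x i) (u - x i) := by
  have h1 := (h.1 i).2 u hu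
  rw [inner_neg_left, inner_add_left] at h1
  have h2 := hreg.inner_gradg_sub_le t i h.multiplier_mem (h.mem i) hu
  linarith

lemma sum_inner_pseudoGradient_ge (h : Γ.IsKKT t x μ) (hreg : Γ.Regular)
    {u : (i : Fin N) → Eu (d i)} (hu : ∀ i, u i ∈ Γ.X i) :
    -inner ℝ μ (Γ.gSum t u) ≤ ∑ i, inner ℝ (Γ.pseudoGradient t x i) (u i - x i) := by
  have h1 := Finset.sum_le_sum fun i (_ : i ∈ Finset.univ) => h.inner_pseudoGradient_ge hreg i (hu i)
  rw [Finset.sum_neg_distrib, ← inner_sum, Finset.sum_sub_distrib, inner_sub_right] at h1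
  have h2 := h.inner_gSum_eq_zero
  rw [gSum] at h2
  rw [gSum]
  linarith

/-- A unilateral change that stays feasible has `⟪μ, g⟫ ≤ 0`, while `⟪μ, g(x)⟫ = 0`. So the
first-order term of the deviation is nonnegative, and convexity in the player's own decision
finishes. -/
lemma isVGNE (h : Γ.IsKKT t x μ) (hreg : Γ.Regular) : Γ.IsVGNE t x := by
  refine ⟨⟨⟨h.mem, h.gSum_nonpos⟩, fun i u hfeas => ?_⟩, μ, h⟩
  have hu : u ∈ Γ.X i := by simpa using hfeas.1 i
  have h1 := (hreg.cost_convex t i x).fderiv_apply_sub_le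
    (hreg.hasFDerivAt_cost_update t i x (h.mem i)) (h.mem i) hu
  simp only [innerSL_apply_apply, Function.update_eq_self] at h1
  have h2 := h.inner_pseudoGradient_ge hreg i hu
  have h3 : inner ℝ μ (Γ.gSum t (Function.update x i u)) ≤ 0 := by
    rw [inner_eq_sum_mul]
    exact Finset.sum_nonpos fun j _ =>
      mul_nonpos_of_nonneg_of_nonpos (h.multiplier_mem j) (hfeas.2 j)
  rw [gSum_update, inner_add_right, h.inner_gSum_eq_zero, zero_add] at h3
  rw [pseudoGradient] at h2
  linarith

/-- The duality gap controls the monotonicity gap of the pseudo-gradient. -/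
lemma sum_inner_sub_le (h : Γ.IsKKT t x μ) (hreg : Γ.Regular) {u : (i : Fin N) → Eu (d i)}
    (hu : ∀ i, u i ∈ Γ.X i) {ν : Eu m} (hν : ν ∈ nonnegOrthant m) :
    ∑ i, inner ℝ (Γ.pseudoGradient t u i - Γ.pseudoGradient t x i) (u i - x i)
      ≤ ∑ i, inner ℝ (Γ.pseudoGradient t u i) (u i - x i) - inner ℝ ν (Γ.gSum t x)
        + inner ℝ μ (Γ.gSum t u) := by
  simp only [inner_sub_left, Finset.sum_sub_distrib]
  have h1 := h.sum_inner_pseudoGradient_ge hreg hu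
  have h2 := h.inner_gSum_nonpos hν
  linarith

/-- Adding the variational inequalities of the two KKT points bounds their monotonicity gap by
pairings of multipliers with feasible constraint values, which are nonpositive. -/
lemma unique (hmono : Γ.StrictlyMonotone t) (hreg : Γ.Regular) (h : Γ.IsKKT t x μ)
    {x' : (i : Fin N) → Eu (d i)} {μ' : Eu m} (h' : Γ.IsKKT t x' μ') : x' = x := by
  by_contra hne
  have h1 := hmono x' x h'.mem h.mem hne
  have h2 := h.sum_inner_sub_le hreg h'.mem h'.multiplier_mem
  have h3 := h'.sum_inner_pseudoGradient_ge hreg h.mem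
  have h4 := h'.inner_gSum_nonpos h.multiplier_mem
  have h5 : ∑ i, inner ℝ (Γ.pseudoGradient t x' i) (x i - x' i)
      = -∑ i, inner ℝ (Γ.pseudoGradient t x' i) (x' i - x i) := by
    rw [← Finset.sum_neg_distrib]
    exact Finset.sum_congr rfl fun i _ => by rw [← inner_neg_right, neg_sub]
  linarith

end IsKKT

lemma StrictlyMonotone.sum_inner_nonneg {t : ℕ} (h : Γ.StrictlyMonotone t)
    {x x' : (i : Fin N) → Eu (d i)} (hx : ∀ i, x i ∈ Γ.X i) (hx' : ∀ i, x' i ∈ Γ.X i) :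
    0 ≤ ∑ i, inner ℝ (Γ.pseudoGradient t x i - Γ.pseudoGradient t x' i) (x i - x' i) := by
  by_cases hne : x = x'
  · simp [hne]
  · exact (h x x' hx hx' hne).le

lemma norm_le_sum_of_mem_nonnegOrthant {μ : Eu m} (hμ : μ ∈ nonnegOrthant m) :
    ‖μ‖ ≤ ∑ j, μ j := by
  have h0 : 0 ≤ ∑ j, μ j := Finset.sum_nonneg fun j _ => hμ j
  rw [← sq_le_sq₀ (norm_nonneg _) h0, EuclideanSpace.norm_sq_eq]
  simp only [Real.norm_eq_abs, sq_abs]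
  exact Finset.sum_sq_le_sq_sum_of_nonneg fun j _ => hμ j

lemma Regular.exists_norm_le (hreg : Γ.Regular) :
    ∃ D > 0, ∀ i, ∀ x ∈ Γ.X i, ‖x‖ ≤ D := by
  have h := fun i => (hreg.compact i).isBounded.exists_norm_le
  choose D hD using h
  refine ⟨∑ i, |D i| + 1, by positivity, fun i x hx => (hD i x hx).trans ?_⟩
  have := Finset.single_le_sum (f := fun i => |D i|) (fun _ _ => abs_nonneg _) (Finset.mem_univ i)
  have := le_abs_self (D i)
  linarith

lemma Regular.exists_norm_g_le (hreg : Γ.Regular) (t : ℕ) :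
    ∃ C > 0, ∀ i, ∀ x ∈ Γ.X i, ‖Γ.g t i x‖ ≤ C := by
  have h := fun i => (hreg.compact i).exists_bound_of_continuousOn (hreg.continuousOn_g t i)
  choose D hD using h
  refine ⟨∑ i, |D i| + 1, by positivity, fun i x hx => (hD i x hx).trans ?_⟩
  have := Finset.single_le_sum (f := fun i => |D i|) (fun _ _ => abs_nonneg _) (Finset.mem_univ i)
  have := le_abs_self (D i)
  linarith

/-- The joint space of decisions and multipliers, with its Euclidean structure. -/
abbrev PrimalDual (m : ℕ) {N : ℕ} (d : Fin N → ℕ) : Type :=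
  WithLp 2 (PiLp 2 (fun i => Eu (d i)) × Eu m)

/-- The Minty form, with the pseudo-gradient evaluated at the test point `y`, is affine in `x` and
`μ` apart from the convex term `⟪ν, g(x)⟫`. It therefore survives averaging and limits without
continuity of the pseudo-gradient. The ball of radius `R` makes the multiplier set compact. -/
lemma Regular.exists_saddle (hreg : Γ.Regular) {t : ℕ} (hmono : Γ.StrictlyMonotone t)
    {S : ℝ} (hS : ∀ i, ∀ x ∈ Γ.X i, ∀ y, ‖Γ.p t i x y‖ ≤ S) {R : ℝ} (hR : 0 ≤ R) :
    ∃ (x : (i : Fin N) → Eu (d i)) (μ : Eu m), (∀ i, x i ∈ Γ.X i) ∧ μ ∈ nonnegOrthant m ∧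
      ∀ (y : (i : Fin N) → Eu (d i)) (ν : Eu m), (∀ i, y i ∈ Γ.X i) → ν ∈ nonnegOrthant m →
        ‖ν‖ ≤ R → ∑ i, inner ℝ (Γ.pseudoGradient t y i) (x i - y i) - inner ℝ μ (Γ.gSum t y)
          + inner ℝ ν (Γ.gSum t x) ≤ 0 ∧ ‖μ‖ ≤ R := by
  let K : Set (PrimalDual m d) :=
    {v | (∀ i, v.fst i ∈ Γ.X i) ∧ v.snd ∈ nonnegOrthant m ∧ ‖v.snd‖ ≤ R}
  let mk : ((i : Fin N) → Eu (d i)) → Eu m → PrimalDual m d :=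
    fun x μ => WithLp.toLp 2 (WithLp.toLp 2 x, μ)
  have hmkc : Continuous fun z : ((i : Fin N) → Eu (d i)) × Eu m => mk z.1 z.2 := by fun_prop
  have hfst : ∀ i, Continuous fun v : PrimalDual m d => v.fst i := fun i => by fun_prop
  have hsnd : Continuous fun v : PrimalDual m d => v.snd := by fun_prop
  have hcomp : IsCompact K := by
    have h1 : IsCompact (nonnegOrthant m ∩ Metric.closedBall (0 : Eu m) R) :=
      (isCompact_closedBall 0 R).inter_left isClosed_nonnegOrthant
    have h2 := ((isCompact_univ_pi hreg.compact).prod h1).image hmkc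
    convert h2 using 1
    ext v
    constructor
    · rintro ⟨h3, h4, h5⟩
      exact ⟨(fun i => v.fst i, v.snd), ⟨fun i _ => h3 i, h4, by simpa using h5⟩, rfl⟩
    · rintro ⟨z, ⟨h3, h4, h5⟩, rfl⟩
      exact ⟨fun i => h3 i trivial, h4, mem_closedBall_zero_iff.1 h5⟩
  have hconv : Convex ℝ K := by
    rintro v ⟨h1, h2, h3⟩ v' ⟨h1', h2', h3'⟩ a b ha hb hab
    refine ⟨fun i => hreg.convex i (h1 i) (h1' i) ha hb hab,
      convex_nonnegOrthant h2 h2' ha hb hab, ?_⟩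
    have := convex_closedBall (0 : Eu m) R (x := v.snd) (by simpa using h3) (y := v'.snd)
      (by simpa using h3') ha hb hab
    simpa using this
  have hgc : ContinuousOn (fun v : PrimalDual m d => Γ.gSum t (fun i => v.fst i)) K := by
    refine continuousOn_finsetSum _ fun i _ => ?_
    exact (hreg.continuousOn_g t i).comp (hfst i).continuousOn fun v hv => hv.1 i
  choose x₀ hx₀ using hreg.nonempty
  obtain ⟨M, hM, hgM⟩ := hreg.g_grad_bdd
  obtain ⟨C, hC, hgC⟩ := hreg.exists_norm_g_le t
  let A : PrimalDual m d → PrimalDual m d := fun v =>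
    mk (fun i => Γ.pseudoGradient t (fun i => v.fst i) i + Γ.gradg t i (v.fst i) v.snd)
      (-Γ.gSum t (fun i => v.fst i))
  have hA : ∀ v w : PrimalDual m d, inner ℝ (A v) w
      = ∑ i, inner ℝ (Γ.pseudoGradient t (fun i => v.fst i) i + Γ.gradg t i (v.fst i) v.snd)
          (w.fst i) - inner ℝ w.snd (Γ.gSum t (fun i => v.fst i)) := by
    intro v w
    rw [WithLp.prod_inner_apply, PiLp.inner_apply, sub_eq_add_neg, ← inner_neg_right,
      real_inner_comm _ w.snd]
    rfl
  let φ : PrimalDual m d → PrimalDual m d → ℝ := fun w v =>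
    ∑ i, inner ℝ (Γ.pseudoGradient t (fun i => w.fst i) i) (v.fst i - w.fst i)
      - inner ℝ v.snd (Γ.gSum t (fun i => w.fst i)) + inner ℝ w.snd (Γ.gSum t (fun i => v.fst i))
  have key := exists_forall_le_zero_of_le_inner (K := K) (A := A) (φ := φ)
    (C := N * (S + M * R) ^ 2 + (N * C) ^ 2)
    ⟨mk x₀ 0, hx₀, zero_mem_nonnegOrthant, by simpa [mk] using hR⟩ hconv hcomp ?_ ?_ ?_ ?_
  · obtain ⟨v, hv, h⟩ := key
    exact ⟨fun i => v.fst i, v.snd, hv.1, hv.2.1, fun y ν hy hν hνR =>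
      ⟨h (mk y ν) ⟨hy, hν, hνR⟩, hv.2.2⟩⟩
  · intro v hv
    rw [← real_inner_self_eq_norm_sq, hA]
    have h1 : ∀ i, inner ℝ (Γ.pseudoGradient t (fun i => v.fst i) i
        + Γ.gradg t i (v.fst i) v.snd) ((A v).fst i) ≤ (S + M * R) ^ 2 := by
      intro i
      change inner ℝ (Γ.pseudoGradient t (fun i => v.fst i) i + Γ.gradg t i (v.fst i) v.snd)
        (Γ.pseudoGradient t (fun i => v.fst i) i + Γ.gradg t i (v.fst i) v.snd) ≤ _
      rw [real_inner_self_eq_norm_sq]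
      refine pow_le_pow_left₀ (norm_nonneg _) ((norm_add_le _ _).trans (add_le_add ?_ ?_)) 2
      · exact hS i _ (hv.1 i) _
      · exact (norm_gradg_le t i _ _).trans
          (mul_le_mul (hgM t i _ (hv.1 i)) hv.2.2 (norm_nonneg _) hM.le)
    have h2 : -inner ℝ (A v).snd (Γ.gSum t fun i => v.fst i) ≤ (N * C) ^ 2 := by
      change -inner ℝ (-Γ.gSum t fun i => v.fst i) (Γ.gSum t fun i => v.fst i) ≤ _
      rw [inner_neg_left, neg_neg, real_inner_self_eq_norm_sq]
      refine pow_le_pow_left₀ (norm_nonneg _) ?_ 2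
      refine (norm_sum_le_of_le _ fun i _ => hgC i _ (hv.1 i)).trans ?_
      simp
    have h3 := Finset.sum_le_sum fun i (_ : i ∈ Finset.univ) => h1 i
    rw [Finset.sum_const, Finset.card_univ, Fintype.card_fin, nsmul_eq_mul] at h3
    linarith
  · intro w hw
    refine ((continuousOn_finsetSum _ fun i _ => ?_).sub ?_).add ?_
    · exact (continuous_const.inner ((hfst i).sub continuous_const)).continuousOn
    · exact (hsnd.inner continuous_const).continuousOn
    · exact continuousOn_const.inner hgc
  · intro w hw
    refine ⟨hconv, fun v hv v' hv' a b ha hb hab => ?_⟩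
    have hg : inner ℝ w.snd (Γ.gSum t fun i => (a • v + b • v').fst i)
        ≤ a * inner ℝ w.snd (Γ.gSum t fun i => v.fst i)
          + b * inner ℝ w.snd (Γ.gSum t fun i => v'.fst i) := by
      simp only [gSum, inner_sum, Finset.mul_sum]
      rw [← Finset.sum_add_distrib]
      exact Finset.sum_le_sum fun i _ =>
        (hreg.convexOn_inner_g t i hw.2.1).2 (hv.1 i) (hv'.1 i) ha hb hab
    have hl : ∑ i, inner ℝ (Γ.pseudoGradient t (fun i => w.fst i) i)
          ((a • v + b • v').fst i - w.fst i)
        = a * ∑ i, inner ℝ (Γ.pseudoGradient t (fun i => w.fst i) i) (v.fst i - w.fst i)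
          + b * ∑ i, inner ℝ (Γ.pseudoGradient t (fun i => w.fst i) i) (v'.fst i - w.fst i) := by
      simp only [Finset.mul_sum]
      rw [← Finset.sum_add_distrib]
      refine Finset.sum_congr rfl fun i _ => ?_
      rw [← inner_smul_right, ← inner_smul_right, ← inner_add_right]
      congr 1
      change a • v.fst i + b • v'.fst i - w.fst i = _
      rw [smul_sub, smul_sub, sub_add_sub_comm, ← add_smul, hab, one_smul]
    have hl2 : inner ℝ (a • v + b • v').snd (Γ.gSum t fun i => w.fst i)
        = a * inner ℝ v.snd (Γ.gSum t fun i => w.fst i)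
          + b * inner ℝ v'.snd (Γ.gSum t fun i => w.fst i) := by
      change inner ℝ (a • v.snd + b • v'.snd) _ = _
      rw [inner_add_left, inner_smul_left, inner_smul_left]
      rfl
    simp only [φ, smul_eq_mul]
    rw [hl, hl2]
    linarith
  -- Monotonicity moves the pseudo-gradient from `v` to the test point `w`; convexity of `g`
  -- replaces its linearization by a difference of values.
  · intro w hw v hv
    rw [hA]
    simp only [φ]
    have h1 := hmono.sum_inner_nonneg hv.1 hw.1
    have h2 : ∀ i, inner ℝ v.snd (Γ.g t i (v.fst i) - Γ.g t i (w.fst i))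
        ≤ inner ℝ (Γ.gradg t i (v.fst i) v.snd) (v.fst i - w.fst i) := by
      intro i
      have := hreg.inner_gradg_sub_le t i hv.2.1 (hv.1 i) (hw.1 i)
      rw [← neg_sub (w.fst i), inner_neg_right, ← neg_sub (Γ.g t i (w.fst i)), inner_neg_right]
      linarith
    have h3 := Finset.sum_le_sum fun i (_ : i ∈ Finset.univ) => h2 i
    rw [← inner_sum, Finset.sum_sub_distrib, inner_sub_right] at h3
    simp only [inner_sub_left, Finset.sum_sub_distrib] at h1
    change _ ≤ ∑ i, inner ℝ (Γ.pseudoGradient t (fun i => v.fst i) i + Γ.gradg t i (v.fst i) v.snd)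
      (v.fst i - w.fst i) - inner ℝ (v.snd - w.snd) (Γ.gSum t fun i => v.fst i)
    simp only [inner_add_left, Finset.sum_add_distrib, inner_sub_left]
    simp only [gSum] at h3 ⊢
    linarith

/-- Take the truncated saddle point, show that the truncation is inactive, and pass from Minty to
the KKT inequality along segments. -/
lemma Regular.exists_isKKT (hreg : Γ.Regular) (hlip : Γ.GradLipschitz) {t : ℕ}
    (hmono : Γ.StrictlyMonotone t) {S : ℝ} (hS : ∀ i, ∀ x ∈ Γ.X i, ∀ y, ‖Γ.p t i x y‖ ≤ S) :
    ∃ x μ, Γ.IsKKT t x μ := by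
  obtain ⟨xhat, hxhat, hslater⟩ := hreg.slater t
  obtain ⟨D, hD, hXD⟩ := hreg.exists_norm_le
  obtain ⟨δ, hδ, hδ0⟩ : ∃ δ : ℝ, (∀ j, Γ.gSum t xhat j ≤ -δ) ∧ 0 < δ := by
    have h1 : ∀ᶠ δ in 𝓝[>] (0 : ℝ), ∀ j, Γ.gSum t xhat j ≤ -δ := by
      refine eventually_all.2 fun j => ?_
      filter_upwards [Ioo_mem_nhdsGT (show 0 < -Γ.gSum t xhat j by linarith [hslater j])] with δ hδ
      linarith [hδ.2]
    exact (h1.and self_mem_nhdsWithin).exists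
  let B : ℝ := N * (|S| * (2 * D))
  have hB : 0 ≤ B := by positivity
  -- The Slater point will force `‖μ‖ ≤ B / δ`; the extra `1` leaves room to perturb `μ` in every
  -- direction of the orthant.
  obtain ⟨x, μ, hx, hμ, h⟩ := hreg.exists_saddle hmono hS (R := B / δ + 1) (by positivity)
  have hμR : ‖μ‖ ≤ B / δ + 1 := (h x 0 hx zero_mem_nonnegOrthant (by simp; positivity)).2
  -- Testing with `y = x` removes the primal part: `μ` maximizes `⟪·, g(x)⟫` over the truncated
  -- orthant.
  have h1 : ∀ ν ∈ nonnegOrthant m, ‖ν‖ ≤ B / δ + 1 →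
      inner ℝ ν (Γ.gSum t x) ≤ inner ℝ μ (Γ.gSum t x) := by
    intro ν hν hνR
    have := (h x ν hx hν hνR).1
    simp only [sub_self, inner_zero_right, Finset.sum_const_zero] at this
    linarith
  have hμ0 : 0 ≤ inner ℝ μ (Γ.gSum t x) := by
    have := h1 0 zero_mem_nonnegOrthant (by simp; positivity)
    simpa using this
  have hμlt : ‖μ‖ ≤ B / δ := by
    have h2 := (h xhat μ hxhat hμ hμR).1
    have h3 : -B ≤ ∑ i, inner ℝ (Γ.pseudoGradient t xhat i) (x i - xhat i) := by
      have h4 : ∀ i, -(|S| * (2 * D)) ≤ inner ℝ (Γ.pseudoGradient t xhat i) (x i - xhat i) := by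
        intro i
        have h5 := neg_le_of_abs_le (abs_real_inner_le_norm (Γ.pseudoGradient t xhat i)
          (x i - xhat i))
        have h6 : ‖x i - xhat i‖ ≤ 2 * D :=
          (norm_sub_le _ _).trans (by linarith [hXD i _ (hx i), hXD i _ (hxhat i)])
        have h7 : ‖Γ.pseudoGradient t xhat i‖ ≤ |S| :=
          (hS i _ (hxhat i) _).trans (le_abs_self S)
        have h8 := mul_le_mul h7 h6 (norm_nonneg _) (abs_nonneg S)
        linarith
      have h9 := Finset.sum_le_sum fun i (_ : i ∈ Finset.univ) => h4 i
      rw [Finset.sum_const, Finset.card_univ, Fintype.card_fin, nsmul_eq_mul] at h9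
      simp only [B]
      linarith
    have h4 : inner ℝ μ (Γ.gSum t xhat) ≤ -(δ * ∑ j, μ j) := by
      rw [inner_eq_sum_mul, Finset.mul_sum, ← Finset.sum_neg_distrib]
      refine Finset.sum_le_sum fun j _ => ?_
      have := mul_le_mul_of_nonneg_left (hδ j) (hμ j)
      linarith
    rw [le_div_iff₀ hδ0]
    have h5 := norm_le_sum_of_mem_nonnegOrthant hμ
    nlinarith
  have hcone : Γ.gSum t x ∈ normalCone (nonnegOrthant m) μ := by
    refine ⟨hμ, fun ν hν => ?_⟩
    -- A step towards `ν` of length at most `1` stays inside the ball, so maximality there extends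
    -- to the whole orthant.
    obtain ⟨e, he0, he1, he⟩ : ∃ e : ℝ, 0 < e ∧ e ≤ 1 ∧ e * ‖ν - μ‖ ≤ 1 := by
      refine ⟨(‖ν - μ‖ + 1)⁻¹, by positivity, inv_le_one_of_one_le₀ (by linarith [norm_nonneg (ν - μ)]), ?_⟩
      rw [inv_mul_le_iff₀ (by positivity)]
      linarith
    have h2 := h1 (μ + e • (ν - μ))
      (convex_nonnegOrthant.add_smul_sub_mem_of_pos hμ hν he0.le he1) (by
        refine (norm_add_le _ _).trans ?_
        rw [norm_smul, Real.norm_of_nonneg he0.le]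
        linarith)
    rw [inner_add_left, inner_smul_left] at h2
    simp only [conj_trivial] at h2
    rw [real_inner_comm]
    by_contra hcon
    push Not at hcon
    have := mul_pos he0 hcon
    linarith
  -- Minty's argument: test at `x + s(u - x)` with `ν = μ`, divide by `s` and let `s` decrease to
  -- `0`. The one-sided bound `A s` stands in for continuity of the pseudo-gradient.
  have hVI : ∀ u : (i : Fin N) → Eu (d i), (∀ i, u i ∈ Γ.X i) →
      0 ≤ ∑ i, inner ℝ (Γ.pseudoGradient t x i + Γ.gradg t i (x i) μ) (u i - x i) := by
    intro u hu
    obtain ⟨A, hA, hAle⟩ := hreg.exists_pseudoGradient_bound hlip t hx hu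
    have h2 : Tendsto (fun s : ℝ => A s + ∑ i, inner ℝ μ
        (s⁻¹ • (Γ.g t i (x i + s • (u i - x i)) - Γ.g t i (x i)))) (𝓝[>] 0)
        (𝓝 (∑ i, inner ℝ (Γ.pseudoGradient t x i) (u i - x i)
          + ∑ i, inner ℝ μ (fderiv ℝ (Γ.g t i) (x i) (u i - x i)))) :=
      hA.add (tendsto_finsetSum _ fun i _ => tendsto_const_nhds.inner
        ((hreg.g_diff t i _ (hx i)).hasFDerivAt.tendsto_slope_right _))
    simp only [inner_add_left, Finset.sum_add_distrib, inner_gradg]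
    refine ge_of_tendsto h2 ?_
    filter_upwards [Ioc_mem_nhdsGT (show (0 : ℝ) < 1 / 2 by norm_num)] with s hs
    have hys : ∀ i, x i + s • (u i - x i) ∈ Γ.X i := fun i =>
      (hreg.convex i).add_smul_sub_mem_of_pos (hx i) (hu i) hs.1.le (by linarith [hs.2])
    have h3 := (h (fun i => x i + s • (u i - x i)) μ hys hμ hμR).1
    have h4 := hAle s hs.1 hs.2
    simp only [sub_add_cancel_left, inner_neg_right, inner_smul_right, Finset.sum_neg_distrib] at h3
    rw [← Finset.mul_sum] at h3
    have h5 : s * ∑ i, inner ℝ μ (s⁻¹ • (Γ.g t i (x i + s • (u i - x i)) - Γ.g t i (x i)))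
        = inner ℝ μ (Γ.gSum t fun i => x i + s • (u i - x i)) - inner ℝ μ (Γ.gSum t x) := by
      rw [← inner_sub_right, gSum, gSum, ← Finset.sum_sub_distrib, inner_sum, Finset.mul_sum]
      refine Finset.sum_congr rfl fun i _ => ?_
      rw [inner_smul_right, ← mul_assoc, mul_inv_cancel₀ hs.1.ne', one_mul]
    have h6 := mul_le_mul_of_nonneg_left h4 hs.1.le
    have h7 : 0 ≤ s * (A s + ∑ i, inner ℝ μ
        (s⁻¹ • (Γ.g t i (x i + s • (u i - x i)) - Γ.g t i (x i)))) := by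
      rw [mul_add, h5]
      linarith
    exact nonneg_of_mul_nonneg_right h7 hs.1
  refine ⟨x, μ, fun i => ⟨hx i, fun u hu => ?_⟩, hcone⟩
  have h2 := hVI (Function.update x i u) fun j => by
    by_cases hj : j = i
    · subst hj; simpa using hu
    · simpa [hj] using hx j
  rw [Finset.sum_eq_single i (fun j _ hj => by simp [hj]) (by simp)] at h2
  simp only [Function.update_self] at h2
  rw [inner_neg_left]
  linarith

end AggGame

/-! ### Monotonicity gap and one-step inequalities along a trajectory -/

/-- The push-sum ratio `û_{i,t} / z_{i,t+1}`. -/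
def pushRatio {N : ℕ} {E : Type*} [AddCommGroup E] [Module ℝ E]
    (w : ℕ → Matrix (Fin N) (Fin N) ℝ) (z : ℕ → Fin N → ℝ) (u : ℕ → Fin N → E) (t : ℕ)
    (i : Fin N) : E := (z (t + 1) i)⁻¹ • matAct (w t) (u t) i

namespace AggGame

variable {N m n : ℕ} {d q : Fin N → ℕ} {Γ : AggGame N m n d q}

/-- Away from `xs`, the monotonicity gap is bounded below; no continuity of the pseudo-gradient is
needed. -/
lemma Regular.exists_pos_le_gap (hreg : Γ.Regular) {t : ℕ} (hmono : Γ.StrictlyMonotone t)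
    {S : ℝ} (hS : ∀ i, ∀ x ∈ Γ.X i, ∀ y, ‖Γ.p t i x y‖ ≤ S) {xs : (i : Fin N) → Eu (d i)}
    (hxs : ∀ i, xs i ∈ Γ.X i) {ε : ℝ} (hε : 0 < ε) :
    ∃ c > 0, ∀ x : (i : Fin N) → Eu (d i), (∀ i, x i ∈ Γ.X i) → ε ≤ ‖x - xs‖ →
      c ≤ ∑ i, inner ℝ (Γ.pseudoGradient t x i - Γ.pseudoGradient t xs i) (x i - xs i) := by
  by_contra! hcon
  have hc := fun k : ℕ => hcon (1 / ((k : ℝ) + 1)) (by positivity)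
  choose u hu hue hugap using hc
  have hcomp := isCompact_univ_pi hreg.compact
  obtain ⟨x', hx', ϕ, hϕ, hlim⟩ := hcomp.tendsto_subseq fun k => Set.mem_univ_pi.2 (hu k)
  have hx'X : ∀ i, x' i ∈ Γ.X i := fun i => hx' i trivial
  have hne : x' ≠ xs := by
    have h1 : ε ≤ ‖x' - xs‖ :=
      ge_of_tendsto' ((hlim.sub_const xs).norm) fun k => hue (ϕ k)
    rintro rfl
    simp at h1
    linarith
  -- Suppose the gaps at `u` vanish along a sequence converging to `x' ≠ xs`, and let `y` be the
  -- midpoint of `xs` and `x'`. Monotonicity between `u` and `y`, with `u - y` split as `(u - xs)/2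
  -- + (u - x')/2`, leaves the pseudo-gradient at `u` only in the vanishing gap and against the
  -- vanishing `u - x'`. In the limit this contradicts strict monotonicity between `y` and `xs`.
  let y : (i : Fin N) → Eu (d i) := fun i => xs i + (1 / 2 : ℝ) • (x' i - xs i)
  have hy : ∀ i, y i ∈ Γ.X i := fun i =>
    (hreg.convex i).add_smul_sub_mem_of_pos (hxs i) (hx'X i) (by norm_num) (by norm_num)
  have hyne : y ≠ xs := by
    intro h
    apply hne
    funext i
    have h1 := congrFun h i
    simpa [y, sub_eq_zero] using h1
  have hb := hmono y xs hy hxs hyne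
  simp only [y, add_sub_cancel_left, inner_smul_right, ← Finset.mul_sum] at hb
  have hi : ∀ i, Tendsto (fun k => u (ϕ k) i) atTop (𝓝 (x' i)) := fun i =>
    ((continuous_apply i).tendsto x').comp hlim
  let b : ℕ → ℝ := fun k => 1 / ((ϕ k : ℝ) + 1)
    + (∑ i, inner ℝ (Γ.pseudoGradient t xs i - Γ.pseudoGradient t y i) (u (ϕ k) i - xs i)
      + ∑ i, (2 * S) * ‖u (ϕ k) i - x' i‖)
  have hblim : Tendsto b atTop (𝓝 (0 +
      (∑ i, inner ℝ (Γ.pseudoGradient t xs i - Γ.pseudoGradient t y i) (x' i - xs i)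
        + ∑ i, (2 * S) * ‖x' i - x' i‖))) := by
    refine (tendsto_one_div_add_atTop_nhds_zero_nat.comp hϕ.tendsto_atTop).add (Tendsto.add ?_ ?_)
    · exact tendsto_finsetSum _ fun i _ => tendsto_const_nhds.inner ((hi i).sub_const _)
    · exact tendsto_finsetSum _ fun i _ => ((hi i).sub_const _).norm.const_mul _
  have hb0 : ∀ k, 0 ≤ b k := by
    intro k
    have h1 := hmono.sum_inner_nonneg (hu (ϕ k)) hy
    have h2 : ∀ i, 2 * inner ℝ (Γ.pseudoGradient t (u (ϕ k)) i - Γ.pseudoGradient t y i)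
        (u (ϕ k) i - y i)
        ≤ inner ℝ (Γ.pseudoGradient t (u (ϕ k)) i - Γ.pseudoGradient t xs i) (u (ϕ k) i - xs i)
          + (inner ℝ (Γ.pseudoGradient t xs i - Γ.pseudoGradient t y i) (u (ϕ k) i - xs i)
            + (2 * S) * ‖u (ϕ k) i - x' i‖) := by
      intro i
      have h3 : ‖Γ.pseudoGradient t (u (ϕ k)) i - Γ.pseudoGradient t y i‖ ≤ 2 * S :=
        (norm_sub_le _ _).trans (by
          have h4 : ‖Γ.pseudoGradient t (u (ϕ k)) i‖ ≤ S := hS i _ (hu _ i) _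
          have h5 : ‖Γ.pseudoGradient t y i‖ ≤ S := hS i _ (hy i) _
          linarith)
      have h4 := (real_inner_le_norm (Γ.pseudoGradient t (u (ϕ k)) i - Γ.pseudoGradient t y i)
        (u (ϕ k) i - x' i)).trans (mul_le_mul_of_nonneg_right h3 (norm_nonneg _))
      have h5 : u (ϕ k) i - y i
          = (1 / 2 : ℝ) • (u (ϕ k) i - xs i) + (1 / 2 : ℝ) • (u (ϕ k) i - x' i) := by
        simp only [y]
        module
      rw [h5, inner_add_right, inner_smul_right, inner_smul_right]
      simp only [inner_sub_left] at h4 ⊢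
      linarith
    have h3 := Finset.sum_le_sum fun i (_ : i ∈ Finset.univ) => h2 i
    rw [← Finset.mul_sum, Finset.sum_add_distrib, Finset.sum_add_distrib] at h3
    have h4 := hugap (ϕ k)
    simp only [b]
    linarith
  have hfin := ge_of_tendsto' hblim hb0
  have h1 : ∑ i, inner ℝ (Γ.pseudoGradient t xs i - Γ.pseudoGradient t y i) (x' i - xs i)
      = -∑ i, inner ℝ (Γ.pseudoGradient t y i - Γ.pseudoGradient t xs i) (x' i - xs i) := by
    rw [← Finset.sum_neg_distrib]
    exact Finset.sum_congr rfl fun i _ => by rw [← inner_neg_left, neg_sub]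
  rw [h1] at hfin
  simp only [sub_self, norm_zero, mul_zero, Finset.sum_const_zero, y] at hfin
  linarith

/-- The recursion of the algorithm, with `v_{i,t}` in place of the sampled gradients. -/
structure IsTrajectory (Γ : AggGame N m n d q) (w : ℕ → Matrix (Fin N) (Fin N) ℝ) (α β : ℕ → ℝ)
    (z : ℕ → Fin N → ℝ) (x : ℕ → (i : Fin N) → Eu (d i)) (μ : ℕ → Fin N → Eu m)
    (σ : ℕ → Fin N → Eu n) (v : ℕ → (i : Fin N) → Eu (d i)) : Prop where
  z_zero : ∀ i, z 0 i = 1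
  z_succ : ∀ t, z (t + 1) = matAct (w t) (z t)
  x_zero : ∀ i, x 0 i ∈ Γ.X i
  x_succ : ∀ t i, x (t + 1) i
    = proj (Γ.X i) (x t i - α t • (v t i + Γ.gradg 0 i (x t i) (pushRatio w z μ t i)))
  μ_zero : ∀ i, μ 0 i = 0
  μ_succ : ∀ t i, μ (t + 1) i = proj (nonnegOrthant m)
    (matAct (w t) (μ t) i + α t • (Γ.g 0 i (x t i) - β t • matAct (w t) (μ t) i))
  σ_zero : ∀ i, σ 0 i = Γ.ψ i (x 0 i)
  σ_succ : ∀ t i, σ (t + 1) i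
    = matAct (w t) (σ t) i + (Γ.ψ i (x (t + 1) i) - Γ.ψ i (x t i))

namespace IsTrajectory

variable {w : ℕ → Matrix (Fin N) (Fin N) ℝ} {α β : ℕ → ℝ} {z : ℕ → Fin N → ℝ}
  {x : ℕ → (i : Fin N) → Eu (d i)} {μ : ℕ → Fin N → Eu m} {σ : ℕ → Fin N → Eu n}
  {v : ℕ → (i : Fin N) → Eu (d i)}

lemma x_mem (h : Γ.IsTrajectory w α β z x μ σ v) (hreg : Γ.Regular) (t : ℕ) (i : Fin N) :
    x t i ∈ Γ.X i := by
  cases t with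
  | zero => exact h.x_zero i
  | succ t =>
    rw [h.x_succ]
    exact proj_mem (hreg.nonempty i) (hreg.compact i).isClosed _

lemma μ_mem (h : Γ.IsTrajectory w α β z x μ σ v) (t : ℕ) (i : Fin N) :
    μ t i ∈ nonnegOrthant m := by
  cases t with
  | zero => rw [h.μ_zero]; exact zero_mem_nonnegOrthant
  | succ t => rw [h.μ_succ]; exact proj_nonnegOrthant_mem _

lemma matAct_μ_mem (h : Γ.IsTrajectory w α β z x μ σ v) (hw : GoodWeights w) (t : ℕ)
    (i : Fin N) : matAct (w t) (μ t) i ∈ nonnegOrthant m :=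
  sum_mem_nonnegOrthant fun j _ => smul_mem_nonnegOrthant (hw.nonneg t i j) (h.μ_mem t j)

lemma meanVec_μ_mem (h : Γ.IsTrajectory w α β z x μ σ v) (t : ℕ) :
    meanVec (μ t) ∈ nonnegOrthant m :=
  smul_mem_nonnegOrthant (by positivity) (sum_mem_nonnegOrthant fun j _ => h.μ_mem t j)

/-- The tracking invariant: mixing preserves sums, and the increments of `ψ` telescope from the
initialization `σ_0 = ψ(x_0)`. -/
lemma meanVec_σ (h : Γ.IsTrajectory w α β z x μ σ v) (hw : GoodWeights w) (t : ℕ) :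
    meanVec (σ t) = Γ.agg (x t) := by
  have key : ∑ i, σ t i = ∑ i, Γ.ψ i (x t i) := by
    induction t with
    | zero => simp [h.σ_zero]
    | succ t ih =>
      simp only [h.σ_succ, Finset.sum_add_distrib, Finset.sum_sub_distrib]
      rw [sum_matAct (hw.col_stochastic t), ih, add_sub_cancel]
  rw [meanVec, key, agg]

/-- The regularization damps by `1 - α β` against a forcing of size `α C` per player. Multiplied by
`β`, the recursion is a convex combination of the previous value and `N C`; `β` nonincreasing allows
passing to `β (t + 1)`. -/
lemma mul_sum_norm_μ_le (h : Γ.IsTrajectory w α β z x μ σ v) (hreg : Γ.Regular)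
    (hw : GoodWeights w) (hα : ∀ t, 0 < α t ∧ α t ≤ 1) (hβ : ∀ t, 0 < β t ∧ β t ≤ 1)
    (hβ' : Antitone β) {C : ℝ} (hC : 0 < C) (hg : ∀ i, ∀ x ∈ Γ.X i, ‖Γ.g 0 i x‖ ≤ C) (t : ℕ) :
    β t * ∑ i, ‖μ t i‖ ≤ N * C := by
  induction t with
  | zero =>
    simp only [h.μ_zero, norm_zero, Finset.sum_const_zero, mul_zero]
    positivity
  | succ t ih =>
    have hab : α t * β t ≤ 1 := by
      have := mul_le_mul (hα t).2 (hβ t).2 (hβ t).1.le zero_le_one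
      simpa using this
    have h1 : ∀ i, ‖μ (t + 1) i‖ ≤ (1 - α t * β t) * ‖matAct (w t) (μ t) i‖ + α t * C := by
      intro i
      rw [h.μ_succ]
      refine (norm_proj_nonnegOrthant_le _).trans ?_
      have h2 : matAct (w t) (μ t) i + α t • (Γ.g 0 i (x t i) - β t • matAct (w t) (μ t) i)
          = (1 - α t * β t) • matAct (w t) (μ t) i + α t • Γ.g 0 i (x t i) := by module
      rw [h2]
      refine (norm_add_le _ _).trans (add_le_add ?_ ?_)
      · rw [norm_smul, Real.norm_of_nonneg (by linarith)]
      · rw [norm_smul, Real.norm_of_nonneg (hα t).1.le]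
        exact mul_le_mul_of_nonneg_left (hg i _ (h.x_mem hreg t i)) (hα t).1.le
    have h2 := Finset.sum_le_sum fun i (_ : i ∈ Finset.univ) => h1 i
    rw [Finset.sum_add_distrib, ← Finset.mul_sum, Finset.sum_const, Finset.card_univ,
      Fintype.card_fin, nsmul_eq_mul] at h2
    have h3 := sum_norm_matAct_le (hw.nonneg t) (hw.col_stochastic t) (μ t)
    have h4 := mul_le_mul_of_nonneg_left h3 (sub_nonneg.2 hab)
    have h5 : 0 ≤ ∑ i, ‖μ (t + 1) i‖ := Finset.sum_nonneg fun _ _ => norm_nonneg _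
    calc β (t + 1) * ∑ i, ‖μ (t + 1) i‖ ≤ β t * ∑ i, ‖μ (t + 1) i‖ :=
          mul_le_mul_of_nonneg_right (hβ' (Nat.le_succ t)) h5
      _ ≤ β t * ((1 - α t * β t) * ∑ i, ‖μ t i‖ + N * (α t * C)) :=
          mul_le_mul_of_nonneg_left (by linarith) (hβ t).1.le
      _ = (1 - α t * β t) * (β t * ∑ i, ‖μ t i‖) + (α t * β t) * (N * C) := by ring
      _ ≤ (1 - α t * β t) * (N * C) + (α t * β t) * (N * C) :=
          add_le_add (mul_le_mul_of_nonneg_left ih (sub_nonneg.2 hab)) le_rfl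
      _ = N * C := by ring

lemma norm_matAct_μ_le (h : Γ.IsTrajectory w α β z x μ σ v) (hreg : Γ.Regular)
    (hw : GoodWeights w) (hα : ∀ t, 0 < α t ∧ α t ≤ 1) (hβ : ∀ t, 0 < β t ∧ β t ≤ 1)
    (hβ' : Antitone β) {C : ℝ} (hC : 0 < C) (hg : ∀ i, ∀ x ∈ Γ.X i, ‖Γ.g 0 i x‖ ≤ C) (t : ℕ)
    (i : Fin N) : β t * ‖matAct (w t) (μ t) i‖ ≤ N * C := by
  refine le_trans (mul_le_mul_of_nonneg_left ?_ (hβ t).1.le)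
    (h.mul_sum_norm_μ_le hreg hw hα hβ hβ' hC hg t)
  exact (Finset.single_le_sum (f := fun i => ‖matAct (w t) (μ t) i‖) (fun _ _ => norm_nonneg _)
    (Finset.mem_univ i)).trans (sum_norm_matAct_le (hw.nonneg t) (hw.col_stochastic t) (μ t))

lemma norm_μ_step_le (h : Γ.IsTrajectory w α β z x μ σ v) (hreg : Γ.Regular)
    (hw : GoodWeights w) (hα : ∀ t, 0 < α t ∧ α t ≤ 1) (hβ : ∀ t, 0 < β t ∧ β t ≤ 1)
    (hβ' : Antitone β) {C : ℝ} (hC : 0 < C) (hg : ∀ i, ∀ x ∈ Γ.X i, ‖Γ.g 0 i x‖ ≤ C) (t : ℕ)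
    (i : Fin N) :
    ‖α t • (Γ.g 0 i (x t i) - β t • matAct (w t) (μ t) i)‖ ≤ α t * (C + N * C) := by
  rw [norm_smul, Real.norm_of_nonneg (hα t).1.le]
  refine mul_le_mul_of_nonneg_left ((norm_sub_le _ _).trans (add_le_add ?_ ?_)) (hα t).1.le
  · exact hg i _ (h.x_mem hreg t i)
  · rw [norm_smul, Real.norm_of_nonneg (hβ t).1.le]
    exact h.norm_matAct_μ_le hreg hw hα hβ hβ' hC hg t i

lemma norm_μ_succ_sub_matAct_le (h : Γ.IsTrajectory w α β z x μ σ v) (hw : GoodWeights w)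
    (t : ℕ) (i : Fin N) : ‖μ (t + 1) i - matAct (w t) (μ t) i‖
      ≤ ‖α t • (Γ.g 0 i (x t i) - β t • matAct (w t) (μ t) i)‖ := by
  have h1 := norm_proj_sub_le isClosed_nonnegOrthant convex_nonnegOrthant
    (matAct (w t) (μ t) i + α t • (Γ.g 0 i (x t i) - β t • matAct (w t) (μ t) i))
    (h.matAct_μ_mem hw t i)
  rwa [add_sub_cancel_left, ← h.μ_succ] at h1

lemma norm_x_succ_sub_le (h : Γ.IsTrajectory w α β z x μ σ v) (hreg : Γ.Regular)
    (hα : ∀ t, 0 < α t ∧ α t ≤ 1) (t : ℕ) (i : Fin N) : ‖x (t + 1) i - x t i‖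
      ≤ α t * ‖v t i + Γ.gradg 0 i (x t i) (pushRatio w z μ t i)‖ := by
  have h1 := norm_proj_sub_le (hreg.compact i).isClosed (hreg.convex i)
    (x t i - α t • (v t i + Γ.gradg 0 i (x t i) (pushRatio w z μ t i))) (h.x_mem hreg t i)
  rwa [sub_sub_cancel_left, norm_neg, norm_smul, Real.norm_of_nonneg (hα t).1.le,
    ← h.x_succ] at h1

/-- One-step inequality for the decision of one player. -/
lemma norm_x_succ_sub_sq_le (h : Γ.IsTrajectory w α β z x μ σ v) (hreg : Γ.Regular)
    (hw : GoodWeights w) (hα : ∀ t, 0 < α t ∧ α t ≤ 1) (hz : ∀ t i, 0 < z t i) {C D L a e₁ e₂ : ℝ}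
    (hg : ∀ i, ∀ x ∈ Γ.X i, ‖Γ.g 0 i x‖ ≤ C) (hD : ∀ i, ∀ x ∈ Γ.X i, ‖x‖ ≤ D)
    (hlip : ∀ i, ∀ x ∈ Γ.X i, ∀ y y' : Eu n, ‖Γ.p 0 i x y - Γ.p 0 i x y'‖ ≤ L * ‖y - y'‖)
    (hL : 0 ≤ L) {t : ℕ} {i : Fin N}
    (ha : ‖v t i + Γ.gradg 0 i (x t i) (pushRatio w z μ t i)‖ ≤ a)
    (he₁ : ‖pushRatio w z μ t i - meanVec (μ t)‖ ≤ e₁)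
    (he₂ : ‖pushRatio w z σ t i - Γ.agg (x t)‖ ≤ e₂) {u : Eu (d i)} (hu : u ∈ Γ.X i) :
    ‖x (t + 1) i - u‖ ^ 2 ≤ ‖x t i - u‖ ^ 2
      - 2 * (α t * inner ℝ (v t i - Γ.p 0 i (x t i) (pushRatio w z σ t i)) (x t i - u))
      - 2 * α t * (inner ℝ (Γ.pseudoGradient 0 (x t) i) (x t i - u)
        + inner ℝ (meanVec (μ t)) (Γ.g 0 i (x t i) - Γ.g 0 i u))
      + α t ^ 2 * a ^ 2 + 4 * C * (α t * e₁) + 4 * L * D * (α t * e₂) := by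
  have hx := h.x_mem hreg t i
  set lam := pushRatio w z μ t i with hlam
  set y := pushRatio w z σ t i
  set dir := v t i + Γ.gradg 0 i (x t i) lam with hdir
  have hlam_mem : lam ∈ nonnegOrthant m :=
    smul_mem_nonnegOrthant (inv_nonneg.2 (hz _ _).le) (h.matAct_μ_mem hw t i)
  have h1 : ‖x (t + 1) i - u‖ ^ 2 ≤ ‖x t i - α t • dir - u‖ ^ 2 := by
    rw [h.x_succ]
    exact norm_proj_sub_sq_le (hreg.compact i).isClosed (hreg.convex i) _ hu
  have h2 : x t i - α t • dir - u = (x t i - u) - α t • dir := by abel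
  rw [h2, norm_sub_sq_real (x t i - u), inner_smul_right, norm_smul, mul_pow, Real.norm_eq_abs,
    sq_abs, real_inner_comm] at h1
  have h3 : ‖dir‖ ^ 2 ≤ a ^ 2 := pow_le_pow_left₀ (norm_nonneg _) ha 2
  have h4 : α t ^ 2 * ‖dir‖ ^ 2 ≤ α t ^ 2 * a ^ 2 := mul_le_mul_of_nonneg_left h3 (sq_nonneg _)
  have hxu : ‖x t i - u‖ ≤ 2 * D :=
    (norm_sub_le _ _).trans (by linarith [hD i _ hx, hD i _ hu])
  have h5 : inner ℝ lam (Γ.g 0 i (x t i) - Γ.g 0 i u)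
      ≤ inner ℝ (Γ.gradg 0 i (x t i) lam) (x t i - u) := by
    have := hreg.inner_gradg_sub_le 0 i hlam_mem hx hu
    rw [← neg_sub u, inner_neg_right, ← neg_sub (Γ.g 0 i u), inner_neg_right]
    linarith
  have h6 : -(2 * C * e₁)
      ≤ inner ℝ (lam - meanVec (μ t)) (Γ.g 0 i (x t i) - Γ.g 0 i u) := by
    have h7 := neg_le_of_abs_le (abs_real_inner_le_norm (lam - meanVec (μ t))
      (Γ.g 0 i (x t i) - Γ.g 0 i u))
    have h8 : ‖Γ.g 0 i (x t i) - Γ.g 0 i u‖ ≤ 2 * C :=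
      (norm_sub_le _ _).trans (by linarith [hg i _ hx, hg i _ hu])
    have h9 := mul_le_mul he₁ h8 (norm_nonneg _) ((norm_nonneg _).trans he₁)
    linarith
  have h10 : -(2 * L * D * e₂) ≤ inner ℝ (Γ.p 0 i (x t i) y - Γ.pseudoGradient 0 (x t) i)
      (x t i - u) := by
    have h7 := neg_le_of_abs_le (abs_real_inner_le_norm
      (Γ.p 0 i (x t i) y - Γ.pseudoGradient 0 (x t) i) (x t i - u))
    have h8 : ‖Γ.p 0 i (x t i) y - Γ.pseudoGradient 0 (x t) i‖ ≤ L * e₂ :=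
      (hlip i _ hx _ _).trans (mul_le_mul_of_nonneg_left he₂ hL)
    have h9 := mul_le_mul h8 hxu (norm_nonneg _) ((norm_nonneg _).trans h8)
    linarith
  have h11 : inner ℝ dir (x t i - u)
      = inner ℝ (v t i - Γ.p 0 i (x t i) y) (x t i - u)
        + inner ℝ (Γ.p 0 i (x t i) y - Γ.pseudoGradient 0 (x t) i) (x t i - u)
        + inner ℝ (Γ.pseudoGradient 0 (x t) i) (x t i - u)
        + inner ℝ (Γ.gradg 0 i (x t i) lam) (x t i - u) := by
    rw [← inner_add_left, ← inner_add_left, ← inner_add_left]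
    congr 1
    rw [hdir]
    abel
  have h12 : inner ℝ (v t i - Γ.p 0 i (x t i) y) (x t i - u) - 2 * L * D * e₂
      + inner ℝ (Γ.pseudoGradient 0 (x t) i) (x t i - u)
      + inner ℝ (meanVec (μ t)) (Γ.g 0 i (x t i) - Γ.g 0 i u) - 2 * C * e₁
      ≤ inner ℝ dir (x t i - u) := by
    rw [inner_sub_left lam] at h6
    rw [h11]
    linarith
  have h13 := mul_le_mul_of_nonneg_left h12 (hα t).1.le
  linarith

/-- One-step inequality for the mean multiplier. -/
lemma norm_meanVec_μ_succ_sub_sq_le (h : Γ.IsTrajectory w α β z x μ σ v) (hN : 0 < N)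
    (hw : GoodWeights w)
    (hα : ∀ t, 0 < α t ∧ α t ≤ 1) (hβ : ∀ t, 0 < β t ∧ β t ≤ 1)
    {δ c e : ℝ} (hδ : 0 < δ) (hz : ∀ t i, δ ≤ z t i) {t : ℕ}
    (hc : ∀ i, ‖α t • (Γ.g 0 i (x t i) - β t • matAct (w t) (μ t) i)‖ ≤ α t * c)
    (he : ∀ i, ‖pushRatio w z μ t i - meanVec (μ t)‖ ≤ e) {ν : Eu m}
    (hν : ν ∈ nonnegOrthant m) :
    N * ‖meanVec (μ (t + 1)) - ν‖ ^ 2 ≤ N * ‖meanVec (μ t) - ν‖ ^ 2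
      + 2 * α t * inner ℝ (Γ.gSum 0 (x t)) (meanVec (μ t) - ν)
      + (N * ‖ν‖ ^ 2) * (α t * β t) + (2 * N * c) * (α t * e)
      + (2 * N * c ^ 2 / δ + N * c ^ 2) * α t ^ 2 := by
  have hNpos : (0 : ℝ) < N := by exact_mod_cast hN
  have hα0 := (hα t).1
  set mb := meanVec (μ t) with hmb
  let step : Fin N → Eu m := fun i => α t • (Γ.g 0 i (x t i) - β t • matAct (w t) (μ t) i)
  let ε : Fin N → Eu m := fun i => μ (t + 1) i - matAct (w t) (μ t) i
  let r : Fin N → Eu m := fun i => μ (t + 1) i - (matAct (w t) (μ t) i + step i)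
  have hε : ∀ i, ε i = step i + r i := fun i => by simp only [ε, r]; abel
  have hmean : meanVec (μ (t + 1)) = mb + meanVec ε := by
    rw [hmb, ← meanVec_step (hw.col_stochastic t)]
    congr 1
    funext i
    simp [ε]
  have hεn : ∀ i, ‖ε i‖ ≤ α t * c := by
    exact fun i => (h.norm_μ_succ_sub_matAct_le hw t i).trans (hc i)
  have hrn : ∀ i, ‖r i‖ ≤ α t * c := by
    intro i
    have h1 := (proj_spec ⟨0, zero_mem_nonnegOrthant⟩ isClosed_nonnegOrthant
      (matAct (w t) (μ t) i + step i)).2 _ (h.matAct_μ_mem hw t i)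
    rw [← h.μ_succ, sub_add_cancel_left, norm_neg] at h1
    exact h1.trans (hc i)
  have hαc : ∀ i : Fin N, 0 ≤ α t * c := fun i => (norm_nonneg _).trans (hεn i)
  -- The projection residual `r i` is orthogonal to `μ (t + 1) i` and pairs nonnegatively with `ν`.
  -- Thus `mb - ν` may be replaced by `mb` minus any multiple of `μ (t + 1) i`; the multiple `1 / z`
  -- makes that difference small.
  have hr : ∀ i, inner ℝ (r i) (mb - ν) ≤ (α t * c) * (e + α t * c / δ) := by
    intro i
    have h1 : 0 ≤ inner ℝ (r i) ν := by
      simp only [r]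
      rw [h.μ_succ]
      exact inner_proj_nonnegOrthant_sub_nonneg _ hν
    have h2 : inner ℝ (r i) (μ (t + 1) i) = 0 := by
      simp only [r]
      rw [h.μ_succ]
      exact inner_proj_nonnegOrthant_sub_self _
    have h3 : inner ℝ (r i) mb = inner ℝ (r i) (mb - (z (t + 1) i)⁻¹ • μ (t + 1) i) := by
      rw [inner_sub_right, inner_smul_right, h2, mul_zero, sub_zero]
    have hzi : 0 < z (t + 1) i := hδ.trans_le (hz _ _)
    have h4 : ‖mb - (z (t + 1) i)⁻¹ • μ (t + 1) i‖ ≤ e + α t * c / δ := by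
      have h5 : mb - (z (t + 1) i)⁻¹ • μ (t + 1) i
          = -(pushRatio w z μ t i - mb) - (z (t + 1) i)⁻¹ • ε i := by
        simp only [pushRatio, ε, smul_sub]
        abel
      rw [h5]
      refine (norm_sub_le _ _).trans (add_le_add ?_ ?_)
      · rw [norm_neg]; exact he i
      · rw [norm_smul, norm_inv, Real.norm_of_nonneg hzi.le, div_eq_inv_mul]
        exact mul_le_mul (inv_anti₀ hδ (hz _ _)) (hεn i) (norm_nonneg _) (inv_nonneg.2 hδ.le)
    have h6 := (real_inner_le_norm (r i) (mb - (z (t + 1) i)⁻¹ • μ (t + 1) i)).trans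
      (mul_le_mul (hrn i) h4 (norm_nonneg _) (hαc i))
    rw [inner_sub_right]
    linarith
  have hrsum := Finset.sum_le_sum fun i (_ : i ∈ Finset.univ) => hr i
  rw [← sum_inner, Finset.sum_const, Finset.card_univ, Fintype.card_fin, nsmul_eq_mul] at hrsum
  have hstep : ∑ i, step i = α t • Γ.gSum 0 (x t) - (α t * β t * N) • mb := by
    simp only [step]
    rw [← Finset.smul_sum, Finset.sum_sub_distrib, ← Finset.smul_sum,
      sum_matAct (hw.col_stochastic t), sum_eq_smul_meanVec hN (μ t), ← hmb, gSum, smul_sub, smul_smul,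
      smul_smul]
  -- Regularization pulls towards `0` rather than `ν`, at a cost of at most `‖ν‖²`; this produces
  -- the `α β` term.
  have hmbν : -(‖ν‖ ^ 2) ≤ 2 * inner ℝ mb (mb - ν) := by
    have h1 := norm_sub_sq_real mb ν
    rw [inner_sub_right, real_inner_self_eq_norm_sq]
    nlinarith [sq_nonneg ‖mb‖, sq_nonneg ‖mb - ν‖]
  have hεsum : (N : ℝ) • meanVec ε = ∑ i, step i + ∑ i, r i := by
    rw [← sum_eq_smul_meanVec hN, ← Finset.sum_add_distrib]
    exact Finset.sum_congr rfl fun i _ => hε i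
  have hεnorm : ‖meanVec ε‖ ≤ α t * c := by
    rw [meanVec, norm_smul, norm_inv, Real.norm_of_nonneg hNpos.le, inv_mul_le_iff₀ hNpos]
    refine (norm_sum_le_of_le _ fun i _ => hεn i).trans ?_
    simp
  have hεsq : ‖meanVec ε‖ ^ 2 ≤ (α t * c) ^ 2 := pow_le_pow_left₀ (norm_nonneg _) hεnorm 2
  have hcross : N * inner ℝ (mb - ν) (meanVec ε)
      = α t * inner ℝ (Γ.gSum 0 (x t)) (mb - ν) - (α t * β t * N) * inner ℝ mb (mb - ν)
        + inner ℝ (∑ i, r i) (mb - ν) := by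
    rw [← real_inner_smul_right, hεsum, hstep, real_inner_comm, inner_add_left, inner_sub_left,
      real_inner_smul_left, real_inner_smul_left]
  have hexp : meanVec (μ (t + 1)) - ν = (mb - ν) + meanVec ε := by rw [hmean]; abel
  rw [hexp, norm_add_sq_real (mb - ν)]
  have hab : 0 ≤ α t * β t * N := by
    have := (hβ t).1
    positivity
  have h1 := mul_le_mul_of_nonneg_left hmbν hab
  have h2 := mul_le_mul_of_nonneg_left hεsq hNpos.le
  have h3 : (N : ℝ) * ((α t * c) * (e + α t * c / δ))
      = N * c * (α t * e) + (N * c ^ 2 / δ) * α t ^ 2 := by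
    field_simp
  rw [h3] at hrsum
  have h4 : 2 * (N : ℝ) * c ^ 2 / δ = 2 * (N * c ^ 2 / δ) := by ring
  rw [h4]
  nlinarith

end IsTrajectory
end AggGame

/-! ### Lyapunov inequality and pathwise convergence -/

namespace AggGame

variable {N m n : ℕ} {d q : Fin N → ℕ} {Γ : AggGame N m n d q}

namespace IsTrajectory

variable {w : ℕ → Matrix (Fin N) (Fin N) ℝ} {α β : ℕ → ℝ} {z : ℕ → Fin N → ℝ}
  {x : ℕ → (i : Fin N) → Eu (d i)} {μ : ℕ → Fin N → Eu m} {σ : ℕ → Fin N → Eu n}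
  {v : ℕ → (i : Fin N) → Eu (d i)}

/-- One-step inequality for the Lyapunov function `‖x - xs‖² + N ‖μ̄ - μs‖²`. -/
lemma lyapunov_succ_le (h : Γ.IsTrajectory w α β z x μ σ v) (hN : 0 < N) (hreg : Γ.Regular)
    (hw : GoodWeights w) (hα : ∀ t, 0 < α t ∧ α t ≤ 1) (hβ : ∀ t, 0 < β t ∧ β t ≤ 1)
    {δ C D L a c e₁ e₂ : ℝ} (hδ : 0 < δ) (hz : ∀ t i, δ ≤ z t i)
    (hg : ∀ i, ∀ x ∈ Γ.X i, ‖Γ.g 0 i x‖ ≤ C) (hD : ∀ i, ∀ x ∈ Γ.X i, ‖x‖ ≤ D)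
    (hlip : ∀ i, ∀ x ∈ Γ.X i, ∀ y y' : Eu n, ‖Γ.p 0 i x y - Γ.p 0 i x y'‖ ≤ L * ‖y - y'‖)
    (hL : 0 ≤ L) {t : ℕ}
    (ha : ∀ i, ‖v t i + Γ.gradg 0 i (x t i) (pushRatio w z μ t i)‖ ≤ a)
    (hc : ∀ i, ‖α t • (Γ.g 0 i (x t i) - β t • matAct (w t) (μ t) i)‖ ≤ α t * c)
    (he₁ : ∀ i, ‖pushRatio w z μ t i - meanVec (μ t)‖ ≤ e₁)
    (he₂ : ∀ i, ‖pushRatio w z σ t i - Γ.agg (x t)‖ ≤ e₂)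
    {xs : (i : Fin N) → Eu (d i)} {μs : Eu m} (hK : Γ.IsKKT 0 xs μs) :
    (∑ i, ‖x (t + 1) i - xs i‖ ^ 2 + N * ‖meanVec (μ (t + 1)) - μs‖ ^ 2)
      + 2 * (α t * ∑ i, inner ℝ (Γ.pseudoGradient 0 (x t) i - Γ.pseudoGradient 0 xs i)
          (x t i - xs i))
      ≤ (∑ i, ‖x t i - xs i‖ ^ 2 + N * ‖meanVec (μ t) - μs‖ ^ 2)
        - 2 * ∑ i, α t * inner ℝ (v t i - Γ.p 0 i (x t i) (pushRatio w z σ t i)) (x t i - xs i)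
        + (N * (α t ^ 2 * a ^ 2) + (4 * N * C + 2 * N * c) * (α t * e₁)
          + 4 * N * L * D * (α t * e₂) + (N * ‖μs‖ ^ 2) * (α t * β t)
          + (2 * N * c ^ 2 / δ + N * c ^ 2) * α t ^ 2) := by
  have h1 := Finset.sum_le_sum fun i (_ : i ∈ Finset.univ) =>
    h.norm_x_succ_sub_sq_le hreg hw hα (fun t i => hδ.trans_le (hz t i)) hg hD hlip hL
      (ha i) (he₁ i) (he₂ i) (hK.mem i)
  simp only [Finset.sum_add_distrib, Finset.sum_sub_distrib, ← Finset.mul_sum, Finset.sum_const,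
    Finset.card_univ, Fintype.card_fin, nsmul_eq_mul, ← inner_sum] at h1
  have h2 := h.norm_meanVec_μ_succ_sub_sq_le hN hw hα hβ hδ hz hc he₁ hK.multiplier_mem
  -- When the primal and dual inequalities are added, the terms pairing the mean multiplier with
  -- `g(x_t)` cancel. What remains is exactly the duality gap bounded here.
  have h3 := hK.sum_inner_sub_le hreg (h.x_mem hreg t) (h.meanVec_μ_mem t)
  have h4 := mul_le_mul_of_nonneg_left h3 (hα t).1.le
  have h5 : inner ℝ (Γ.gSum 0 (x t)) (meanVec (μ t) - μs)
      = inner ℝ (meanVec (μ t)) (Γ.gSum 0 (x t)) - inner ℝ μs (Γ.gSum 0 (x t)) := by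
    rw [real_inner_comm, inner_sub_left]
  have h6 : inner ℝ (meanVec (μ t)) (∑ i, Γ.g 0 i (x t i) - ∑ i, Γ.g 0 i (xs i))
      = inner ℝ (meanVec (μ t)) (Γ.gSum 0 (x t)) - inner ℝ (meanVec (μ t)) (Γ.gSum 0 xs) := by
    rw [inner_sub_right, gSum, gSum]
  rw [h5] at h2
  rw [h6] at h1
  rw [← Finset.mul_sum]
  linarith

/-- Pathwise convergence: the decisions converge to the equilibrium as soon as the accumulated
gradient noise stays bounded below. -/
theorem tendsto_x (h : Γ.IsTrajectory w α β z x μ σ v) (hN : 0 < N) (hreg : Γ.Regular)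
    (hw : GoodWeights w) (hlip : Γ.GradLipschitz) (hmono : Γ.StrictlyMonotone 0)
    (hα : ∀ t, 0 < α t ∧ α t ≤ 1) (hα' : Antitone α)
    (hβ : ∀ t, 0 < β t ∧ β t ≤ 1) (hβ' : Antitone β)
    (hns : ¬ Summable α) (hsum_sq : Summable fun t => α t ^ 2)
    (hsum_sq_div_sq : Summable fun t => α t ^ 2 / β t ^ 2)
    (hsum_mul : Summable fun t => α t * β t)
    (hsum_sq_div : Summable fun t => α t ^ 2 / β t)
    {S : ℝ} (hS0 : 0 < S) (hS : ∀ i, ∀ x ∈ Γ.X i, ∀ y, ‖Γ.p 0 i x y‖ ≤ S)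
    (hv : ∀ t i, ‖v t i‖ ≤ S) {xs : (i : Fin N) → Eu (d i)} {μs : Eu m}
    (hK : Γ.IsKKT 0 xs μs) {B : ℝ}
    (hB : ∀ T, -B ≤ ∑ t ∈ Finset.range T, ∑ i,
      α t * inner ℝ (v t i - Γ.p 0 i (x t i) (pushRatio w z σ t i)) (x t i - xs i)) :
    Tendsto x atTop (𝓝 xs) := by
  obtain ⟨δ, hδ, hz⟩ := exists_pushSum_weights_ge hN hw h.z_zero h.z_succ
  obtain ⟨K, ρ, hρ0, hρ1, hcon⟩ := exists_disagreement_contraction hN hw h.z_zero h.z_succ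
  obtain ⟨M, hM, hgM⟩ := hreg.g_grad_bdd
  obtain ⟨C, hC, hg⟩ := hreg.exists_norm_g_le 0
  obtain ⟨D, hD0, hD⟩ := hreg.exists_norm_le
  obtain ⟨L, hL, hpL⟩ := hlip
  obtain ⟨Lψ, hLψ, hψ⟩ := hreg.ψ_lip
  set c := C + N * C with hcdef
  have hc0 : 0 < c := by positivity
  have hc := h.norm_μ_step_le hreg hw hα hβ hβ' hC hg
  let Eμ : ℕ → ℝ := fun t => disagreement (z t) (μ t)
  let Eσ : ℕ → ℝ := fun t => disagreement (z t) (σ t)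
  have hEμ0 : ∀ t, 0 ≤ Eμ t := fun t => disagreement_nonneg _ _
  have hEσ0 : ∀ t, 0 ≤ Eσ t := fun t => disagreement_nonneg _ _
  have hμe : ∀ t, ∑ i, ‖(μ (t + 1) - matAct (w t) (μ t)) i‖ ≤ N * (α t * c) := by
    intro t
    refine (Finset.sum_le_sum fun i _ => (h.norm_μ_succ_sub_matAct_le hw t i).trans (hc t i)).trans ?_
    simp [hcdef]
  have hμcon := hcon μ (fun t => μ (t + 1) - matAct (w t) (μ t)) fun t =>
    (add_sub_cancel (matAct (w t) (μ t)) (μ (t + 1))).symm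
  have hμsum : Summable fun t => α t * Eμ t := by
    refine summable_mul_of_delayed_contraction (E := Eμ)
      (e := fun t => ∑ i, ‖(μ (t + 1) - matAct (w t) (μ t)) i‖) (fun t => (hα t).1.le) hα' hEμ0
      (fun t => Finset.sum_nonneg fun i _ => norm_nonneg _) hρ0 hρ1 ?_ hμcon
    refine Summable.of_nonneg_of_le (fun t => mul_nonneg (hα t).1.le
      (Finset.sum_nonneg fun i _ => norm_nonneg _)) (fun t => ?_) (hsum_sq.mul_left (N * c))
    calc _ ≤ α t * (N * (α t * c)) := mul_le_mul_of_nonneg_left (hμe t) (hα t).1.le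
      _ = _ := by ring
  obtain ⟨Bμ, hBμ⟩ : ∃ B, ∀ t, Eμ t ≤ B := by
    refine bounded_of_delayed_contraction (C := 2 * (K * (N * c))) (K := K) hEμ0 hρ0 hρ1
      (by positivity) fun t => (hμcon t).trans ?_
    have h1 : ∑ s ∈ Finset.range K, ∑ i, ‖(μ (t + s + 1) - matAct (w (t + s)) (μ (t + s))) i‖
        ≤ ∑ s ∈ Finset.range K, (N * c : ℝ) := by
      refine Finset.sum_le_sum fun s _ => (hμe _).trans ?_
      have := (hα (t + s)).2
      have : α (t + s) * c ≤ c := by nlinarith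
      gcongr
    rw [Finset.sum_const, Finset.card_range, nsmul_eq_mul] at h1
    simp only [Eμ]
    linarith
  have hlamdev : ∀ t i, ‖pushRatio w z μ t i - meanVec (μ t)‖ ≤ Eμ t / δ := fun t i =>
    norm_inv_smul_matAct_sub_meanVec_le hw h.z_succ hδ hz t (μ t) i
  have hydev : ∀ t i, ‖pushRatio w z σ t i - Γ.agg (x t)‖ ≤ Eσ t / δ := fun t i => by
    rw [← h.meanVec_σ hw t]
    exact norm_inv_smul_matAct_sub_meanVec_le hw h.z_succ hδ hz t (σ t) i
  have hdir : ∀ t i, ‖v t i + Γ.gradg 0 i (x t i) (pushRatio w z μ t i)‖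
      ≤ S + M * ‖pushRatio w z μ t i‖ := fun t i =>
    (norm_add_le _ _).trans (add_le_add (hv t i) ((norm_gradg_le _ _ _ _).trans
      (mul_le_mul_of_nonneg_right (hgM 0 i _ (h.x_mem hreg t i)) (norm_nonneg _))))
  -- First, crude pass: only `β ‖μ‖ ≤ N C` is known, so directions are bounded by `A / β`. This is
  -- enough to make all error terms summable.
  set A := S + M * (δ⁻¹ * (N * C)) with hA
  have hA0 : 0 < A := by positivity
  have hdirβ : ∀ t i, ‖v t i + Γ.gradg 0 i (x t i) (pushRatio w z μ t i)‖ ≤ A / β t := by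
    intro t i
    refine (hdir t i).trans ?_
    have hβt := hβ t
    rw [le_div_iff₀ hβt.1, add_mul]
    refine add_le_add (mul_le_of_le_one_right hS0.le hβt.2) ?_
    rw [mul_assoc]
    refine mul_le_mul_of_nonneg_left ?_ hM.le
    rw [pushRatio, norm_smul, norm_inv, Real.norm_of_nonneg (hδ.le.trans (hz _ _)), mul_assoc]
    refine mul_le_mul (inv_anti₀ hδ (hz _ _)) ?_ (by have := hβt.1; positivity) (by positivity)
    rw [mul_comm]
    exact h.norm_matAct_μ_le hreg hw hα hβ hβ' hC hg t i
  have hσsum : Summable fun t => α t * Eσ t := by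
    refine summable_mul_of_delayed_contraction (E := Eσ)
      (e := fun t => ∑ i, ‖Γ.ψ i (x (t + 1) i) - Γ.ψ i (x t i)‖) (fun t => (hα t).1.le) hα' hEσ0
      (fun t => Finset.sum_nonneg fun i _ => norm_nonneg _) hρ0 hρ1 ?_
      (hcon σ (fun t i => Γ.ψ i (x (t + 1) i) - Γ.ψ i (x t i)) fun t => funext fun i =>
        h.σ_succ t i)
    refine Summable.of_nonneg_of_le (fun t => mul_nonneg (hα t).1.le
      (Finset.sum_nonneg fun i _ => norm_nonneg _)) (fun t => ?_) (hsum_sq_div.mul_left (N * Lψ * A))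
    have h1 : ∑ i, ‖Γ.ψ i (x (t + 1) i) - Γ.ψ i (x t i)‖ ≤ N * (Lψ * (α t * (A / β t))) := by
      refine (Finset.sum_le_sum (g := fun _ => Lψ * (α t * (A / β t))) fun i _ => ?_).trans ?_
      · refine (hψ i _ (h.x_mem hreg _ i) _ (h.x_mem hreg _ i)).trans ?_
        refine mul_le_mul_of_nonneg_left ((h.norm_x_succ_sub_le hreg hα t i).trans ?_) hLψ.le
        exact mul_le_mul_of_nonneg_left (hdirβ t i) (hα t).1.le
      · simp
    calc _ ≤ α t * (N * (Lψ * (α t * (A / β t)))) := mul_le_mul_of_nonneg_left h1 (hα t).1.le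
      _ = _ := by ring
  let V : ℕ → ℝ := fun t => ∑ i, ‖x t i - xs i‖ ^ 2 + N * ‖meanVec (μ t) - μs‖ ^ 2
  let φ : ℕ → ℝ := fun t => ∑ i, inner ℝ (Γ.pseudoGradient 0 (x t) i - Γ.pseudoGradient 0 xs i)
    (x t i - xs i)
  have hφ0 : ∀ t, 0 ≤ φ t := fun t => hmono.sum_inner_nonneg (h.x_mem hreg t) hK.mem
  let η : ℕ → ℝ := fun t => N * (α t ^ 2 * (A / β t) ^ 2)
    + (4 * N * C + 2 * N * c) * (α t * (Eμ t / δ)) + 4 * N * L * D * (α t * (Eσ t / δ))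
    + (N * ‖μs‖ ^ 2) * (α t * β t) + (2 * N * c ^ 2 / δ + N * c ^ 2) * α t ^ 2
  have hη : Summable η := by
    have h1 : Summable fun t => α t ^ 2 * (A / β t) ^ 2 :=
      (hsum_sq_div_sq.mul_left (A ^ 2)).congr fun t => by rw [div_pow]; ring
    have h2 : Summable fun t => α t * (Eμ t / δ) := (hμsum.mul_left δ⁻¹).congr fun t => by ring
    have h3 : Summable fun t => α t * (Eσ t / δ) := (hσsum.mul_left δ⁻¹).congr fun t => by ring
    exact ((((h1.mul_left _).add (h2.mul_left _)).add (h3.mul_left _)).add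
      (hsum_mul.mul_left _)).add (hsum_sq.mul_left _)
  have hη0 : ∀ t, 0 ≤ η t := by
    intro t
    have h1 := (hα t).1
    have h2 := (hβ t).1
    have h3 := hEμ0 t
    have h4 := hEσ0 t
    simp only [η]
    positivity
  have hstep : ∀ t, V (t + 1) + 2 * (α t * φ t) ≤ V t
      - 2 * ∑ i, α t * inner ℝ (v t i - Γ.p 0 i (x t i) (pushRatio w z σ t i)) (x t i - xs i)
      + η t := fun t =>
    h.lyapunov_succ_le hN hreg hw hα hβ hδ hz hg hD (hpL 0) hL.le (hdirβ t) (hc t) (hlamdev t)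
      (hydev t) hK
  have hV : ∀ T, V T + 2 * ∑ t ∈ Finset.range T, α t * φ t ≤ V 0 + 2 * B + ∑' t, η t := by
    intro T
    have h1 : V T + 2 * ∑ t ∈ Finset.range T, α t * φ t ≤ V 0
        - 2 * ∑ t ∈ Finset.range T, ∑ i,
          α t * inner ℝ (v t i - Γ.p 0 i (x t i) (pushRatio w z σ t i)) (x t i - xs i)
        + ∑ t ∈ Finset.range T, η t := by
      induction T with
      | zero => simp
      | succ T ih =>
        simp only [Finset.sum_range_succ]
        have := hstep T
        linarith
    have h2 := hη.sum_le_tsum (Finset.range T) fun t _ => hη0 t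
    have h3 := hB T
    linarith
  have hV0 : ∀ T, 0 ≤ V T := fun T => by positivity
  have hφα0 : ∀ t, 0 ≤ α t * φ t := fun t => mul_nonneg (hα t).1.le (hφ0 t)
  set W := V 0 + 2 * B + ∑' t, η t with hW
  have hφsum : Summable fun t => α t * φ t :=
    summable_of_sum_range_le (c := W / 2) hφα0 fun T => by linarith [hV T, hV0 T]
  have hVW : ∀ T, V T ≤ W := fun T => by
    have := hV T
    have := Finset.sum_nonneg fun t (_ : t ∈ Finset.range T) => hφα0 t
    linarith
  -- Second pass: boundedness of `V` bounds the mean multiplier, and bounded disagreement carries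
  -- this over to the push-sum ratios. The increments of `x` thereby become `O(α)`, as the
  -- convergence criterion requires.
  have hmean : ∀ t, ‖meanVec (μ t)‖ ≤ ‖μs‖ + (W + 1) := by
    intro t
    have h1 : (1 : ℝ) ≤ N := by exact_mod_cast hN
    have h2 : ‖meanVec (μ t) - μs‖ ^ 2 ≤ W := by
      have h3 : N * ‖meanVec (μ t) - μs‖ ^ 2 ≤ V t :=
        le_add_of_nonneg_left (Finset.sum_nonneg fun _ _ => by positivity)
      nlinarith [hVW t, sq_nonneg ‖meanVec (μ t) - μs‖]
    have h3 : ‖meanVec (μ t) - μs‖ ≤ W + 1 := by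
      nlinarith [norm_nonneg (meanVec (μ t) - μs), sq_nonneg (‖meanVec (μ t) - μs‖ - 1)]
    have h4 := norm_le_norm_add_norm_sub' (meanVec (μ t)) μs
    linarith
  have hlamb : ∀ t i, ‖pushRatio w z μ t i‖ ≤ ‖μs‖ + (W + 1) + Bμ / δ := by
    intro t i
    have h1 := norm_le_norm_add_norm_sub' (pushRatio w z μ t i) (meanVec (μ t))
    have h2 := hlamdev t i
    have h3 : Eμ t / δ ≤ Bμ / δ := div_le_div_of_nonneg_right (hBμ t) hδ.le
    have h4 := hmean t
    linarith
  set R := ‖μs‖ + (W + 1) + Bμ / δ with hR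
  have hR0 : 0 ≤ R := (norm_nonneg _).trans (hlamb 0 ⟨0, hN⟩)
  have hinc : ∀ t, ‖x (t + 1) - x t‖ ≤ (S + M * R) * α t := by
    intro t
    have h0 := (hα t).1
    refine (pi_norm_le_iff_of_nonneg (by positivity)).2 fun i => ?_
    refine (h.norm_x_succ_sub_le hreg hα t i).trans ?_
    rw [mul_comm]
    refine mul_le_mul_of_nonneg_right ((hdir t i).trans ?_) h0.le
    have := mul_le_mul_of_nonneg_left (hlamb t i) hM.le
    linarith
  have hα0 : Tendsto α atTop (𝓝 0) := by
    have h1 := hsum_sq.tendsto_atTop_zero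
    have h2 := h1.sqrt
    rw [Real.sqrt_zero] at h2
    exact h2.congr fun t => Real.sqrt_sq (hα t).1.le
  rw [tendsto_iff_norm_sub_tendsto_zero]
  refine tendsto_zero_of_summable_mul (φ := φ) (α := α) (C := S + M * R) (fun t => norm_nonneg _)
    (by positivity) (fun t => ?_) (fun t => (hα t).1.le) hα0 hns hφ0 hφsum fun ε hε => ?_
  · refine (abs_norm_sub_norm_le _ _).trans ?_
    rw [sub_sub_sub_cancel_right]
    exact hinc t
  · obtain ⟨κ, hκ, hgap⟩ := hreg.exists_pos_le_gap hmono hS hK.mem hε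
    exact ⟨κ, hκ, fun t ht => hgap _ (h.x_mem hreg t) ht⟩

end IsTrajectory
end AggGame

/-! ### Martingale noise -/

section Martingale

/-- Partial sums of bounded martingale differences with square-summable bounds are almost surely
bounded. -/
lemma ae_exists_forall_neg_le_sum_of_condExp_eq_zero {Ω : Type*} {m0 : MeasurableSpace Ω}
    {P : Measure Ω} [IsProbabilityMeasure P] (ℱ : Filtration ℕ m0) {D : ℕ → Ω → ℝ} {a : ℕ → ℝ}
    (hmeas : ∀ t, StronglyMeasurable[ℱ (t + 1)] (D t)) (hbd : ∀ t, ∀ᵐ ω ∂P, |D t ω| ≤ a t)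
    (hcond : ∀ t, P[D t | ℱ t] =ᵐ[P] 0) (hsum : Summable fun t => a t ^ 2) :
    ∀ᵐ ω ∂P, ∃ B, ∀ T, -B ≤ ∑ t ∈ Finset.range T, D t ω := by
  let M : ℕ → Ω → ℝ := fun T ω => ∑ t ∈ Finset.range T, D t ω
  have hMs : ∀ T, M (T + 1) = M T + D T := fun T => funext fun ω => Finset.sum_range_succ _ _
  have hMmeas : ∀ T, StronglyMeasurable[ℱ T] (M T) := by
    intro T
    refine Finset.stronglyMeasurable_fun_sum _ fun t ht => ?_
    exact (hmeas t).mono (ℱ.mono (Finset.mem_range.1 ht))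
  have hDm : ∀ t, AEStronglyMeasurable (D t) P := fun t =>
    ((hmeas t).mono (ℱ.le _)).aestronglyMeasurable
  have hMm : ∀ t, AEStronglyMeasurable (M t) P := fun t =>
    ((hMmeas t).mono (ℱ.le _)).aestronglyMeasurable
  have hall := ae_all_iff.2 hbd
  have hMb : ∀ T, ∀ᵐ ω ∂P, |M T ω| ≤ ∑ t ∈ Finset.range T, a t := fun T => by
    filter_upwards [hall] with ω hω
    exact (Finset.abs_sum_le_sum_abs _ _).trans (Finset.sum_le_sum fun t _ => hω t)
  have hDint : ∀ t, Integrable (D t) P := fun t => Integrable.of_bound (hDm t) (a t) (hbd t)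
  have hMint : ∀ t, Integrable (M t) P := fun t => Integrable.of_bound (hMm t) _ (hMb t)
  have hprod : ∀ {f g : Ω → ℝ} {A B : ℝ}, AEStronglyMeasurable f P → AEStronglyMeasurable g P →
      (∀ᵐ ω ∂P, |f ω| ≤ A) → (∀ᵐ ω ∂P, |g ω| ≤ B) → Integrable (f * g) P := by
    intro f g A B hf hg hA hB
    refine Integrable.of_bound (hf.mul hg) (A * B) ?_
    filter_upwards [hA, hB] with ω h1 h2
    rw [Pi.mul_apply, norm_mul]
    exact mul_le_mul h1 h2 (norm_nonneg _) ((abs_nonneg _).trans h1)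
  -- Orthogonality of the increments: second moments add up and stay below `∑ a ^ 2`. With `|M| ≤ 1
  -- + M²` this bounds the martingale in `L¹`, so it converges almost surely and its paths are
  -- bounded.
  have hcross : ∀ T, ∫ ω, (M T * D T) ω ∂P = 0 := by
    intro T
    rw [← integral_condExp (ℱ.le T)]
    have h1 := condExp_mul_of_stronglyMeasurable_left (hMmeas T)
      (hprod (hMm T) (hDm T) (hMb T) (hbd T)) (hDint T)
    rw [integral_eq_zero_of_ae]
    filter_upwards [h1, hcond T] with ω h2 h3
    rw [h2, Pi.mul_apply, h3]
    simp
  have hsq : ∀ T, ∫ ω, (M T * M T) ω ∂P ≤ ∑ t ∈ Finset.range T, a t ^ 2 := by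
    intro T
    induction T with
    | zero => simp [M]
    | succ T ih =>
      have h1 : M (T + 1) * M (T + 1) = M T * M T + (2 : ℝ) • (M T * D T) + D T * D T := by
        rw [hMs]
        funext ω
        simp only [Pi.mul_apply, Pi.add_apply, Pi.smul_apply, smul_eq_mul]
        ring
      have i1 := hprod (hMm T) (hMm T) (hMb T) (hMb T)
      have i2 := (hprod (hMm T) (hDm T) (hMb T) (hbd T)).smul (2 : ℝ)
      have i3 := hprod (hDm T) (hDm T) (hbd T) (hbd T)
      rw [h1, integral_add' (i1.add i2) i3, integral_add' i1 i2]
      have h2 : ∫ ω, ((2 : ℝ) • (M T * D T)) ω ∂P = 0 := by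
        simp only [Pi.smul_apply]
        rw [integral_smul, hcross, smul_zero]
      have h3 : ∫ ω, (D T * D T) ω ∂P ≤ a T ^ 2 := by
        have h4 := integral_mono_ae i3 (integrable_const (a T ^ 2)) (by
          filter_upwards [hbd T] with ω h5
          rw [Pi.mul_apply, ← sq, ← sq_abs]
          exact pow_le_pow_left₀ (abs_nonneg _) h5 2)
        simpa using h4
      rw [h2, Finset.sum_range_succ]
      linarith
  have hmart : Martingale M ℱ P := by
    refine martingale_of_condExp_sub_eq_zero_nat hMmeas hMint fun T => ?_
    rw [hMs, add_sub_cancel_left]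
    exact hcond T
  have hL1 : ∀ T, eLpNorm (M T) 1 P ≤ (Real.toNNReal (1 + ∑' t, a t ^ 2) : ENNReal) := by
    intro T
    rw [eLpNorm_one_eq_lintegral_enorm, ← ofReal_integral_norm_eq_lintegral_enorm (hMint T)]
    refine ENNReal.ofReal_le_ofReal ?_
    have i1 := hprod (hMm T) (hMm T) (hMb T) (hMb T)
    have h1 : ∫ ω, ‖M T ω‖ ∂P ≤ ∫ ω, (1 + (M T * M T) ω) ∂P := by
      refine integral_mono (hMint T).norm ((integrable_const 1).add i1) fun ω => ?_
      simp only [Pi.mul_apply, Real.norm_eq_abs]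
      nlinarith [sq_abs (M T ω), sq_nonneg (|M T ω| - 1)]
    rw [integral_add (integrable_const 1) i1] at h1
    have h2 := hsq T
    have h3 := hsum.sum_le_tsum (Finset.range T) fun t _ => sq_nonneg (a t)
    simp only [Real.norm_eq_abs]
    simp at h1 h2
    linarith
  filter_upwards [hmart.submartingale.ae_tendsto_limitProcess hL1] with ω hω
  obtain ⟨B, hB⟩ := hω.bddBelow_range
  exact ⟨-B, fun T => by rw [neg_neg]; exact hB ⟨T, rfl⟩⟩

end Martingale

/-! ### The algorithm as an adapted trajectory -/

namespace AggGame

variable {N m n : ℕ} {d q : Fin N → ℕ} {Γ : AggGame N m n d q}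

lemma IsTimeInvariant.p_eq (hinv : Γ.IsTimeInvariant) (t : ℕ) (i : Fin N) (x : Eu (d i))
    (y : Eu n) : Γ.p t i x y = Γ.p 0 i x y := by
  have h : Γ.cost t i = Γ.cost 0 i := funext fun u => funext fun v => hinv.1 t i u v
  simp only [p, h]

lemma IsTimeInvariant.g_eq (hinv : Γ.IsTimeInvariant) (t : ℕ) (i : Fin N) :
    Γ.g t i = Γ.g 0 i := funext fun u => hinv.2 t i u

lemma IsTimeInvariant.gradg_eq (hinv : Γ.IsTimeInvariant) (t : ℕ) (i : Fin N) (x : Eu (d i))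
    (μ : Eu m) : Γ.gradg t i x μ = Γ.gradg 0 i x μ := by
  simp only [gradg, hinv.g_eq t i]

/-- The push-sum estimate of the aggregate at which player `i` samples its gradient. -/
def aggEstimate (w : ℕ → Matrix (Fin N) (Fin N) ℝ) (st : AlgState N m n d) (t : ℕ) (i : Fin N) :
    Eu n := (∑ j, w t i j * st.z j)⁻¹ • ∑ j, w t i j • st.σ j

lemma isTrajectory_algRun (hinv : Γ.IsTimeInvariant) (w : ℕ → Matrix (Fin N) (Fin N) ℝ)
    (α β : ℕ → ℝ) {x₀ : (i : Fin N) → Eu (d i)} (hx₀ : ∀ i, x₀ i ∈ Γ.X i)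
    (s : (i : Fin N) → ℕ → Eu (q i)) :
    Γ.IsTrajectory w α β (fun t => (Γ.algRun w α β α x₀ s t).z)
      (fun t => (Γ.algRun w α β α x₀ s t).x) (fun t => (Γ.algRun w α β α x₀ s t).μ)
      (fun t => (Γ.algRun w α β α x₀ s t).σ)
      (fun t i => Γ.qs t i ((Γ.algRun w α β α x₀ s t).x i)
        (aggEstimate w (Γ.algRun w α β α x₀ s t) t i) (s i t)) where
  z_zero _ := rfl
  z_succ _ := rfl
  x_zero := hx₀
  x_succ t i := by
    rw [← hinv.gradg_eq t]
    rfl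
  μ_zero _ := rfl
  μ_succ t i := by
    rw [← hinv.g_eq t]
    rfl
  σ_zero _ := rfl
  σ_succ t i := add_sub_assoc _ _ _

section Measurability

variable {Ω : Type*}

/-- Each coordinate pairs `v` with a directional derivative, and such derivatives are measurable
without any regularity of `g`. -/
lemma measurable_gradg [mΩ : MeasurableSpace Ω] (t : ℕ) (i : Fin N) {x : Ω → Eu (d i)}
    {v : Ω → Eu m} (hx : Measurable x) (hv : Measurable v) :
    Measurable fun ω => Γ.gradg t i (x ω) (v ω) := by
  refine (WithLp.measurable_toLp 2 (Fin (d i) → ℝ)).comp (f := fun ω j => Γ.gradg t i (x ω) (v ω) j)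
    (measurable_pi_lambda _ fun j => ?_)
  have h : ∀ ω, Γ.gradg t i (x ω) (v ω) j
      = inner ℝ (v ω) (fderiv ℝ (Γ.g t i) (x ω) (EuclideanSpace.single j 1)) := by
    intro ω
    rw [← inner_gradg]
    simp [EuclideanSpace.inner_single_right]
  simp only [h]
  exact hv.inner ((measurable_fderiv_apply_const ℝ (Γ.g t i) _).comp hx)

lemma measurable_comp_of_continuousOn [mΩ : MeasurableSpace Ω] {k l : ℕ} {X : Set (Eu k)}
    {f : Eu k → Eu l} (hf : ContinuousOn f X) {x : Ω → Eu k} (hx : Measurable x)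
    (hxX : ∀ ω, x ω ∈ X) : Measurable fun ω => f (x ω) :=
  (continuousOn_iff_continuous_domRestrict.1 hf).measurable.comp (hx.subtype_mk (h := hxX))

lemma WellPosed.measurable_qs [mΩ : MeasurableSpace Ω] (hwp : Γ.WellPosed) (t : ℕ) (i : Fin N)
    {x : Ω → Eu (d i)} {y : Ω → Eu n} {s : Ω → Eu (q i)} (hx : Measurable x)
    (hxX : ∀ ω, x ω ∈ Γ.X i) (hy : Measurable y) (hs : Measurable s) :
    Measurable fun ω => Γ.qs t i (x ω) (y ω) (s ω) :=
  Measurable.comp (g := fun z : Γ.X i × Eu n × Eu (q i) => Γ.qs t i (z.1 : Eu (d i)) z.2.1 z.2.2)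
    (f := fun ω => ((⟨x ω, hxX ω⟩ : Γ.X i), y ω, s ω)) (hwp.measurable t i)
    (Measurable.prodMk (hx.subtype_mk (h := hxX)) (Measurable.prodMk hy hs))

/-- All components of a random state of the algorithm are measurable. -/
structure MeasurableState [mΩ : MeasurableSpace Ω] (st : Ω → AlgState N m n d) : Prop where
  z : ∀ i, Measurable fun ω => (st ω).z i
  x : ∀ i, Measurable fun ω => (st ω).x i
  μ : ∀ i, Measurable fun ω => (st ω).μ i
  σ : ∀ i, Measurable fun ω => (st ω).σ i

lemma MeasurableState.aggEstimate [mΩ : MeasurableSpace Ω] {st : Ω → AlgState N m n d}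
    (h : MeasurableState st) (w : ℕ → Matrix (Fin N) (Fin N) ℝ) (t : ℕ) (i : Fin N) :
    Measurable fun ω => aggEstimate w (st ω) t i :=
  (Finset.measurable_fun_sum _ fun j _ => (h.z j).const_mul _).inv.smul
    (Finset.measurable_fun_sum _ fun j _ => (h.σ j).const_smul (w t i j))

lemma MeasurableState.algStep [mΩ : MeasurableSpace Ω] (hwp : Γ.WellPosed) (hreg : Γ.Regular)
    {st : Ω → AlgState N m n d} (h : MeasurableState st) (hX : ∀ ω i, (st ω).x i ∈ Γ.X i)
    (w : ℕ → Matrix (Fin N) (Fin N) ℝ) (t : ℕ) (a b c : ℝ) {s : (i : Fin N) → Ω → Eu (q i)}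
    (hs : ∀ i, Measurable (s i)) :
    MeasurableState fun ω => Γ.algStep t (w t) a b c (fun i => s i ω) (st ω) := by
  have hz : ∀ i, Measurable fun ω => ∑ j, w t i j * (st ω).z j := fun i =>
    Finset.measurable_fun_sum _ fun j _ => (h.z j).const_mul _
  have hμ : ∀ i, Measurable fun ω => ∑ j, w t i j • (st ω).μ j := fun i =>
    Finset.measurable_fun_sum _ fun j _ => (h.μ j).const_smul (w t i j)
  have hσ : ∀ i, Measurable fun ω => ∑ j, w t i j • (st ω).σ j := fun i =>
    Finset.measurable_fun_sum _ fun j _ => (h.σ j).const_smul (w t i j)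
  have hx' : ∀ i, Measurable fun ω =>
      (Γ.algStep t (w t) a b c (fun i => s i ω) (st ω)).x i := by
    intro i
    refine (continuous_proj (hreg.nonempty i) (hreg.compact i).isClosed
      (hreg.convex i)).measurable.comp ((h.x i).sub (Measurable.const_smul (Measurable.add ?_ ?_) a))
    · exact hwp.measurable_qs t i (h.x i) (fun ω => hX ω i) (h.aggEstimate w t i) (hs i)
    · exact measurable_gradg t i (h.x i) ((hz i).inv.smul (hμ i))
  have hX' : ∀ ω i, (Γ.algStep t (w t) a b c (fun i => s i ω) (st ω)).x i ∈ Γ.X i := fun ω i =>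
    proj_mem (hreg.nonempty i) (hreg.compact i).isClosed _
  refine ⟨hz, hx', fun i => ?_, fun i => ?_⟩
  · refine (continuous_proj ⟨0, zero_mem_nonnegOrthant⟩ isClosed_nonnegOrthant
      convex_nonnegOrthant).measurable.comp ((hμ i).add (Measurable.const_smul (Measurable.sub ?_
        ((hμ i).const_smul b)) c))
    exact measurable_comp_of_continuousOn (hreg.continuousOn_g t i) (h.x i) fun ω => hX ω i
  · exact ((hσ i).add (measurable_comp_of_continuousOn (hreg.continuousOn_ψ i) (hx' i)
      fun ω => hX' ω i)).sub
      (measurable_comp_of_continuousOn (hreg.continuousOn_ψ i) (h.x i) fun ω => hX ω i)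

lemma MeasurableState.mono {m₁ m₂ : MeasurableSpace Ω} (hle : m₁ ≤ m₂)
    {st : Ω → AlgState N m n d} (h : MeasurableState (mΩ := m₁) st) :
    MeasurableState (mΩ := m₂) st :=
  ⟨fun i => (MeasurableState.z (mΩ := m₁) h i).mono hle le_rfl,
    fun i => (MeasurableState.x (mΩ := m₁) h i).mono hle le_rfl,
    fun i => (MeasurableState.μ (mΩ := m₁) h i).mono hle le_rfl,
    fun i => (MeasurableState.σ (mΩ := m₁) h i).mono hle le_rfl⟩

end Measurability

end AggGame

lemma monotone_sampleFiltration {Ω : Type*} {N : ℕ} {q : Fin N → ℕ}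
    (ξ : (i : Fin N) → ℕ → Ω → Eu (q i)) : Monotone (sampleFiltration ξ) := fun _ _ hst =>
  iSup_mono fun _ => iSup_mono fun _ => iSup_mono' fun hs => ⟨hs.trans_le hst, le_rfl⟩

lemma measurable_sample_succ {Ω : Type*} {N : ℕ} {q : Fin N → ℕ}
    (ξ : (i : Fin N) → ℕ → Ω → Eu (q i)) (i : Fin N) (t : ℕ) :
    Measurable[sampleFiltration ξ (t + 1)] (ξ i t) :=
  Measurable.mono (comap_measurable (ξ i t))
    (le_iSup_of_le i (le_iSup_of_le t (le_iSup_of_le (Nat.lt_succ_self t) le_rfl))) le_rfl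

/-- The natural filtration of the samples. -/
def naturalFiltration {Ω : Type*} [m0 : MeasurableSpace Ω] {N : ℕ} {q : Fin N → ℕ}
    (ξ : (i : Fin N) → ℕ → Ω → Eu (q i)) (hξ : ∀ i t, Measurable (ξ i t)) : Filtration ℕ m0 where
  seq := sampleFiltration ξ
  mono' := monotone_sampleFiltration ξ
  le' _ := iSup_le fun i => iSup_le fun s => iSup_le fun _ => (hξ i s).comap_le

namespace AggGame

variable {N m n : ℕ} {d q : Fin N → ℕ} {Γ : AggGame N m n d q}

lemma algRun_x_mem (hreg : Γ.Regular) (w : ℕ → Matrix (Fin N) (Fin N) ℝ) (α β γ : ℕ → ℝ)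
    {x₀ : (i : Fin N) → Eu (d i)} (hx₀ : ∀ i, x₀ i ∈ Γ.X i) (s : (i : Fin N) → ℕ → Eu (q i))
    (t : ℕ) (i : Fin N) : (Γ.algRun w α β γ x₀ s t).x i ∈ Γ.X i := by
  cases t with
  | zero => exact hx₀ i
  | succ t => exact proj_mem (hreg.nonempty i) (hreg.compact i).isClosed _

/-- The state at time `t` is determined by the samples before `t`. -/
lemma measurableState_algRun {Ω : Type*} (hwp : Γ.WellPosed) (hreg : Γ.Regular)
    (w : ℕ → Matrix (Fin N) (Fin N) ℝ) (α β γ : ℕ → ℝ) {x₀ : (i : Fin N) → Eu (d i)}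
    (hx₀ : ∀ i, x₀ i ∈ Γ.X i) (ξ : (i : Fin N) → ℕ → Ω → Eu (q i)) (t : ℕ) :
    MeasurableState (mΩ := sampleFiltration ξ t)
      fun ω => Γ.algRun w α β γ x₀ (fun i t => ξ i t ω) t := by
  induction t with
  | zero =>
    exact MeasurableState.mk (mΩ := sampleFiltration ξ 0) (fun _ => measurable_const)
      (fun _ => measurable_const) (fun _ => measurable_const) (fun _ => measurable_const)
  | succ t ih =>
    exact MeasurableState.algStep (mΩ := sampleFiltration ξ (t + 1)) hwp hreg
      (MeasurableState.mono (m₁ := sampleFiltration ξ t)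
        (monotone_sampleFiltration ξ (Nat.le_succ t)) ih)
      (fun ω i => algRun_x_mem hreg w α β γ hx₀ _ t i) w t (α t) (β t) (γ t)
      fun i => measurable_sample_succ ξ i t

end AggGame

/-! ### The gradient noise along the algorithm -/

lemma stronglyMeasurable_sum_mul_inner {Ω : Type*} [mΩ : MeasurableSpace Ω] {N : ℕ}
    {d : Fin N → ℕ} (a : ℝ) {f g : (i : Fin N) → Ω → Eu (d i)} (hf : ∀ i, Measurable (f i))
    (hg : ∀ i, Measurable (g i)) :
    StronglyMeasurable fun ω => ∑ i, a * inner ℝ (f i ω) (g i ω) :=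
  (Finset.measurable_fun_sum _ fun i _ => ((hf i).inner (hg i)).const_mul a).stronglyMeasurable

/-- Centered vectors paired with predictable ones have zero conditional expectation. -/
lemma condExp_mul_inner_sub_condExp {Ω : Type*} {m m0 : MeasurableSpace Ω} {P : Measure Ω}
    [IsProbabilityMeasure P] (hm : m ≤ m0) {k : ℕ} {f g : Ω → Eu k}
    {S D : ℝ} (hf : AEStronglyMeasurable f P) (hfS : ∀ᵐ ω ∂P, ‖f ω‖ ≤ S)
    (hcS : ∀ᵐ ω ∂P, ‖P[f | m] ω‖ ≤ S) (hg : StronglyMeasurable[m] g) (hgD : ∀ ω, ‖g ω‖ ≤ D)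
    (a : ℝ) :
    Integrable (fun ω => a * inner ℝ (f ω - P[f | m] ω) (g ω)) P ∧
    P[fun ω => a * inner ℝ (f ω - P[f | m] ω) (g ω) | m] =ᵐ[P] 0 := by
  have hfi : Integrable f P := Integrable.of_bound hf S hfS
  have hci : Integrable (P[f | m]) P := integrable_condExp
  have hgm : AEStronglyMeasurable g P := (hg.mono hm).aestronglyMeasurable
  have hint : Integrable (fun ω => inner ℝ ((f - P[f | m]) ω) (g ω)) P := by
    refine Integrable.of_bound ((hf.sub hci.1).inner hgm) ((S + S) * D) ?_
    filter_upwards [hfS, hcS] with ω h1 h2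
    refine (norm_inner_le_norm _ _).trans ?_
    exact mul_le_mul ((norm_sub_le _ _).trans (add_le_add h1 h2)) (hgD ω) (norm_nonneg _)
      (add_nonneg ((norm_nonneg _).trans h1) ((norm_nonneg _).trans h2))
  refine ⟨hint.const_mul a, ?_⟩
  have h1 := condExp_bilin_of_stronglyMeasurable_right (innerSL ℝ) (f := f - P[f | m]) hg
    (μ := P) hint (hfi.sub hci)
  have h2 := condExp_sub hfi hci m
  have h3 : P[P[f | m] | m] = P[f | m] :=
    condExp_of_stronglyMeasurable hm stronglyMeasurable_condExp hci
  have h4 := condExp_smul (μ := P) a (fun ω => inner ℝ ((f - P[f | m]) ω) (g ω)) m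
  filter_upwards [h1, h2, h4] with ω e1 e2 e4
  refine e4.trans ?_
  rw [Pi.smul_apply]
  refine (congrArg (a • ·) (e1.trans ?_)).trans (smul_zero a)
  rw [e2, h3]
  simp

namespace GoodOracle

variable {Ω : Type*} [mΩ : MeasurableSpace Ω] {P : Measure Ω} [IsProbabilityMeasure P]
  {N m n : ℕ} {d q : Fin N → ℕ} {Γ : AggGame N m n d q} {ξ : (i : Fin N) → ℕ → Ω → Eu (q i)}

/-- At deterministic points, unbiasedness makes `p` the mean of the sampled gradient, so it inherits
the bound `S`. -/
lemma exists_bound (h : GoodOracle P Γ ξ) :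
    ∃ S > 0, (∀ t i (x : Ω → Eu (d i)) (y : Ω → Eu n), (∀ ω, x ω ∈ Γ.X i) →
      Measurable[sampleFiltration ξ t] x → Measurable[sampleFiltration ξ t] y →
      ∀ᵐ ω ∂P, ‖Γ.qs t i (x ω) (y ω) (ξ i t ω)‖ ≤ S) ∧
      ∀ t i, ∀ x ∈ Γ.X i, ∀ y, ‖Γ.p t i x y‖ ≤ S := by
  obtain ⟨S, hS, hb⟩ := h.bounded
  refine ⟨S, hS, hb, fun t i x hx y => ?_⟩
  have h1 := hb t i (fun _ => x) (fun _ => y) (fun _ => hx) measurable_const measurable_const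
  have h2 := h.unbiased t i (fun _ => x) (fun _ => y) (fun _ => hx) measurable_const
    measurable_const
  have hle : sampleFiltration ξ t ≤ mΩ := (naturalFiltration ξ h.measurable).le t
  have h3 : Γ.p t i x y = ∫ ω, Γ.qs t i x y (ξ i t ω) ∂P := by
    rw [← integral_condExp hle, integral_congr_ae h2]
    simp
  rw [h3]
  simpa using norm_integral_le_of_norm_le_const h1

/-- Along the algorithm, almost surely the sampled gradients are bounded and their accumulated
noise stays bounded below. -/
lemma ae_noise_bounded (h : GoodOracle P Γ ξ) (hwp : Γ.WellPosed) (hreg : Γ.Regular)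
    (hinv : Γ.IsTimeInvariant) {S : ℝ}
    (hb : ∀ t i (x : Ω → Eu (d i)) (y : Ω → Eu n), (∀ ω, x ω ∈ Γ.X i) →
      Measurable[sampleFiltration ξ t] x → Measurable[sampleFiltration ξ t] y →
      ∀ᵐ ω ∂P, ‖Γ.qs t i (x ω) (y ω) (ξ i t ω)‖ ≤ S)
    (hp : ∀ t i, ∀ x ∈ Γ.X i, ∀ y, ‖Γ.p t i x y‖ ≤ S) {α : ℕ → ℝ} (hα : ∀ t, 0 ≤ α t)
    (hsum : Summable fun t => α t ^ 2) {st : Ω → ℕ → AlgState N m n d}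
    (hst : ∀ t, AggGame.MeasurableState (mΩ := sampleFiltration ξ t) fun ω => st ω t)
    (hX : ∀ ω t i, (st ω t).x i ∈ Γ.X i) (w : ℕ → Matrix (Fin N) (Fin N) ℝ)
    {xs : (i : Fin N) → Eu (d i)} (hxs : ∀ i, xs i ∈ Γ.X i) :
    ∀ᵐ ω ∂P,
      (∀ t i, ‖Γ.qs t i ((st ω t).x i) (AggGame.aggEstimate w (st ω t) t i) (ξ i t ω)‖ ≤ S) ∧
      ∃ B, ∀ T, -B ≤ ∑ t ∈ Finset.range T, ∑ i, α t * inner ℝ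
        (Γ.qs t i ((st ω t).x i) (AggGame.aggEstimate w (st ω t) t i) (ξ i t ω)
          - Γ.p 0 i ((st ω t).x i) (AggGame.aggEstimate w (st ω t) t i)) ((st ω t).x i - xs i) := by
  let ℱ := naturalFiltration ξ h.measurable
  obtain ⟨R, hR, hXR⟩ := hreg.exists_norm_le
  let Q : ℕ → (i : Fin N) → Ω → Eu (d i) := fun t i ω =>
    Γ.qs t i ((st ω t).x i) (AggGame.aggEstimate w (st ω t) t i) (ξ i t ω)
  have hx : ∀ t i, Measurable[ℱ t] fun ω => (st ω t).x i := fun t i =>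
    AggGame.MeasurableState.x (mΩ := sampleFiltration ξ t) (hst t) i
  have hy : ∀ t i, Measurable[ℱ t] fun ω => AggGame.aggEstimate w (st ω t) t i := fun t i =>
    AggGame.MeasurableState.aggEstimate (mΩ := sampleFiltration ξ t) (hst t) w t i
  have hQ : ∀ t i, Measurable[ℱ (t + 1)] (Q t i) := fun t i =>
    hwp.measurable_qs (mΩ := ℱ (t + 1)) t i ((hx t i).mono (ℱ.mono (Nat.le_succ t)) le_rfl)
      (fun ω => hX ω t i) ((hy t i).mono (ℱ.mono (Nat.le_succ t)) le_rfl)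
      (measurable_sample_succ ξ i t)
  have hQS : ∀ t i, ∀ᵐ ω ∂P, ‖Q t i ω‖ ≤ S := fun t i =>
    hb t i _ _ (fun ω => hX ω t i) (hx t i) (hy t i)
  have hc : ∀ t i, P[Q t i | ℱ t]
      =ᵐ[P] fun ω => Γ.p t i ((st ω t).x i) (AggGame.aggEstimate w (st ω t) t i) := fun t i =>
    h.unbiased t i _ _ (fun ω => hX ω t i) (hx t i) (hy t i)
  have hcS : ∀ t i, ∀ᵐ ω ∂P, ‖P[Q t i | ℱ t] ω‖ ≤ S := fun t i => by
    filter_upwards [hc t i] with ω hω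
    rw [hω]
    exact hp t i _ (hX ω t i) _
  have hxD : ∀ t i ω, ‖(st ω t).x i - xs i‖ ≤ 2 * R := fun t i ω =>
    (norm_sub_le _ _).trans (by linarith [hXR i _ (hX ω t i), hXR i _ (hxs i)])
  have hgm : ∀ t i, Measurable[ℱ t] fun ω => (st ω t).x i - xs i := fun t i =>
    Measurable.sub_const (m := ℱ t) (hx t i) (xs i)
  have hcond := fun t i => condExp_mul_inner_sub_condExp (ℱ.le t)
    (((hQ t i).mono (ℱ.le _) le_rfl).aestronglyMeasurable) (hQS t i) (hcS t i)
    (hgm t i).stronglyMeasurable (hxD t i) (α t)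
  -- The noise is centred at the conditional expectation, which is measurable by construction; it is
  -- replaced by `p` only at the end, almost surely, so no measurability of `p` is needed.
  let D : ℕ → Ω → ℝ := fun t ω =>
    ∑ i, α t * inner ℝ (Q t i ω - P[Q t i | ℱ t] ω) ((st ω t).x i - xs i)
  have hD : ∀ᵐ ω ∂P, ∃ B, ∀ T, -B ≤ ∑ t ∈ Finset.range T, D t ω := by
    refine ae_exists_forall_neg_le_sum_of_condExp_eq_zero ℱ
      (a := fun t => α t * (N * ((S + S) * (2 * R)))) (fun t => ?_) (fun t => ?_) (fun t => ?_) ?_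
    · refine stronglyMeasurable_sum_mul_inner (mΩ := ℱ (t + 1)) (α t) (fun i => ?_) (fun i => ?_)
      · exact Measurable.sub (m := ℱ (t + 1)) (hQ t i)
          (stronglyMeasurable_condExp.measurable.mono (ℱ.mono (Nat.le_succ t)) le_rfl)
      · exact (hgm t i).mono (ℱ.mono (Nat.le_succ t)) le_rfl
    · filter_upwards [ae_all_iff.2 (hQS t), ae_all_iff.2 (hcS t)] with ω h1 h2
      refine (Finset.abs_sum_le_sum_abs _ _).trans ?_
      calc ∑ i, |α t * inner ℝ (Q t i ω - P[Q t i | ℱ t] ω) ((st ω t).x i - xs i)|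
          ≤ ∑ i : Fin N, α t * ((S + S) * (2 * R)) := by
            refine Finset.sum_le_sum fun i _ => ?_
            rw [abs_mul, abs_of_nonneg (hα t)]
            refine mul_le_mul_of_nonneg_left ((abs_real_inner_le_norm _ _).trans ?_) (hα t)
            exact mul_le_mul ((norm_sub_le _ _).trans (add_le_add (h1 i) (h2 i))) (hxD t i ω)
              (norm_nonneg _) (add_nonneg ((norm_nonneg _).trans (h1 i))
                ((norm_nonneg _).trans (h2 i)))
        _ = _ := by
            rw [Finset.sum_const, Finset.card_univ, Fintype.card_fin, nsmul_eq_mul]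
            ring
    · have e1 : D t = ∑ i, fun ω =>
          α t * inner ℝ (Q t i ω - P[Q t i | ℱ t] ω) ((st ω t).x i - xs i) := by
        funext ω
        simp [D, Finset.sum_apply]
      have e2 := condExp_finsetSum (μ := P) (s := Finset.univ) (f := fun i ω =>
        α t * inner ℝ (Q t i ω - P[Q t i | ℱ t] ω) ((st ω t).x i - xs i))
        (fun i _ => (hcond t i).1) (ℱ t)
      rw [e1]
      filter_upwards [e2, ae_all_iff.2 fun i => (hcond t i).2] with ω h1 h2
      rw [h1, Finset.sum_apply]
      exact Finset.sum_eq_zero fun i _ => h2 i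
    · refine (hsum.mul_right ((N * ((S + S) * (2 * R))) ^ 2)).congr fun t => by ring
  filter_upwards [ae_all_iff.2 fun t => ae_all_iff.2 (hQS t), hD,
    ae_all_iff.2 fun t => ae_all_iff.2 (hc t)] with ω h1 h2 h3
  refine ⟨h1, ?_⟩
  obtain ⟨B, hB⟩ := h2
  refine ⟨B, fun T => (hB T).trans_eq ?_⟩
  refine Finset.sum_congr rfl fun t _ => Finset.sum_congr rfl fun i _ => ?_
  rw [h3 t i, hinv.p_eq t]

end GoodOracle

end

/-! ### The main theorem -/

theorem theorem2 {N m n : ℕ} (hN : 0 < N) {d q : Fin N → ℕ} (Γ : AggGame N m n d q)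
    {Ω : Type*} [MeasurableSpace Ω] (P : Measure Ω) [IsProbabilityMeasure P]
    (ξ : (i : Fin N) → ℕ → Ω → Eu (q i))
    (w : ℕ → Matrix (Fin N) (Fin N) ℝ)
    (α β γ : ℕ → ℝ)
    (x₀ : (i : Fin N) → Eu (d i))
    (hwp : Γ.WellPosed)
    (hinv : Γ.IsTimeInvariant)
    (hw : GoodWeights w)
    (hreg : Γ.Regular)
    (hlip : Γ.GradLipschitz)
    (horacle : GoodOracle P Γ ξ)
    (hmono : Γ.StrictlyMonotone 0)
    (hx₀ : ∀ i, x₀ i ∈ Γ.X i)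
    (hα : ∀ t, 0 < α t ∧ α t ≤ 1) (hα' : Antitone α)
    (hβ : ∀ t, 0 < β t ∧ β t ≤ 1) (hβ' : Antitone β)
    (hαγ : ∀ t, α t = γ t)
    (hsum : Tendsto (fun T : ℕ => ∑ t ∈ Finset.Icc 1 T, α t) atTop atTop)
    (hsum_sq : Summable fun t => α t ^ 2)
    (hsum_sq_div_sq : Summable fun t => α t ^ 2 / β t ^ 2)
    (hsum_mul : Summable fun t => α t * β t)
    (hsum_sq_div : Summable fun t => α t ^ 2 / β t) :
    ∃ xs : (i : Fin N) → Eu (d i),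
      Γ.IsVGNE 0 xs ∧ (∀ y, Γ.IsVGNE 0 y → y = xs) ∧
      ∀ᵐ ω ∂P, Tendsto
        (fun t => (Γ.algRun w α β γ x₀ (fun i t => ξ i t ω) t).x) atTop (𝓝 xs) := by
  obtain rfl : γ = α := funext fun t => (hαγ t).symm
  obtain ⟨S, hS, hb, hp⟩ := horacle.exists_bound
  obtain ⟨xs, μs, hK⟩ := hreg.exists_isKKT hlip hmono (hp 0)
  refine ⟨xs, hK.isVGNE hreg, fun y hy => ?_, ?_⟩
  · obtain ⟨_, μ, hμ⟩ := hy
    exact hK.unique hmono hreg hμ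
  -- The divergent partial sums omit the term at time `0`; being sums of nonnegative terms over
  -- finite sets, they would still be bounded by a finite total.
  have hns : ¬ Summable γ := by
    intro hs
    obtain ⟨T, hT⟩ := (hsum.eventually_gt_atTop (∑' t, γ t)).exists
    exact absurd hT (not_lt.2 (hs.sum_le_tsum _ fun t _ => (hα t).1.le))
  filter_upwards [horacle.ae_noise_bounded hwp hreg hinv hb hp (fun t => (hα t).1.le) hsum_sq
    (fun t => AggGame.measurableState_algRun hwp hreg w γ β γ hx₀ ξ t)
    (fun ω t i => AggGame.algRun_x_mem hreg w γ β γ hx₀ (fun i t => ξ i t ω) t i) w hK.mem]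
    with ω hω
  obtain ⟨hv, B, hB⟩ := hω
  exact (AggGame.isTrajectory_algRun hinv w γ β hx₀ fun i t => ξ i t ω).tendsto_x hN hreg hw hlip
    hmono hα hα' hβ hβ' hns hsum_sq hsum_sq_div_sq hsum_mul hsum_sq_div hS (hp 0) hv hK hB
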